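/- **Setting.** Let $d\ge1$, $K\ge2$. A $K$-armed bandit machine with covariates is a sequence of independent random vectors $(X_t,Y_t^{(1)},\dots,Y_t^{(K)})$, $t\ge1$, where the covariates $X_t\in[0,1]^d$ are i.i.d. with law $P_X$, the rewards $Y^{(i)}_t$ lie in $[0,1]$, and $\mathbb E[Y_t^{(i)}\mid X_t]=f^{(i)}(X_t)$ with $f^{(i)}:[0,1]^d\to[0,1]$. Write $f^\star=\max_i f^{(i)}$, and let $f^\sharp(x)=\max\{f^{(i)}(x): f^{(i)}(x)<f^\star(x)\}$ if the $f^{(i)}(x)$ are not all equal, $f^\sharp(x)=f^\star(x)$ otherwise. Assume that * $P_X$ has a Lebesgue density on $[0,1]^d$ with values in $[\underline c,\bar c]$, $\underline c,\bar c>0$; * (smoothness) $|f^{(i)}(x)-f^{(i)}(x')|\le L\|x-x'\|^\beta$ for all $x,x'\in[0,1]^d$ and all $i$, where $\beta\in(0,1]$, $L>0$ and $\|\cdot\|$ is the Euclidean norm; * (margin) $P_X\bigl[0<f^\star(X)-f^\sharp(X)\le\delta\bigr]\le C_0\delta^\alpha$ for all $\delta\in[0,\delta_0]$, where $\alpha\in(0,\infty]$,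 $\delta_0\in(0,1)$, $C_0>0$, and $\delta^\infty=0$. The (random) regret at time $n$ of a policy that pulls arm $\pi_t$ at time $t$ is $R_n=\sum_{t=1}^n\bigl(f^\star(X_t)-f^{(\pi_t)}(X_t)\bigr)$. **Policy.** Let $U(\tau,T)=2\sqrt{2(\log(T/\tau)\vee1)/\tau}$. Successive Elimination with parameters $T,\gamma$ and a given initial set of arms works in rounds: in round $\tau=1,2,\dots$ each active arm is pulled once, in increasing order; at the end of round $\tau$ every active arm whose average reward over its $\tau$ pulls is less than the largest such average among active arms minus $\gamma U(\tau,T)$ is eliminated. Adaptively Binned Successive Elimination (ABSE) with horizon $n\ge K\log K$ maintains a partition of $[0,1]^d$ into dyadic cubes ("live bins"), initially $\{[0,1]^d\}$ with all arms active. Each live bin $B$, of side length $|B|$, runs its own Successive Elimination with $T=n|B|^d$, $\gamma=2$ on the times $t$ at which $X_t\in B$. Let $k_0$ be the smallest integer with $2^{-k_0}\le(K\log K/n)^{1/(d+2\beta)}$ and $\ell_B$ the smallest positive integer with $U(\ell_B,n|B|^d)\le 4Ld^{\beta/2}|B|^\beta$. As soon as $\ell_B$ rounds have been completed on $B$, if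 $|B|\ge2^{-k_0+1}$ and at least two arms are active on $B$, the bin $B$ is replaced by the $2^d$ dyadic cubes of side $|B|/2$ that partition it, and on each of them a new Successive Elimination is started with the arms still active on $B$. **Theorem.** There is a constant $C>0$, depending only on $d,\beta,L,\alpha,\underline c,\bar c,\delta_0,C_0$ (in particular not on $K$ or $n$), such that for every $K\ge2$, every integer $n\ge K\log K$ and every machine as above, the regret $R_n$ of ABSE is integrable and 1. if $\alpha<\infty$ and $\alpha\beta\le d$, then $$\mathbb E R_n\le C\,n\Bigl(\frac{K\log K}{n}\Bigr)^{\beta(\alpha+1)/(2\beta+d)};$$ 2. if $\alpha=\infty$, or if $\alpha<\infty$ and $\alpha\beta>d$, then $\mathbb E R_n\le C\,K\log n$. -/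

import Mathlib

open MeasureTheory ProbabilityTheory
open scoped ENNReal

universe u

noncomputable section

namespace CovariateBandit

/-! ## The bandit machine with covariates -/

/-- Covariates live in `ℝ^d` with the Euclidean norm. -/
abbrev Cov (d : ℕ) : Type := EuclideanSpace ℝ (Fin d)

/-- The covariate space `[0,1]^d`. -/
def unitCube (d : ℕ) : Set (Cov d) := {x | ∀ j, 0 ≤ x j ∧ x j ≤ 1}

/-- The pointwise maximum `f⋆` of the mean reward functions. -/
def fStar {d K : ℕ} (f : Fin K → Cov d → ℝ) (x : Cov d) : ℝ := ⨆ i, f i x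

/-- The second pointwise maximum `f♯`: the largest value `f i x` strictly below `f⋆ x`, and
`f⋆ x` if all the arms have the same mean reward at `x`. -/
def fSharp {d K : ℕ} (f : Fin K → Cov d → ℝ) (x : Cov d) : ℝ :=
  if h : (Finset.univ.filter fun i => f i x < fStar f x).Nonempty then
    (Finset.univ.filter fun i => f i x < fStar f x).sup' h fun i => f i x
  else fStar f x

/-- A `K`-armed bandit machine with covariates. `X t` is the covariate and `Y t i` the reward of
arm `i` at time `t` (times are numbered from `0`), `PX` is the common law of the covariates, and
`f i` is the mean reward function of arm `i`. -/
structure IsMachine {Ω : Type*} [MeasurableSpace Ω] (μ : Measure Ω) {d K : ℕ}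
    (PX : Measure (Cov d)) (f : Fin K → Cov d → ℝ)
    (X : ℕ → Ω → Cov d) (Y : ℕ → Fin K → Ω → ℝ) : Prop where
  measurable_X : ∀ t, Measurable (X t)
  measurable_Y : ∀ t i, Measurable (Y t i)
  /-- The random vectors `(X t, Y t 1, …, Y t K)` are independent. -/
  indep : iIndepFun (fun t ω => (X t ω, fun i => Y t i ω)) μ
  /-- The covariates have the common law `PX`. -/
  law_X : ∀ t, μ.map (X t) = PX
  X_mem : ∀ t, ∀ᵐ ω ∂μ, X t ω ∈ unitCube d
  Y_mem : ∀ t i, ∀ᵐ ω ∂μ, 0 ≤ Y t i ω ∧ Y t i ω ≤ 1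
  f_mem : ∀ i, ∀ x ∈ unitCube d, 0 ≤ f i x ∧ f i x ≤ 1
  /-- `E[Y t i | X t] = f i (X t)`. -/
  condExp_Y : ∀ t i,
    μ[Y t i | MeasurableSpace.comap (X t) inferInstance] =ᵐ[μ] fun ω => f i (X t ω)

/-- `PX` has a density with respect to Lebesgue measure on `[0,1]^d` with values in
`[clow, cup]`. -/
def HasBoundedDensity {d : ℕ} (PX : Measure (Cov d)) (clow cup : ℝ) : Prop :=
  ∃ p : Cov d → ℝ, Measurable p ∧ (∀ x ∈ unitCube d, clow ≤ p x ∧ p x ≤ cup) ∧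
    PX = (volume.restrict (unitCube d)).withDensity fun x => ENNReal.ofReal (p x)

/-- Smoothness condition: every `f i` is `(β, L)`-Hölder on `[0,1]^d`. -/
def Smoothness {d K : ℕ} (f : Fin K → Cov d → ℝ) (β L : ℝ) : Prop :=
  ∀ i, ∀ x ∈ unitCube d, ∀ x' ∈ unitCube d, |f i x - f i x'| ≤ L * ‖x - x'‖ ^ β

/-- `δ ^ α` for `δ ∈ [0,1)` and an exponent `α ∈ (0,∞]`, with `δ ^ ∞ = 0`. -/
def marginPow (δ : ℝ) (α : ℝ≥0∞) : ℝ := if α = ⊤ then 0 else δ ^ α.toReal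

/-- Margin condition with parameter `α ∈ (0,∞]` and constants `δ₀`, `C₀`. -/
def Margin {d K : ℕ} (PX : Measure (Cov d)) (f : Fin K → Cov d → ℝ)
    (α : ℝ≥0∞) (δ₀ C₀ : ℝ) : Prop :=
  ∀ δ : ℝ, 0 ≤ δ → δ ≤ δ₀ →
    PX.real {x | 0 < fStar f x - fSharp f x ∧ fStar f x - fSharp f x ≤ δ} ≤ C₀ * marginPow δ α

/-! ## Successive Elimination -/

/-- `log x ∨ 1`. -/
def logBar (x : ℝ) : ℝ := max (Real.log x) 1

/-- `U(τ, T) = 2 √(2 (log(T/τ) ∨ 1) / τ)`, used for `τ ≥ 1` only. -/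
def confU (τ : ℕ) (T : ℝ) : ℝ := 2 * √(2 * logBar (T / τ) / τ)

/-- State of a Successive Elimination policy. -/
structure SEState (K : ℕ) where
  /-- the arms that have not been eliminated -/
  active : Finset (Fin K)
  /-- the active arms still to be pulled in the current round -/
  pending : Finset (Fin K)
  /-- the number of completed rounds -/
  rounds : ℕ
  /-- for each arm, the sum of the rewards it has yielded to this policy -/
  total : Fin K → ℝ

/-- Successive Elimination initialized with the set of arms `I`. -/
def SEState.init {K : ℕ} (I : Finset (Fin K)) : SEState K where
  active := I
  pending := I
  rounds := 0
  total := fun _ => 0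

/-- The arm to pull next: in each round every active arm is pulled once, in increasing order.
(The set of pending arms is never empty when the policy starts with a nonempty set of arms.) -/
def SEState.arm {K : ℕ} [NeZero K] (s : SEState K) : Fin K :=
  if h : s.pending.Nonempty then s.pending.min' h else 0

open Classical in
/-- Update after pulling the arm `s.arm` and observing the reward `y`. When this pull completes
round `τ`, every active arm whose average reward over its `τ` pulls is smaller than
`max - γ U(τ, T)` is eliminated, `max` being the largest average reward of an active arm, and a
new round begins. -/
def SEState.update {K : ℕ} [NeZero K] (T γ : ℝ) (s : SEState K) (y : ℝ) : SEState K :=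
  let total' : Fin K → ℝ := Function.update s.total s.arm (s.total s.arm + y)
  let pending' : Finset (Fin K) := s.pending.erase s.arm
  if pending'.Nonempty then
    { active := s.active, pending := pending', rounds := s.rounds, total := total' }
  else
    let τ : ℕ := s.rounds + 1
    let kept : Finset (Fin K) := s.active.filter fun i =>
      ∀ j ∈ s.active, total' j / τ - γ * confU τ T ≤ total' i / τ
    { active := kept, pending := kept, rounds := τ, total := total' }

/-! ## Dyadic bins -/

/-- A dyadic bin of `[0,1]^d`: the pair `(k, v)` stands for the cube of side `2^{-k}` formed by the
points `x` with `v j ≤ 2^k x_j ≤ v j + 1` for all `j` (up to its boundary). -/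
abbrev Bin (d : ℕ) : Type := ℕ × (Fin d → ℕ)

/-- The side length `|B| = 2^{-k}` of a bin. -/
def Bin.side {d : ℕ} (B : Bin d) : ℝ := (1 / 2 : ℝ) ^ B.1

/-- The bin of depth `k` that contains the covariate `x`. Bins are half-open, except that the
last one in each direction also contains its right end point. -/
def binAt {d : ℕ} (k : ℕ) (x : Cov d) : Bin d :=
  (k, fun j => min ⌊(2 : ℝ) ^ k * x j⌋₊ (2 ^ k - 1))

/-- The `2^d` bins of the next depth that partition the bin `B`. -/
def burst {d : ℕ} (B : Bin d) : Finset (Bin d) :=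
  (Finset.univ : Finset (Fin d → Fin 2)).image fun e => (B.1 + 1, fun j => 2 * B.2 j + (e j : ℕ))

/-! ## Adaptively Binned Successive Elimination -/

/-- `k₀`: the smallest integer with `2^{-k₀} ≤ (K log K / n)^{1/(d+2β)}`. -/
def maxDepth (d K n : ℕ) (β : ℝ) : ℕ :=
  sInf {k : ℕ | (1 / 2 : ℝ) ^ k ≤ ((K : ℝ) * Real.log K / n) ^ (1 / ((d : ℝ) + 2 * β))}

/-- `c₀ = 2 L d^{β/2}`. -/
def c0 (d : ℕ) (β L : ℝ) : ℝ := 2 * L * (d : ℝ) ^ (β / 2)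

/-- The parameter `n |B|^d` of the Successive Elimination policy run on the bin `B`. -/
def binHorizon {d : ℕ} (n : ℕ) (B : Bin d) : ℝ := n * B.side ^ d

/-- `ℓ_B`: the smallest integer with `U(ℓ_B, n|B|^d) ≤ 2 c₀ |B|^β`. -/
def roundLimit {d : ℕ} (n : ℕ) (β L : ℝ) (B : Bin d) : ℕ :=
  sInf {l : ℕ | 1 ≤ l ∧ confU l (binHorizon n B) ≤ 2 * c0 d β L * B.side ^ β}

/-- State of the policy: the current partition and the Successive Elimination policies attached
to the bins (only those attached to live bins are ever used). -/
structure ABSEState (d K : ℕ) where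
  /-- the live bins -/
  live : Finset (Bin d)
  /-- the state of the Successive Elimination policy run on each bin -/
  se : Bin d → SEState K

/-- Initially the whole cube is the only live bin, and all the arms are active on it. -/
def ABSEState.init (d K : ℕ) : ABSEState d K where
  live := {((0 : ℕ), fun _ => (0 : ℕ))}
  se := fun _ => SEState.init Finset.univ

/-- The live bin that contains `x`. -/
def ABSEState.liveBin {d K : ℕ} (s : ABSEState d K) (x : Cov d) : Bin d :=
  binAt (sInf {k : ℕ | binAt k x ∈ s.live}) x

/-- The arm pulled when the covariate is `x`. -/
def ABSEState.arm {d K : ℕ} [NeZero K] (s : ABSEState d K) (x : Cov d) : Fin K :=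
  (s.se (s.liveBin x)).arm

/-- Update after the covariate `x` and the reward `y` have been observed: the Successive
Elimination policy (with `γ = 2`) on the live bin `B` that contains `x` is updated; then, if it has
completed `ℓ_B` rounds, if `|B| ≥ 2^{-k₀+1}`, and if at least two arms are still active, `B` is
replaced in the partition by its children, on which new policies start with the remaining arms. -/
def ABSEState.step {d K : ℕ} [NeZero K] (n : ℕ) (β L : ℝ) (s : ABSEState d K)
    (x : Cov d) (y : ℝ) : ABSEState d K :=
  let B : Bin d := s.liveBin x
  let u : SEState K := (s.se B).update (binHorizon n B) 2 y
  if roundLimit n β L B ≤ u.rounds ∧ B.1 + 1 ≤ maxDepth d K n β ∧ 2 ≤ u.active.card then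
    { live := s.live.erase B ∪ burst B
      se := fun B' => if B' ∈ burst B then SEState.init u.active else Function.update s.se B u B' }
  else
    { live := s.live, se := Function.update s.se B u }

/-- The state of the policy with horizon `n` before time `t`, along covariates `x` and a table `y`
of potential rewards, of which only those of the pulled arms are used. -/
def abseState {d K : ℕ} [NeZero K] (n : ℕ) (β L : ℝ) (x : ℕ → Cov d) (y : ℕ → Fin K → ℝ) :
    ℕ → ABSEState d K
  | 0 => ABSEState.init d K
  | t + 1 =>
    (abseState n β L x y t).step n β L (x t) (y t ((abseState n β L x y t).arm (x t)))

/-- The arm pulled at time `t` by Adaptively Binned Successive Elimination with horizon `n`. -/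
def abseArm {d K : ℕ} [NeZero K] (n : ℕ) (β L : ℝ) (x : ℕ → Cov d) (y : ℕ → Fin K → ℝ)
    (t : ℕ) : Fin K :=
  (abseState n β L x y t).arm (x t)

/-- The cumulative regret of Adaptively Binned Successive Elimination at time `n`; its expectation
is the expected regret. -/
def abseRegret {Ω : Type*} {d K : ℕ} [NeZero K] (n : ℕ) (β L : ℝ) (f : Fin K → Cov d → ℝ)
    (X : ℕ → Ω → Cov d) (Y : ℕ → Fin K → Ω → ℝ) (ω : Ω) : ℝ :=
  ∑ t ∈ Finset.range n,
    (fStar f (X t ω) - f (abseArm n β L (fun s => X s ω) (fun s i => Y s i ω) t) (X t ω))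

end CovariateBandit

end

/-! The regret is charged to bins. Along a fixed path, a bin has failed once the average reward of
some arm over one of its first `roundLimit` pulls there is further than `U/2` from its mean over the
bin. On a bin that has not failed and is not of maximal depth, an arm that is optimal somewhere
survives, and at a split the survivors lose at most a constant times `|B|^β` everywhere on the bin.
Hence (`guarantee`), below ancestors that have not failed, the regret at depth `k` is at most
`gapBound`, of order `2^{-kβ}`. A nonzero regret is at least the gap `f⋆ - f♯`, so a regret of at
most `δ` is paid only on the margin set of level `δ` (`regret_le_indicator`). Thus (`regret_le`) the
regret of one step is charged to the exploration of the current bin, to the shallowest failed bin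
among it and its ancestors, or to the maximal depth. A bin that has completed its rounds without
being split, below the maximal depth and without failure, keeps a single arm and costs nothing.

In expectation, the point is that the past decides whether a bin `A` is live, unfinished or failed,
and `X t` is independent of the past. Let `M` be the margin set of depth `k` and `ℓ` the number of
rounds on `A`. As `A` is explored at most `K ℓ` times, its exploration hits `M` at most `P(M ∩ A) /
P(A) * K ℓ` times on average. A failure has probability `O(K ℓ / (n |A|^d))`, by Ville's inequality
for exponential supermartingales and peeling over dyadic numbers of pulls
(`IsMachine.measure_failed_le`); over `n` steps this costs the same order. Summing over `A`, depth
`k` contributes about `P(M) 2^{-kβ} K ℓ 2^{kd}`, with `ℓ` of order `2^{2kβ}` times a logarithm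
(`IsMachine.integral_abseRegret_le`, `exists_roundLimit_le`).

If `αβ ≤ d`, the margin condition turns this into `K 2^{ks}` times the logarithm, with `s = d + β -
αβ > 0`. The logarithm is at most of order `log K` times the number of depths that remain, so the
deepest bins dominate and give the rate (`depth_sum_le_of_margin`). If `αβ > d`, small positive gaps
are impossible: next to the boundary of the region where an arm is optimal, a cell of side `h` would
have mass of order at least `h^d` and at most `h^{αβ}` (`exists_marginSet_eq_empty`). So only
boundedly many depths contribute, each of them `O(K log n)` (`depth_sum_le_of_gap`). -/

noncomputable section

namespace CovariateBandit

/-! ### Dyadic bins -/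

section Bins

variable {d : ℕ}

/-- The points of the unit cube that belong to the bin `A`. -/
def cell (A : Bin d) : Set (Cov d) := {x | x ∈ unitCube d ∧ binAt A.1 x = A}

@[simp] lemma binAt_fst (k : ℕ) (x : Cov d) : (binAt k x).1 = k := rfl

/-- Integer halving commutes with the floor and sends the truncation level `2 ^ (k + 1) - 1` to `2 ^
k - 1`. The bins are therefore nested although the last one in each direction is closed. -/
lemma binAt_snd_div (k : ℕ) (x : Cov d) (j : Fin d) :
    (binAt (k + 1) x).2 j / 2 = (binAt k x).2 j := by
  have h1 : ⌊(2 : ℝ) ^ (k + 1) * x j⌋₊ / 2 = ⌊(2 : ℝ) ^ k * x j⌋₊ := by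
    have := Nat.floor_div_natCast ((2 : ℝ) ^ (k + 1) * x j) 2
    rw [← this]; congr 1; push_cast; ring
  have hp : 1 ≤ 2 ^ k := Nat.one_le_two_pow
  have h2 : (2 ^ (k + 1) - 1) / 2 = 2 ^ k - 1 := by rw [pow_succ]; omega
  simp only [binAt]
  rw [← h1, ← h2]
  omega

lemma binAt_eq_of_succ {k : ℕ} {x z : Cov d} (h : binAt (k + 1) x = binAt (k + 1) z) :
    binAt k x = binAt k z := by
  refine Prod.ext rfl (funext fun j => ?_)
  rw [← binAt_snd_div k x, ← binAt_snd_div k z, h]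

lemma binAt_eq_of_le {k m : ℕ} (hkm : k ≤ m) {x z : Cov d} (h : binAt m x = binAt m z) :
    binAt k x = binAt k z := by
  induction m, hkm using Nat.le_induction with
  | base => exact h
  | succ m _ ih => exact ih (binAt_eq_of_succ h)

lemma mem_burst {A B : Bin d} : A ∈ burst B ↔ A.1 = B.1 + 1 ∧ ∀ j, A.2 j / 2 = B.2 j := by
  simp only [burst, Finset.mem_image, Finset.mem_univ, true_and]
  constructor
  · rintro ⟨e, rfl⟩
    refine ⟨rfl, fun j => ?_⟩
    have := (e j).2
    simp only
    omega
  · rintro ⟨h1, h2⟩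
    refine ⟨fun j => ⟨A.2 j % 2, Nat.mod_lt _ two_pos⟩, Prod.ext h1.symm (funext fun j => ?_)⟩
    have := h2 j
    simp only
    omega

lemma binAt_mem_burst {B : Bin d} {m : ℕ} {x : Cov d} :
    binAt m x ∈ burst B ↔ m = B.1 + 1 ∧ binAt B.1 x = B := by
  rw [mem_burst]
  constructor
  · rintro ⟨rfl : m = B.1 + 1, h⟩
    exact ⟨rfl, Prod.ext rfl (funext fun j => by rw [← binAt_snd_div]; exact h j)⟩
  · rintro ⟨rfl, h⟩
    exact ⟨rfl, fun j => by rw [binAt_snd_div, h]⟩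

lemma cell_subset {A : Bin d} : cell A ⊆ unitCube d := fun _ h => h.1

lemma mem_cell_binAt {x : Cov d} (hx : x ∈ unitCube d) (k : ℕ) : x ∈ cell (binAt k x) := ⟨hx, rfl⟩

lemma cell_subset_of_le {k m : ℕ} (hkm : k ≤ m) (x : Cov d) :
    cell (binAt m x) ⊆ cell (binAt k x) :=
  fun _ hz => ⟨hz.1, binAt_eq_of_le hkm hz.2⟩

lemma side_pos (A : Bin d) : 0 < A.side := by unfold Bin.side; positivity

lemma side_le_one (A : Bin d) : A.side ≤ 1 := by
  unfold Bin.side; exact pow_le_one₀ (by norm_num) (by norm_num)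

lemma isClosed_unitCube : IsClosed (unitCube d) := by
  have : unitCube d = ⋂ j, {x : Cov d | 0 ≤ x j} ∩ {x : Cov d | x j ≤ 1} := by
    ext x; simp [unitCube]
  rw [this]
  exact isClosed_iInter fun j =>
    (isClosed_le (by fun_prop) (by fun_prop)).inter (isClosed_le (by fun_prop) (by fun_prop))

lemma measurableSet_unitCube : MeasurableSet (unitCube d) := isClosed_unitCube.measurableSet

lemma isCompact_unitCube : IsCompact (unitCube d) := by
  have h : unitCube d = (EuclideanSpace.equiv (Fin d) ℝ) ⁻¹' (Set.Icc 0 1) := by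
    ext x
    simp [unitCube, Pi.le_def, forall_and]
  rw [h]
  exact (EuclideanSpace.equiv (Fin d) ℝ).toHomeomorph.isClosedEmbedding.isCompact_preimage
    isCompact_Icc

lemma convex_unitCube : Convex ℝ (unitCube d) := by
  intro x hx y hy a b ha hb hab j
  have := hx j; have := hy j
  simp only [PiLp.add_apply, PiLp.smul_apply, smul_eq_mul]
  constructor
  · nlinarith
  · nlinarith

lemma measurable_binAt (k : ℕ) : Measurable (binAt k : Cov d → Bin d) := by
  refine Measurable.prodMk measurable_const (measurable_pi_lambda _ fun j => ?_)
  exact Measurable.min (Nat.measurable_floor.comp (by fun_prop)) measurable_const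

lemma measurableSet_cell (A : Bin d) : MeasurableSet (cell A) :=
  measurableSet_unitCube.inter (measurable_binAt A.1 (measurableSet_singleton A))

lemma abs_sub_le_of_binAt_eq {k : ℕ} {x z : Cov d} (hx : x ∈ unitCube d) (hz : z ∈ unitCube d)
    (h : binAt k x = binAt k z) (j : Fin d) : |x j - z j| ≤ (1 / 2 : ℝ) ^ k := by
  have key : ∀ w ∈ unitCube d, ((binAt k w).2 j : ℝ) ≤ 2 ^ k * w j ∧
      2 ^ k * w j ≤ (binAt k w).2 j + 1 := by
    intro w hw
    have hp : (0 : ℝ) < 2 ^ k := by positivity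
    have hw' := hw j
    have h0 : 0 ≤ (2 : ℝ) ^ k * w j := mul_nonneg hp.le hw'.1
    have h1 : (2 : ℝ) ^ k * w j ≤ 2 ^ k := by nlinarith
    have hf := Nat.floor_le h0
    have hf' := (Nat.lt_floor_add_one ((2 : ℝ) ^ k * w j)).le
    have h2 : ((2 ^ k - 1 : ℕ) : ℝ) + 1 = 2 ^ k := by
      rw [Nat.cast_sub Nat.one_le_two_pow]; push_cast; ring
    simp only [binAt, Nat.cast_min]
    refine ⟨(min_le_left _ _).trans hf, ?_⟩
    -- Where the truncation acts, the upper bound comes from `w j ≤ 1` and no longer from the floor.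
    rcases le_total ((⌊(2 : ℝ) ^ k * w j⌋₊ : ℝ)) ((2 ^ k - 1 : ℕ) : ℝ) with h | h
    · rw [min_eq_left h]; exact hf'
    · rw [min_eq_right h, h2]; exact h1
  have hx' := key x hx
  have hz' := key z hz
  rw [h] at hx'
  have hp : (0 : ℝ) < 2 ^ k := by positivity
  have h3 : |(2 : ℝ) ^ k * x j - 2 ^ k * z j| ≤ 1 := by
    rw [abs_le]; constructor <;> linarith
  rw [← mul_sub, abs_mul, abs_of_pos hp] at h3
  rw [one_div, inv_pow, ← one_div, le_div_iff₀ hp]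
  linarith

lemma norm_sub_le_of_mem_cell {A : Bin d} {x z : Cov d} (hx : x ∈ cell A) (hz : z ∈ cell A) :
    ‖x - z‖ ≤ √d * A.side := by
  have h : ∀ j, (x j - z j) ^ 2 ≤ A.side ^ 2 := fun j =>
    sq_le_sq' (abs_le.mp (abs_sub_le_of_binAt_eq hx.1 hz.1 (hx.2.trans hz.2.symm) j)).1
      (abs_le.mp (abs_sub_le_of_binAt_eq hx.1 hz.1 (hx.2.trans hz.2.symm) j)).2
  rw [EuclideanSpace.norm_eq]
  calc √(∑ j, ‖(x - z) j‖ ^ 2) ≤ √(∑ _j : Fin d, A.side ^ 2) := by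
        apply Real.sqrt_le_sqrt
        refine Finset.sum_le_sum fun j _ => ?_
        rw [Real.norm_eq_abs, sq_abs]; exact h j
    _ = √d * A.side := by
        rw [Finset.sum_const, Finset.card_univ, Fintype.card_fin, nsmul_eq_mul,
          Real.sqrt_mul (by positivity), Real.sqrt_sq (side_pos A).le]

/-- Oscillation of the mean rewards over a cell. -/
lemma abs_sub_le_of_mem_cell {K : ℕ} {f : Fin K → Cov d → ℝ} {β L : ℝ} (hβ : 0 < β) (hL : 0 < L)
    (hf : Smoothness f β L) {A : Bin d} {x z : Cov d} (hx : x ∈ cell A) (hz : z ∈ cell A)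
    (i : Fin K) : |f i x - f i z| ≤ c0 d β L / 2 * A.side ^ β := by
  refine (hf i x hx.1 z hz.1).trans ?_
  have h := Real.rpow_le_rpow (norm_nonneg _) (norm_sub_le_of_mem_cell hx hz) hβ.le
  rw [Real.mul_rpow (Real.sqrt_nonneg _) (side_pos A).le, Real.sqrt_eq_rpow,
    ← Real.rpow_mul (by positivity)] at h
  calc L * ‖x - z‖ ^ β ≤ L * ((d : ℝ) ^ (1 / 2 * β) * A.side ^ β) := by gcongr
    _ = c0 d β L / 2 * A.side ^ β := by
      unfold c0; rw [show 1 / 2 * β = β / 2 by ring]; ring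

/-- The bins of depth `k`. -/
def bins (d k : ℕ) : Finset (Bin d) :=
  (Finset.univ : Finset (Fin d → Fin (2 ^ k))).image fun v => (k, fun j => (v j : ℕ))

lemma mem_bins {k : ℕ} {A : Bin d} : A ∈ bins d k ↔ A.1 = k ∧ ∀ j, A.2 j < 2 ^ k := by
  simp only [bins, Finset.mem_image, Finset.mem_univ, true_and]
  constructor
  · rintro ⟨v, rfl⟩
    exact ⟨rfl, fun j => (v j).2⟩
  · rintro ⟨h1, h2⟩
    exact ⟨fun j => ⟨A.2 j, h2 j⟩, Prod.ext h1.symm rfl⟩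

lemma binAt_mem_bins (k : ℕ) (x : Cov d) : binAt k x ∈ bins d k := by
  rw [mem_bins]
  refine ⟨rfl, fun j => ?_⟩
  have : 1 ≤ 2 ^ k := Nat.one_le_two_pow
  simp only [binAt]
  omega

lemma pairwise_disjoint_cell {A B : Bin d} (hAB : A.1 = B.1) (h : A ≠ B) :
    Disjoint (cell A) (cell B) := by
  rw [Set.disjoint_left]
  rintro x ⟨_, h1⟩ ⟨_, h2⟩
  rw [← hAB, h1] at h2
  exact h h2

/-- The cell contains a half-open box of side `2^{-k}`, which is all that a lower bound needs; the
closed faces at coordinate one need no separate treatment. -/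
lemma volume_cell_ge {k : ℕ} {A : Bin d} (hA : A ∈ bins d k) :
    ENNReal.ofReal ((1 / 2 : ℝ) ^ (k * d)) ≤ volume (cell A) := by
  obtain ⟨h1, h2⟩ := mem_bins.mp hA
  have hp : (0 : ℝ) < 2 ^ k := by positivity
  set S : Set (Fin d → ℝ) :=
    Set.univ.pi fun j => Set.Ico ((A.2 j : ℝ) / 2 ^ k) ((A.2 j + 1 : ℝ) / 2 ^ k) with hS
  have hvol : volume S = ENNReal.ofReal ((1 / 2 : ℝ) ^ (k * d)) := by
    rw [hS, Real.volume_pi_Ico, ← ENNReal.ofReal_prod_of_nonneg]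
    · congr 1
      rw [Finset.prod_congr rfl (g := fun _ => (1 / 2 : ℝ) ^ k)]
      · simp [pow_mul]
      · intro j _
        rw [← sub_div, add_sub_cancel_left, one_div, one_div, inv_pow]
    · intro j _
      rw [← sub_div]; apply div_nonneg _ hp.le; linarith
  have hmp := EuclideanSpace.volume_preserving_symm_measurableEquiv_toLp (Fin d)
  have hSm : MeasurableSet S := MeasurableSet.univ_pi fun j => measurableSet_Ico
  rw [← hvol, ← hmp.measure_preimage hSm.nullMeasurableSet]
  refine measure_mono fun x hx => ?_
  have hx' : ∀ j, (A.2 j : ℝ) ≤ 2 ^ k * x j ∧ 2 ^ k * x j < A.2 j + 1 := by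
    intro j
    have hj : (A.2 j : ℝ) / 2 ^ k ≤ x j ∧ x j < (A.2 j + 1 : ℝ) / 2 ^ k := hx j trivial
    rw [div_le_iff₀ hp, lt_div_iff₀ hp] at hj
    constructor <;> nlinarith
  have h3 : ∀ j, (A.2 j : ℝ) + 1 ≤ 2 ^ k := fun j => by exact_mod_cast h2 j
  refine ⟨fun j => ⟨?_, ?_⟩, Prod.ext rfl (funext fun j => ?_)⟩
  · have := (hx' j).1
    by_contra hneg
    have : (2 : ℝ) ^ k * x j < 0 := mul_neg_of_pos_of_neg hp (not_le.mp hneg)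
    have : (0 : ℝ) ≤ A.2 j := Nat.cast_nonneg _
    linarith
  · have := (hx' j).2; have := h3 j
    by_contra hneg
    have : (2 : ℝ) ^ k * 1 < 2 ^ k * x j := mul_lt_mul_of_pos_left (not_le.mp hneg) hp
    linarith
  · have hfl : ⌊(2 : ℝ) ^ k * x j⌋₊ = A.2 j := by
      rw [Nat.floor_eq_iff ((Nat.cast_nonneg _).trans (hx' j).1)]
      exact hx' j
    have := h2 j
    simp only [binAt, h1, hfl]
    omega

end Bins

/-! ### Successive Elimination: bookkeeping -/

section SE

variable {K : ℕ}

lemma logBar_ge_one (x : ℝ) : 1 ≤ logBar x := le_max_right _ _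

lemma confU_nonneg (τ : ℕ) (T : ℝ) : 0 ≤ confU τ T := by unfold confU; positivity

/-- The state `s` is consistent with arm `i` having been pulled `N i` times with total reward
`G i`. -/
structure SEState.Consistent (s : SEState K) (N : Fin K → ℕ) (G : Fin K → ℝ) : Prop where
  pending_subset : s.pending ⊆ s.active
  pending_nonempty : s.pending.Nonempty
  count : ∀ i ∈ s.active, N i = s.rounds + if i ∈ s.pending then 0 else 1
  total : ∀ i, s.total i = G i

lemma SEState.Consistent.init {I : Finset (Fin K)} (hI : I.Nonempty) {N : Fin K → ℕ}
    {G : Fin K → ℝ} (hN : ∀ i, N i = 0) (hG : ∀ i, G i = 0) : (SEState.init I).Consistent N G where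
  pending_subset := subset_rfl
  pending_nonempty := hI
  count i hi := by
    have : i ∈ I := hi
    simp [SEState.init, hN, this]
  total i := by simp [SEState.init, hG]

variable [NeZero K]

lemma SEState.arm_mem {s : SEState K} (h : s.pending.Nonempty) : s.arm ∈ s.pending := by
  unfold SEState.arm
  rw [dif_pos h]
  exact Finset.min'_mem _ _

/-- The two possible forms of an update. -/
lemma SEState.Consistent.update_cases {s : SEState K} {N N' : Fin K → ℕ} {G G' : Fin K → ℝ}
    (h : s.Consistent N G) {T γ y : ℝ} (hγ : 0 ≤ γ)
    (hN : ∀ i, N' i = N i + if s.arm = i then 1 else 0)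
    (hG : ∀ i, G' i = G i + if s.arm = i then y else 0) :
    (s.update T γ y).Consistent N' G' ∧
    (((s.update T γ y).active = s.active ∧ (s.update T γ y).rounds = s.rounds) ∨
      ((s.update T γ y).rounds = s.rounds + 1 ∧ (s.update T γ y).active ⊆ s.active ∧
        (∀ i ∈ s.active, N' i = s.rounds + 1) ∧
        ∀ i ∈ s.active, i ∈ (s.update T γ y).active ↔ ∀ j ∈ s.active,
          G' j / (s.rounds + 1 : ℕ) - γ * confU (s.rounds + 1) T ≤ G' i / (s.rounds + 1 : ℕ))) := by
  classical
  have harm := SEState.arm_mem h.pending_nonempty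
  have htot : Function.update s.total s.arm (s.total s.arm + y) = G' := by
    funext i
    rw [hG, ← h.total]
    by_cases hi : s.arm = i
    · subst hi; simp
    · rw [Function.update_of_ne (Ne.symm hi)]; simp [hi]
  by_cases hp : (s.pending.erase s.arm).Nonempty
  · have hu : s.update T γ y = ⟨s.active, s.pending.erase s.arm, s.rounds, G'⟩ := by
      rw [← htot]; simp only [SEState.update, if_pos hp]
    rw [hu]
    refine ⟨⟨(Finset.erase_subset _ _).trans h.pending_subset, hp, fun i hi => ?_, fun i => rfl⟩,
      Or.inl ⟨rfl, rfl⟩⟩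
    have hc := h.count i hi
    rw [hN, hc]
    by_cases hi' : s.arm = i
    · subst hi'; simp [harm]
    · simp [Ne.symm hi', hi']
  · have hN' : ∀ i ∈ s.active, N' i = s.rounds + 1 := by
      intro i hi
      rw [hN, h.count i hi]
      by_cases hi' : s.arm = i
      · subst hi'; simp [harm]
      · have : i ∉ s.pending := fun hip =>
          hp ⟨i, Finset.mem_erase.mpr ⟨Ne.symm hi', hip⟩⟩
        simp [this, hi']
    set kept : Finset (Fin K) := s.active.filter fun i =>
      ∀ j ∈ s.active, G' j / (s.rounds + 1 : ℕ) - γ * confU (s.rounds + 1) T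
        ≤ G' i / (s.rounds + 1 : ℕ) with hkept
    have hu : s.update T γ y = ⟨kept, kept, s.rounds + 1, G'⟩ := by
      rw [hkept, ← htot]; simp only [SEState.update, if_neg hp]
    rw [hu]
    -- The arm with the largest average passes its own test because `γ U ≥ 0`, so an elimination
    -- never empties the set of active arms.
    have hne : kept.Nonempty := by
      obtain ⟨i, hi, hmax⟩ := s.active.exists_max_image (fun i => G' i / ((s.rounds + 1 : ℕ) : ℝ))
        (h.pending_nonempty.mono h.pending_subset)
      refine ⟨i, Finset.mem_filter.mpr ⟨hi, fun j hj => ?_⟩⟩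
      have := hmax j hj
      have := mul_nonneg hγ (confU_nonneg (s.rounds + 1) T)
      linarith
    refine ⟨⟨subset_rfl, hne, fun i hi => ?_, fun i => rfl⟩, Or.inr ⟨rfl, Finset.filter_subset _ _,
      hN', fun i hi => ?_⟩⟩
    · have hi' : i ∈ kept := hi
      simp only [hi', if_true, add_zero]
      exact hN' i (Finset.mem_filter.mp hi').1
    · simp only [hkept, Finset.mem_filter, hi, true_and]

end SE

/-! ### The state of the policy -/

section Path

variable {d K : ℕ} [NeZero K] (n : ℕ) (β L : ℝ) (x : ℕ → Cov d) (y : ℕ → Fin K → ℝ)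

/-- The live bin to which the covariate of time `t` belongs. -/
def curBin (t : ℕ) : Bin d := (abseState n β L x y t).liveBin (x t)

/-- The number of times before `t` at which arm `i` was pulled on the bin `A`. -/
def pulls (A : Bin d) (i : Fin K) (t : ℕ) : ℕ :=
  ∑ s ∈ Finset.range t, if curBin n β L x y s = A ∧ abseArm n β L x y s = i then 1 else 0

/-- The total reward of arm `i` on the bin `A` before time `t`. -/
def gain (A : Bin d) (i : Fin K) (t : ℕ) : ℝ :=
  ∑ s ∈ Finset.range t, if curBin n β L x y s = A ∧ abseArm n β L x y s = i then y s i else 0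

variable {n β L x y}

lemma pulls_succ (A : Bin d) (i : Fin K) (t : ℕ) :
    pulls n β L x y A i (t + 1) = pulls n β L x y A i t +
      if curBin n β L x y t = A ∧ abseArm n β L x y t = i then 1 else 0 :=
  Finset.sum_range_succ _ _

lemma gain_succ (A : Bin d) (i : Fin K) (t : ℕ) :
    gain n β L x y A i (t + 1) = gain n β L x y A i t +
      if curBin n β L x y t = A ∧ abseArm n β L x y t = i then y t i else 0 :=
  Finset.sum_range_succ _ _

lemma gain_eq_zero {A : Bin d} {i : Fin K} {t : ℕ} (h : pulls n β L x y A i t = 0) :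
    gain n β L x y A i t = 0 := by
  unfold pulls at h
  unfold gain
  rw [Finset.sum_eq_zero_iff] at h
  refine Finset.sum_eq_zero fun s hs => ?_
  have := h s hs
  by_cases hc : curBin n β L x y s = A ∧ abseArm n β L x y s = i
  · simp [hc] at this
  · simp [hc]

variable (n β L x y) in
/-- The invariants of the policy before time `t`. -/
structure Invariant (t : ℕ) : Prop where
  cover : ∀ z, ∃ k, binAt k z ∈ (abseState n β L x y t).live
  uniq : ∀ z k m, binAt k z ∈ (abseState n β L x y t).live →
    binAt m z ∈ (abseState n β L x y t).live → k = m
  depth : ∀ A ∈ (abseState n β L x y t).live, A.1 ≤ maxDepth d K n β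
  fresh : ∀ z k m, binAt k z ∈ (abseState n β L x y t).live → k < m →
    ∀ i, pulls n β L x y (binAt m z) i t = 0
  consistent : ∀ z k, binAt k z ∈ (abseState n β L x y t).live →
    ((abseState n β L x y t).se (binAt k z)).Consistent
      (fun i => pulls n β L x y (binAt k z) i t) (fun i => gain n β L x y (binAt k z) i t)
  stopped : ∀ z k, binAt k z ∈ (abseState n β L x y t).live → k + 1 ≤ maxDepth d K n β →
    roundLimit n β L (binAt k z) ≤ ((abseState n β L x y t).se (binAt k z)).rounds →
    ((abseState n β L x y t).se (binAt k z)).active.card ≤ 1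

/-- `liveBin` is defined by an infimum over depths. Uniqueness makes that set a singleton, so
neither the choice of the infimum nor its value on the empty set matters. -/
lemma Invariant.liveBin_eq {t : ℕ} (h : Invariant n β L x y t) {z : Cov d} {k : ℕ}
    (hk : binAt k z ∈ (abseState n β L x y t).live) :
    (abseState n β L x y t).liveBin z = binAt k z := by
  have : {k : ℕ | binAt k z ∈ (abseState n β L x y t).live} = {k} := by
    ext m
    exact ⟨fun hm => h.uniq z m k hm hk, fun hm => by rw [Set.mem_singleton_iff.mp hm]; exact hk⟩
  simp [ABSEState.liveBin, this]

lemma Invariant.liveBin_mem {t : ℕ} (h : Invariant n β L x y t) (z : Cov d) :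
    (abseState n β L x y t).liveBin z ∈ (abseState n β L x y t).live := by
  obtain ⟨k, hk⟩ := h.cover z
  rw [h.liveBin_eq hk]; exact hk

lemma Invariant.liveBin_eq_iff {t : ℕ} (h : Invariant n β L x y t) (z : Cov d) (A : Bin d) :
    (abseState n β L x y t).liveBin z = A ↔
      A ∈ (abseState n β L x y t).live ∧ binAt A.1 z = A := by
  constructor
  · rintro rfl
    refine ⟨h.liveBin_mem z, ?_⟩
    obtain ⟨k, hk⟩ := h.cover z
    rw [h.liveBin_eq hk]; rfl
  · rintro ⟨h1, h2⟩
    rw [← h2] at h1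
    rw [h.liveBin_eq h1, h2]

variable (n β L x y) in
/-- The state of the policy run on the current bin, after the observation of time `t`. -/
def nextSE (t : ℕ) : SEState K :=
  ((abseState n β L x y t).se (curBin n β L x y t)).update (binHorizon n (curBin n β L x y t)) 2
    (y t (abseArm n β L x y t))

variable (n β L x y) in
/-- The current bin is split after the observation of time `t`. -/
def Splits (t : ℕ) : Prop :=
  roundLimit n β L (curBin n β L x y t) ≤ (nextSE n β L x y t).rounds ∧
    (curBin n β L x y t).1 + 1 ≤ maxDepth d K n β ∧ 2 ≤ (nextSE n β L x y t).active.card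

lemma abseState_succ_of_splits {t : ℕ} (h : Splits n β L x y t) :
    abseState n β L x y (t + 1) =
      { live := (abseState n β L x y t).live.erase (curBin n β L x y t) ∪ burst (curBin n β L x y t)
        se := fun B' => if B' ∈ burst (curBin n β L x y t) then
          SEState.init (nextSE n β L x y t).active else
          Function.update (abseState n β L x y t).se (curBin n β L x y t)
            (nextSE n β L x y t) B' } := by
  rw [abseState]; exact if_pos h

lemma abseState_succ_of_not_splits {t : ℕ} (h : ¬ Splits n β L x y t) :
    abseState n β L x y (t + 1) =
      { live := (abseState n β L x y t).live
        se := Function.update (abseState n β L x y t).se (curBin n β L x y t)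
            (nextSE n β L x y t) } := by
  rw [abseState]; exact if_neg h

lemma abseArm_eq (t : ℕ) :
    abseArm n β L x y t = ((abseState n β L x y t).se (curBin n β L x y t)).arm := rfl

/-- When the pull completes round `τ`, every arm that was active has exactly `τ` pulls on the bin.
The quantities compared by the test are then the true averages `gain / τ`, to which the deviation
bounds apply. -/
lemma Invariant.nextSE_cases {t : ℕ} (h : Invariant n β L x y t) :
    (nextSE n β L x y t).Consistent (fun i => pulls n β L x y (curBin n β L x y t) i (t + 1))
        (fun i => gain n β L x y (curBin n β L x y t) i (t + 1)) ∧
    (((nextSE n β L x y t).active =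
          ((abseState n β L x y t).se (curBin n β L x y t)).active ∧
        (nextSE n β L x y t).rounds =
          ((abseState n β L x y t).se (curBin n β L x y t)).rounds) ∨
      ∃ τ, τ = ((abseState n β L x y t).se (curBin n β L x y t)).rounds + 1 ∧
        (nextSE n β L x y t).rounds = τ ∧
        (nextSE n β L x y t).active ⊆
          ((abseState n β L x y t).se (curBin n β L x y t)).active ∧
        (∀ i ∈ ((abseState n β L x y t).se (curBin n β L x y t)).active,
          pulls n β L x y (curBin n β L x y t) i (t + 1) = τ) ∧
        ∀ i ∈ ((abseState n β L x y t).se (curBin n β L x y t)).active,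
          i ∈ (nextSE n β L x y t).active ↔
          ∀ j ∈ ((abseState n β L x y t).se (curBin n β L x y t)).active,
          gain n β L x y (curBin n β L x y t) j (t + 1) / (τ : ℝ) -
              2 * confU τ (binHorizon n (curBin n β L x y t)) ≤
            gain n β L x y (curBin n β L x y t) i (t + 1) / (τ : ℝ)) := by
  obtain ⟨k, hk⟩ := h.cover (x t)
  have hB : curBin n β L x y t = binAt k (x t) := h.liveBin_eq hk
  have hc := h.consistent _ _ hk
  rw [← hB] at hc
  have := hc.update_cases (T := binHorizon n (curBin n β L x y t)) (γ := 2)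
    (y := y t (abseArm n β L x y t)) two_pos.le
    (N' := fun i => pulls n β L x y (curBin n β L x y t) i (t + 1))
    (G' := fun i => gain n β L x y (curBin n β L x y t) i (t + 1))
    (fun i => by simp [pulls_succ, abseArm_eq]) (fun i => by
      rw [gain_succ]
      by_cases hi : abseArm n β L x y t = i
      · subst hi; simp [abseArm_eq]
      · have hi' := hi
        rw [abseArm_eq] at hi'
        simp [hi, hi'])
  refine ⟨this.1, this.2.imp id fun h2 => ?_⟩
  exact ⟨_, rfl, h2.1, h2.2.1, h2.2.2.1, h2.2.2.2⟩

lemma Invariant.nextSE_active_subset {t : ℕ} (h : Invariant n β L x y t) :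
    (nextSE n β L x y t).active ⊆ ((abseState n β L x y t).se (curBin n β L x y t)).active := by
  rcases h.nextSE_cases.2 with h1 | ⟨τ, h1⟩
  · rw [h1.1]
  · exact h1.2.2.1

lemma Invariant.curBin_eq {t : ℕ} (h : Invariant n β L x y t) :
    binAt (curBin n β L x y t).1 (x t) = curBin n β L x y t :=
  ((h.liveBin_eq_iff (x t) _).mp rfl).2

lemma Invariant.curBin_mem {t : ℕ} (h : Invariant n β L x y t) :
    curBin n β L x y t ∈ (abseState n β L x y t).live := h.liveBin_mem _

/-- Where a bin that is live after the observation of time `t` comes from. -/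
lemma Invariant.live_succ_cases {t : ℕ} (h : Invariant n β L x y t) {z : Cov d} {k : ℕ}
    (hk : binAt k z ∈ (abseState n β L x y (t + 1)).live) :
    (binAt k z ∈ (abseState n β L x y t).live ∧ curBin n β L x y t ≠ binAt k z ∧
      (abseState n β L x y (t + 1)).se (binAt k z) = (abseState n β L x y t).se (binAt k z)) ∨
    (binAt k z ∈ (abseState n β L x y t).live ∧ curBin n β L x y t = binAt k z ∧
      ¬ Splits n β L x y t ∧
      (abseState n β L x y (t + 1)).se (binAt k z) = nextSE n β L x y t) ∨
    (Splits n β L x y t ∧ k = (curBin n β L x y t).1 + 1 ∧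
      curBin n β L x y t = binAt (curBin n β L x y t).1 z ∧
      (abseState n β L x y (t + 1)).se (binAt k z) =
        SEState.init (nextSE n β L x y t).active) := by
  have hBl := h.curBin_mem
  by_cases hs : Splits n β L x y t
  · rw [abseState_succ_of_splits hs] at hk ⊢
    simp only [Finset.mem_union, Finset.mem_erase] at hk
    by_cases hb : binAt k z ∈ burst (curBin n β L x y t)
    · right; right
      have hb' := binAt_mem_burst.mp hb
      exact ⟨hs, hb'.1, hb'.2.symm, if_pos hb⟩
    · left
      have hk' := hk.resolve_right hb
      refine ⟨hk'.2, hk'.1.symm, ?_⟩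
      simp only [if_neg hb]
      rw [Function.update_of_ne hk'.1]
  · rw [abseState_succ_of_not_splits hs] at hk ⊢
    simp only at hk
    by_cases hb : curBin n β L x y t = binAt k z
    · exact Or.inr (Or.inl ⟨hk, hb, hs, by simp [hb]⟩)
    · exact Or.inl ⟨hk, hb, Function.update_of_ne (Ne.symm hb) _ _⟩

lemma pulls_succ_of_ne {A : Bin d} {t : ℕ} (h : curBin n β L x y t ≠ A) (i : Fin K) :
    pulls n β L x y A i (t + 1) = pulls n β L x y A i t := by
  rw [pulls_succ]; simp [h]

lemma gain_succ_of_ne {A : Bin d} {t : ℕ} (h : curBin n β L x y t ≠ A) (i : Fin K) :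
    gain n β L x y A i (t + 1) = gain n β L x y A i t := by
  rw [gain_succ]; simp [h]

lemma invariant_zero (hℓ : ∀ A : Bin d, 1 ≤ roundLimit n β L A) : Invariant n β L x y 0 where
  cover z := ⟨0, by
    simp only [abseState, ABSEState.init, Finset.mem_singleton]
    exact Prod.ext rfl (funext fun j => by simp [binAt])⟩
  uniq z k m hk hm := by
    simp only [abseState, ABSEState.init, Finset.mem_singleton] at hk hm
    have h1 := congrArg Prod.fst hk
    have h2 := congrArg Prod.fst hm
    simp only [binAt_fst] at h1 h2
    omega
  depth A hA := by
    simp only [abseState, ABSEState.init, Finset.mem_singleton] at hA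
    simp [hA]
  fresh z k m _ _ i := by simp [pulls]
  consistent z k _ := SEState.Consistent.init Finset.univ_nonempty
    (fun i => by simp [pulls]) (fun i => by simp [gain])
  stopped z k _ _ hr := by
    have := hℓ (binAt k z)
    simp only [abseState, ABSEState.init, SEState.init] at hr
    omega

/-- A split exchanges a bin for its children, which preserves covering and uniqueness. Bins strictly
below a live bin have never been used, so the policies started on the children agree with pull
counts equal to zero. A bin that reaches `roundLimit` with two arms left is split at once if its
depth allows; this gives `stopped`, and `1 ≤ roundLimit` settles it for new bins. -/
lemma Invariant.succ (hℓ : ∀ A : Bin d, 1 ≤ roundLimit n β L A) {t : ℕ}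
    (h : Invariant n β L x y t) : Invariant n β L x y (t + 1) := by
  have hBl := h.curBin_mem
  have hmem_of_splits : ∀ (_ : Splits n β L x y t) (z : Cov d) (k : ℕ),
      binAt k z ∈ (abseState n β L x y (t + 1)).live ↔
        (binAt k z ≠ curBin n β L x y t ∧ binAt k z ∈ (abseState n β L x y t).live) ∨
        (k = (curBin n β L x y t).1 + 1 ∧
          binAt (curBin n β L x y t).1 z = curBin n β L x y t) := by
    intro hs z k
    rw [abseState_succ_of_splits hs]
    simp only [Finset.mem_union, Finset.mem_erase, binAt_mem_burst]
  have hlive_of_not : ∀ _ : ¬ Splits n β L x y t,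
      (abseState n β L x y (t + 1)).live = (abseState n β L x y t).live := by
    intro hs
    rw [abseState_succ_of_not_splits hs]
  have hfresh : ∀ z, binAt (curBin n β L x y t).1 z = curBin n β L x y t → ∀ m,
      (curBin n β L x y t).1 < m → ∀ i, pulls n β L x y (binAt m z) i (t + 1) = 0 := by
    intro z hz m hm i
    rw [pulls_succ_of_ne (fun hc => ?_)]
    · exact h.fresh z _ m (by rw [hz]; exact hBl) hm i
    · have := congrArg Prod.fst hc
      simp only [binAt_fst] at this
      omega
  refine ⟨fun z => ?_, fun z k m hk hm => ?_, fun A hA => ?_, fun z k m hk hkm i => ?_,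
    fun z k hk => ?_, fun z k hk hd hr => ?_⟩
  · obtain ⟨k, hk⟩ := h.cover z
    by_cases hs : Splits n β L x y t
    · by_cases hb : binAt k z = curBin n β L x y t
      · refine ⟨k + 1, (hmem_of_splits hs z _).mpr (Or.inr ?_)⟩
        rw [← hb]; exact ⟨rfl, rfl⟩
      · exact ⟨k, (hmem_of_splits hs z _).mpr (Or.inl ⟨hb, hk⟩)⟩
    · exact ⟨k, by rw [hlive_of_not hs]; exact hk⟩
  · by_cases hs : Splits n β L x y t
    · have key : ∀ a, binAt a z ≠ curBin n β L x y t →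
          binAt a z ∈ (abseState n β L x y t).live →
          binAt (curBin n β L x y t).1 z ≠ curBin n β L x y t := by
        intro a ha hal hz
        have := h.uniq z a _ hal (by rw [hz]; exact hBl)
        rw [this] at ha
        exact ha hz
      rcases (hmem_of_splits hs z k).mp hk with h1 | h1 <;>
        rcases (hmem_of_splits hs z m).mp hm with h2 | h2
      · exact h.uniq z k m h1.2 h2.2
      · exact absurd h2.2 (key k h1.1 h1.2)
      · exact absurd h1.2 (key m h2.1 h2.2)
      · rw [h1.1, h2.1]
    · rw [hlive_of_not hs] at hk hm
      exact h.uniq z k m hk hm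
  · by_cases hs : Splits n β L x y t
    · rw [abseState_succ_of_splits hs] at hA
      simp only [Finset.mem_union, Finset.mem_erase, mem_burst] at hA
      rcases hA with hA | hA
      · exact h.depth A hA.2
      · rw [hA.1]; exact hs.2.1
    · rw [hlive_of_not hs] at hA
      exact h.depth A hA
  · have hold : binAt k z ∈ (abseState n β L x y t).live →
        pulls n β L x y (binAt m z) i (t + 1) = 0 := by
      intro hk'
      rw [pulls_succ_of_ne (fun hc => ?_)]
      · exact h.fresh z k m hk' hkm i
      · rw [hc] at hBl
        have := h.uniq z k m hk' hBl
        omega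
    rcases h.live_succ_cases hk with h1 | h1 | h1
    · exact hold h1.1
    · exact hold h1.1
    · exact hfresh z h1.2.2.1.symm m (by omega) i
  · rcases h.live_succ_cases hk with h1 | h1 | h1
    · rw [h1.2.2]
      have := h.consistent z k h1.1
      simpa only [pulls_succ_of_ne h1.2.1, gain_succ_of_ne h1.2.1] using this
    · rw [h1.2.2.2, ← h1.2.1]
      exact h.nextSE_cases.1
    · rw [h1.2.2.2]
      have hp : ∀ i, pulls n β L x y (binAt k z) i (t + 1) = 0 :=
        hfresh z h1.2.2.1.symm k (by omega)
      exact SEState.Consistent.init (Finset.card_pos.mp (by have := h1.1.2.2; omega)) hp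
        (fun i => gain_eq_zero (hp i))
  · rcases h.live_succ_cases hk with h1 | h1 | h1
    · rw [h1.2.2] at hr ⊢
      exact h.stopped z k h1.1 hd hr
    · rw [h1.2.2.2] at hr ⊢
      by_contra hcard
      refine h1.2.2.1 ⟨?_, ?_, by omega⟩
      · rw [h1.2.1]; exact hr
      · rw [h1.2.1]; exact hd
    · rw [h1.2.2.2] at hr
      have := hℓ (binAt k z)
      simp only [SEState.init] at hr
      omega

lemma invariant (hℓ : ∀ A : Bin d, 1 ≤ roundLimit n β L A) (t : ℕ) : Invariant n β L x y t := by
  induction t with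
  | zero => exact invariant_zero hℓ
  | succ t ih => exact ih.succ hℓ

end Path

/-! ### Regret of the policy along a path -/

section Regret

variable {d K : ℕ}

lemma le_fStar (f : Fin K → Cov d → ℝ) (i : Fin K) (z : Cov d) : f i z ≤ fStar f z :=
  le_ciSup (f := fun i => f i z) (Set.finite_range _).bddAbove i

lemma exists_eq_fStar [NeZero K] (f : Fin K → Cov d → ℝ) (z : Cov d) :
    ∃ i, f i z = fStar f z :=
  exists_eq_ciSup_of_finite (f := fun i => f i z)

lemma le_fSharp {f : Fin K → Cov d → ℝ} {i : Fin K} {z : Cov d} (h : f i z < fStar f z) :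
    f i z ≤ fSharp f z := by
  have hm : i ∈ Finset.univ.filter fun i => f i z < fStar f z := by simp [h]
  unfold fSharp
  rw [dif_pos ⟨i, hm⟩]
  exact Finset.le_sup' (fun i => f i z) hm

lemma fSharp_lt {f : Fin K → Cov d → ℝ} {i : Fin K} {z : Cov d} (h : f i z < fStar f z) :
    fSharp f z < fStar f z := by
  have hm : i ∈ Finset.univ.filter fun i => f i z < fStar f z := by simp [h]
  unfold fSharp
  have hne : (Finset.univ.filter fun i => f i z < fStar f z).Nonempty := ⟨i, hm⟩
  rw [dif_pos hne]
  exact (Finset.sup'_lt_iff hne).mpr fun j hj => (Finset.mem_filter.mp hj).2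

/-- If the gap at `z` is positive then it is the gap of some arm. -/
lemma exists_eq_fSharp {f : Fin K → Cov d → ℝ} {z : Cov d} (h : 0 < fStar f z - fSharp f z) :
    ∃ i, f i z = fSharp f z := by
  unfold fSharp at h ⊢
  split_ifs with hne
  · obtain ⟨i, _, hi⟩ := Finset.exists_mem_eq_sup' hne (fun i => f i z)
    exact ⟨i, hi.symm⟩
  · rw [dif_neg hne] at h; simp at h

variable (d) in
/-- Upper bound for the regret of the arms that are active on a bin of depth `k`. -/
def gapBound (β L : ℝ) (k : ℕ) : ℝ := max (14 * c0 d β L) 1 * ((1 / 2 : ℝ) ^ k) ^ β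

/-- The points of the cube at which the gap is positive and at most `δ`. -/
def marginSet (f : Fin K → Cov d → ℝ) (δ : ℝ) : Set (Cov d) :=
  {z | z ∈ unitCube d ∧ 0 < fStar f z - fSharp f z ∧ fStar f z - fSharp f z ≤ δ}

open Classical in
-- A suboptimal arm has mean at most `f♯`, so a nonzero regret bounded by `δ` forces the gap at `z`
-- into `(0, δ]`. This is how the margin condition enters the regret.
lemma regret_le_indicator {f : Fin K → Cov d → ℝ} {δ : ℝ} {z : Cov d} {i : Fin K}
    (hz : z ∈ unitCube d) (h : fStar f z - f i z ≤ δ) :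
    fStar f z - f i z ≤ if z ∈ marginSet f δ then δ else 0 := by
  rcases (le_fStar f i z).lt_or_eq with h1 | h1
  · have h2 := le_fSharp h1
    have h3 := fSharp_lt h1
    rw [if_pos ⟨hz, by linarith, by linarith⟩]
    exact h
  · have : 0 ≤ δ := by linarith
    split_ifs <;> linarith

/-- What the analysis of the policy along a path needs to know about the mean rewards `f`, their
averages `m` over the bins, and the parameters of the policy. -/
structure Regular (n : ℕ) (β L : ℝ) (f : Fin K → Cov d → ℝ) (m : Bin d → Fin K → ℝ) : Prop where
  c0_nonneg : 0 ≤ c0 d β L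
  β_nonneg : 0 ≤ β
  β_le : β ≤ 1
  f_mem : ∀ i, ∀ z ∈ unitCube d, 0 ≤ f i z ∧ f i z ≤ 1
  mean_mem : ∀ A, (cell A).Nonempty → ∀ i, 0 ≤ m A i ∧ m A i ≤ 1
  mean_near : ∀ A, ∀ z ∈ cell A, ∀ i, |m A i - f i z| ≤ c0 d β L / 2 * A.side ^ β
  limit_pos : ∀ A : Bin d, 1 ≤ roundLimit n β L A
  limit_le : ∀ A : Bin d, confU (roundLimit n β L A) (binHorizon n A) ≤
    2 * c0 d β L * A.side ^ β
  le_limit : ∀ A : Bin d, ∀ τ, 1 ≤ τ → τ ≤ roundLimit n β L A →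
    min 1 (c0 d β L * A.side ^ β) ≤ confU τ (binHorizon n A)

lemma Regular.gapBound_nonneg {n : ℕ} {β L : ℝ} {f : Fin K → Cov d → ℝ} {m : Bin d → Fin K → ℝ}
    (_ : Regular n β L f m) (k : ℕ) : 0 ≤ gapBound d β L k := by
  unfold gapBound; positivity

/-- The constant 14 is twice 7: the factor two pays for passing from a bin to its children, since
`2^{-β} ≥ 1/2` for `β ≤ 1`. -/
lemma Regular.gapBound_succ {n : ℕ} {β L : ℝ} {f : Fin K → Cov d → ℝ} {m : Bin d → Fin K → ℝ}
    (hR : Regular n β L f m) (k : ℕ) :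
    7 * c0 d β L * ((1 / 2 : ℝ) ^ k) ^ β ≤ gapBound d β L (k + 1) := by
  have h1 : (1 / 2 : ℝ) ≤ (1 / 2 : ℝ) ^ β := by
    simpa using Real.rpow_le_rpow_of_exponent_ge (x := 1 / 2) (by norm_num) (by norm_num) hR.β_le
  unfold gapBound
  rw [pow_succ, Real.mul_rpow (by positivity) (by positivity)]
  have h2 : 14 * c0 d β L ≤ max (14 * c0 d β L) 1 := le_max_left _ _
  have h3 : 0 ≤ ((1 / 2 : ℝ) ^ k) ^ β := by positivity
  have := hR.c0_nonneg
  calc 7 * c0 d β L * ((1 / 2 : ℝ) ^ k) ^ β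
      = 14 * c0 d β L * (((1 / 2 : ℝ) ^ k) ^ β * (1 / 2)) := by ring
    _ ≤ max (14 * c0 d β L) 1 * (((1 / 2 : ℝ) ^ k) ^ β * (1 / 2 : ℝ) ^ β) := by gcongr

variable [NeZero K] (n : ℕ) (β L : ℝ) (x : ℕ → Cov d) (y : ℕ → Fin K → ℝ)
  (m : Bin d → Fin K → ℝ)

/-- Some average reward observed on the bin `A` before time `t` is far from its mean. -/
def Failed (A : Bin d) (t : ℕ) : Prop :=
  ∃ s ≤ t, ∃ i, 1 ≤ pulls n β L x y A i s ∧ pulls n β L x y A i s ≤ roundLimit n β L A ∧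
    pulls n β L x y A i s * confU (pulls n β L x y A i s) (binHorizon n A) / 2 <
      |gain n β L x y A i s - pulls n β L x y A i s * m A i|

variable {n β L x y m} {f : Fin K → Cov d → ℝ}

lemma Failed.mono {A : Bin d} {s t : ℕ} (hst : s ≤ t) (h : Failed n β L x y m A s) :
    Failed n β L x y m A t := by
  obtain ⟨r, hr, h⟩ := h
  exact ⟨r, hr.trans hst, h⟩

lemma abs_div_sub_le_of_not_failed {A : Bin d} {t : ℕ} (h : ¬ Failed n β L x y m A t)
    {i : Fin K} {τ : ℕ} (hτ : pulls n β L x y A i t = τ) (h1 : 1 ≤ τ)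
    (h2 : τ ≤ roundLimit n β L A) :
    |gain n β L x y A i t / τ - m A i| ≤ confU τ (binHorizon n A) / 2 := by
  have h3 : ¬ (pulls n β L x y A i t * confU (pulls n β L x y A i t) (binHorizon n A) / 2 <
      |gain n β L x y A i t - pulls n β L x y A i t * m A i|) := fun hc =>
    h ⟨t, le_rfl, i, by rw [hτ]; exact h1, by rw [hτ]; exact h2, hc⟩
  rw [hτ, not_lt] at h3
  have hpos : (0 : ℝ) < τ := by exact_mod_cast h1
  have : gain n β L x y A i t / τ - m A i = (gain n β L x y A i t - τ * m A i) / τ := by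
    field_simp
  rw [this, abs_div, abs_of_pos hpos, div_le_iff₀ hpos]
  linarith

/-- Unless the bin has failed, an arm that is optimal at some point is not eliminated. -/
lemma Invariant.optimal_mem_nextSE (hR : Regular n β L f m) {t : ℕ}
    (h : Invariant n β L x y t) (hd : (curBin n β L x y t).1 + 1 ≤ maxDepth d K n β)
    (hF : ¬ Failed n β L x y m (curBin n β L x y t) (t + 1)) {w : Cov d}
    (hw : w ∈ cell (curBin n β L x y t)) {i : Fin K} (hi : f i w = fStar f w)
    (hact : i ∈ ((abseState n β L x y t).se (curBin n β L x y t)).active) :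
    i ∈ (nextSE n β L x y t).active := by
  rcases h.nextSE_cases.2 with h1 | ⟨τ, hτ, _, _, hp, hiff⟩
  · rw [h1.1]; exact hact
  rw [hiff i hact]
  intro j hj
  rcases eq_or_ne j i with rfl | hji
  · have := confU_nonneg τ (binHorizon n (curBin n β L x y t)); linarith
  -- Two distinct active arms exclude, by `stopped`, that the rounds were already complete, so `τ`
  -- lies in the range covered by `Failed`. At maximal depth this argument is not available.
  have hlt : ¬ roundLimit n β L (curBin n β L x y t) ≤
      ((abseState n β L x y t).se (curBin n β L x y t)).rounds := by
    intro hle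
    have hs := h.stopped (x t) (curBin n β L x y t).1 (by rw [h.curBin_eq]; exact h.curBin_mem) hd
      (by rw [h.curBin_eq]; exact hle)
    rw [h.curBin_eq] at hs
    exact hji (Finset.card_le_one.mp hs j hj i hact)
  have hτ1 : 1 ≤ τ := by omega
  have hτ2 : τ ≤ roundLimit n β L (curBin n β L x y t) := by omega
  have e1 := abs_le.mp (abs_div_sub_le_of_not_failed hF (hp i hact) hτ1 hτ2)
  have e2 := abs_le.mp (abs_div_sub_le_of_not_failed hF (hp j hj) hτ1 hτ2)
  have e3 := hR.le_limit _ τ hτ1 hτ2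
  have e4 := abs_le.mp (hR.mean_near _ w hw i)
  have e5 := abs_le.mp (hR.mean_near _ w hw j)
  have e6 := hR.mean_mem _ ⟨w, hw⟩ i
  have e7 := hR.mean_mem _ ⟨w, hw⟩ j
  have e8 := le_fStar f j w
  -- The averages differ by at most `m j - m i + U`. Either `U ≥ 1 ≥ m j - m i`, or `U ≥ c₀ |B|^β`,
  -- which bounds `m j - m i` because `f j w ≤ f i w`. In both cases the total is at most `2 U`.
  rcases min_le_iff.mp e3 with e | e <;> linarith

/-- The arms that survive to the end of a bin that has not failed have small regret. -/
lemma Invariant.gap_nextSE (hR : Regular n β L f m) {t : ℕ}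
    (h : Invariant n β L x y t) (hS : Splits n β L x y t)
    (hF : ¬ Failed n β L x y m (curBin n β L x y t) (t + 1)) {w : Cov d}
    (hw : w ∈ cell (curBin n β L x y t))
    (hopt : ∀ j, f j w = fStar f w →
      j ∈ ((abseState n β L x y t).se (curBin n β L x y t)).active)
    {i : Fin K} (hi : i ∈ (nextSE n β L x y t).active) :
    fStar f w - f i w ≤ gapBound d β L ((curBin n β L x y t).1 + 1) := by
  have hlt : ¬ roundLimit n β L (curBin n β L x y t) ≤
      ((abseState n β L x y t).se (curBin n β L x y t)).rounds := by
    intro hle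
    have hs := h.stopped (x t) (curBin n β L x y t).1 (by rw [h.curBin_eq]; exact h.curBin_mem)
      hS.2.1 (by rw [h.curBin_eq]; exact hle)
    rw [h.curBin_eq] at hs
    have h1 := Finset.card_le_card h.nextSE_active_subset
    have h2 := hS.2.2
    omega
  have hS1 := hS.1
  rcases h.nextSE_cases.2 with h1 | ⟨τ, hτ, hr, hsub, hp, hiff⟩
  · rw [h1.2] at hS1; omega
  -- The rounds were incomplete before this pull and are complete after it, so the split follows the
  -- test of round `roundLimit` exactly.
  have hτ3 : τ = roundLimit n β L (curBin n β L x y t) := by omega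
  have hτ1 : 1 ≤ τ := by omega
  obtain ⟨j, hj⟩ := exists_eq_fStar f w
  have hjact := hopt j hj
  have e0 := (hiff i (hsub hi)).mp hi j hjact
  have e1 := abs_le.mp (abs_div_sub_le_of_not_failed hF (hp i (hsub hi)) hτ1 hτ3.le)
  have e2 := abs_le.mp (abs_div_sub_le_of_not_failed hF (hp j hjact) hτ1 hτ3.le)
  have e3 := hR.limit_le (curBin n β L x y t)
  rw [← hτ3] at e3
  have e4 := abs_le.mp (hR.mean_near _ w hw i)
  have e5 := abs_le.mp (hR.mean_near _ w hw j)
  have e6 : 7 * c0 d β L * (curBin n β L x y t).side ^ β ≤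
    gapBound d β L ((curBin n β L x y t).1 + 1) := hR.gapBound_succ _
  rw [← hj]
  -- Survival gives `m j - m i ≤ 2 U + U ≤ 6 c₀ |B|^β`; replacing both means by values at `w` costs
  -- another `c₀ |B|^β`, whence the constant 7.
  linarith

variable (n β L x y m f) in
/-- The guarantees enjoyed by the active arms as long as no ancestor has failed. -/
structure Guarantee (t : ℕ) : Prop where
  gap : ∀ z k, binAt k z ∈ (abseState n β L x y t).live → ∀ k' ≤ k,
    (∀ j < k', ¬ Failed n β L x y m (binAt j z) t) →
    ∀ i ∈ ((abseState n β L x y t).se (binAt k z)).active, ∀ w ∈ cell (binAt k z),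
      fStar f w - f i w ≤ gapBound d β L k'
  optimal : ∀ z k, binAt k z ∈ (abseState n β L x y t).live → k + 1 ≤ maxDepth d K n β →
    (∀ j ≤ k, ¬ Failed n β L x y m (binAt j z) t) → ∀ w ∈ cell (binAt k z), ∀ i,
      f i w = fStar f w → i ∈ ((abseState n β L x y t).se (binAt k z)).active

lemma guarantee_zero (hR : Regular n β L f m) : Guarantee n β L x y m f 0 where
  gap z k hk k' hk' _ i _ w hw := by
    have h0 : k = 0 := by
      simp only [abseState, ABSEState.init, Finset.mem_singleton] at hk
      exact congrArg Prod.fst hk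
    obtain rfl : k' = 0 := by omega
    obtain ⟨j, hj⟩ := exists_eq_fStar f w
    have h1 := hR.f_mem j w hw.1
    have h2 := hR.f_mem i w hw.1
    -- The maximum with 1 in `gapBound` serves here: at depth zero nothing is known beyond rewards
    -- in `[0,1]`.
    have : 1 ≤ gapBound d β L 0 := by simp [gapBound]
    linarith
  optimal z k _ _ _ w _ i _ := by simp [abseState, ABSEState.init, SEState.init]

/-- The level `k'` is kept separate from the depth `k` so that bounds obtained above a failed bin
persist on its descendants. At a split, levels up to the depth of the parent are inherited, and only
the level of the children uses that the parent has not failed. Optimal arms stay active because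
every bin traversed, including the current one, has not failed. -/
lemma Guarantee.succ (hR : Regular n β L f m) {t : ℕ} (h : Invariant n β L x y t)
    (hG : Guarantee n β L x y m f t) : Guarantee n β L x y m f (t + 1) where
  gap z k hk k' hk' hF i hi w hw := by
    have hF' : ∀ j < k', ¬ Failed n β L x y m (binAt j z) t := fun j hj hc =>
      hF j hj (hc.mono (Nat.le_succ t))
    rcases h.live_succ_cases hk with ⟨h1, _, h3⟩ | ⟨h1, h2, _, h4⟩ | ⟨hS, h2, h3, h4⟩
    · rw [h3] at hi
      exact hG.gap z k h1 k' hk' hF' i hi w hw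
    · rw [h4] at hi
      exact hG.gap z k h1 k' hk' hF' i (h2 ▸ h.nextSE_active_subset hi) w hw
    · rw [h4] at hi
      have hlive : binAt (curBin n β L x y t).1 z ∈ (abseState n β L x y t).live := by
        rw [← h3]; exact h.curBin_mem
      have hw' : w ∈ cell (binAt (curBin n β L x y t).1 z) := cell_subset_of_le (by omega) z hw
      have hi' : i ∈ (nextSE n β L x y t).active := hi
      rcases Nat.lt_or_ge (curBin n β L x y t).1 k' with hlt | hge
      · obtain rfl : k' = (curBin n β L x y t).1 + 1 := by omega
        refine h.gap_nextSE hR hS (by rw [h3]; exact hF _ (Nat.lt_succ_self _))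
          (by rw [h3]; exact hw') (fun j hj => ?_) hi'
        have := hG.optimal z _ hlive hS.2.1 (fun j hj => hF' j (by omega)) w hw' j hj
        rwa [← h3] at this
      · refine hG.gap z _ hlive k' hge hF' i ?_ w hw'
        rw [← h3]
        exact h.nextSE_active_subset hi'
  optimal z k hk hd hF w hw i hi := by
    have hF' : ∀ j ≤ k, ¬ Failed n β L x y m (binAt j z) t := fun j hj hc =>
      hF j hj (hc.mono (Nat.le_succ t))
    rcases h.live_succ_cases hk with ⟨h1, _, h3⟩ | ⟨h1, h2, _, h4⟩ | ⟨hS, h2, h3, h4⟩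
    · rw [h3]
      exact hG.optimal z k h1 hd hF' w hw i hi
    · rw [h4]
      have := hG.optimal z k h1 hd hF' w hw i hi
      rw [← h2] at this
      exact h.optimal_mem_nextSE hR (by rw [h2]; exact hd) (by rw [h2]; exact hF k le_rfl)
        (by rw [h2]; exact hw) hi this
    · rw [h4]
      have hlive : binAt (curBin n β L x y t).1 z ∈ (abseState n β L x y t).live := by
        rw [← h3]; exact h.curBin_mem
      have hw' : w ∈ cell (binAt (curBin n β L x y t).1 z) := cell_subset_of_le (by omega) z hw
      have := hG.optimal z _ hlive hS.2.1 (fun j hj => hF' j (by omega)) w hw' i hi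
      rw [← h3] at this hw'
      exact h.optimal_mem_nextSE hR hS.2.1 (by rw [h3]; exact hF _ (by omega)) hw' hi this

lemma guarantee (hR : Regular n β L f m) (t : ℕ) : Guarantee n β L x y m f t := by
  induction t with
  | zero => exact guarantee_zero hR
  | succ t ih => exact ih.succ hR (invariant hR.limit_pos t)

variable (n β L x y) in
/-- At time `t` the bin `A` is the current bin, and it has not completed its rounds. -/
def Explores (A : Bin d) (t : ℕ) : Prop :=
  curBin n β L x y t = A ∧ ((abseState n β L x y t).se A).rounds < roundLimit n β L A

lemma Invariant.arm_mem {t : ℕ} (h : Invariant n β L x y t) :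
    abseArm n β L x y t ∈ ((abseState n β L x y t).se (curBin n β L x y t)).pending := by
  have hc := h.consistent (x t) (curBin n β L x y t).1 (by rw [h.curBin_eq]; exact h.curBin_mem)
  rw [h.curBin_eq] at hc
  exact SEState.arm_mem hc.pending_nonempty

open Classical in
/-- A bin of non-maximal depth is explored at most `K ℓ` times. -/
lemma card_explores_le (hR : Regular n β L f m) (A : Bin d) (t : ℕ) :
    ∑ s ∈ Finset.range t, (if Explores n β L x y A s then (1 : ℕ) else 0) ≤
      K * roundLimit n β L A := by
  -- The potential is the sum over the arms of `pulls` capped at `roundLimit`. On an unfinished bin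
  -- the pulled arm is pending and has been pulled `rounds < roundLimit` times, so each exploration
  -- raises the potential.
  have key : ∑ s ∈ Finset.range t, (if Explores n β L x y A s then (1 : ℕ) else 0) ≤
      ∑ i : Fin K, min (pulls n β L x y A i t) (roundLimit n β L A) := by
    induction t with
    | zero => simp
    | succ t ih =>
      rw [Finset.sum_range_succ]
      by_cases hE : Explores n β L x y A t
      · rw [if_pos hE]
        have h := invariant (x := x) (y := y) hR.limit_pos t
        have hc := h.consistent (x t) (curBin n β L x y t).1
          (by rw [h.curBin_eq]; exact h.curBin_mem)
        rw [h.curBin_eq] at hc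
        have ha := h.arm_mem
        have hcnt := hc.count _ (hc.pending_subset ha)
        rw [if_pos ha, hE.1] at hcnt
        have hlt := hE.2
        refine (Nat.add_le_add_right ih 1).trans (Nat.succ_le_of_lt ?_)
        refine Finset.sum_lt_sum (fun i _ => ?_) ⟨abseArm n β L x y t, Finset.mem_univ _, ?_⟩
        · rw [pulls_succ]; omega
        · rw [pulls_succ, if_pos ⟨hE.1, rfl⟩]; omega
      · rw [if_neg hE, add_zero]
        refine ih.trans (Finset.sum_le_sum fun i _ => ?_)
        rw [pulls_succ]; omega
  refine key.trans ((Finset.sum_le_sum fun i _ => min_le_right _ _).trans ?_)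
  simp

open Classical in
/-- The regret at time `t`, split according to the depth of the bin responsible for it. -/
lemma regret_le (hR : Regular n β L f m) {t : ℕ} (hx : x t ∈ unitCube d) :
    fStar f (x t) - f (abseArm n β L x y t) (x t) ≤
      ∑ k ∈ Finset.range (maxDepth d K n β),
        ((if x t ∈ marginSet f (gapBound d β L k) ∧ Explores n β L x y (binAt k (x t)) t
            then gapBound d β L k else 0) +
          (if x t ∈ marginSet f (gapBound d β L k) ∧ Failed n β L x y m (binAt k (x t)) t
            then gapBound d β L k else 0)) +
      if x t ∈ marginSet f (gapBound d β L (maxDepth d K n β))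
        then gapBound d β L (maxDepth d K n β) else 0 := by
  set D := maxDepth d K n β with hD
  have h := invariant (x := x) (y := y) hR.limit_pos t
  have hG := guarantee (x := x) (y := y) hR t
  set k := (curBin n β L x y t).1 with hk
  have hlive : binAt k (x t) ∈ (abseState n β L x y t).live := by
    rw [h.curBin_eq]; exact h.curBin_mem
  have hkD : k ≤ D := h.depth _ hlive
  have hc := h.consistent (x t) k hlive
  have harm : abseArm n β L x y t ∈ ((abseState n β L x y t).se (binAt k (x t))).active := by
    refine hc.pending_subset ?_
    rw [h.curBin_eq]
    exact h.arm_mem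
  have hcell := mem_cell_binAt hx k
  have hpos := hR.gapBound_nonneg
  have hterm : ∀ j, 0 ≤ ((if x t ∈ marginSet f (gapBound d β L j) ∧
        Explores n β L x y (binAt j (x t)) t then gapBound d β L j else 0) +
      (if x t ∈ marginSet f (gapBound d β L j) ∧ Failed n β L x y m (binAt j (x t)) t
        then gapBound d β L j else 0)) := by
    intro j
    have := hpos j
    split_ifs <;> linarith
  have hlast : 0 ≤ if x t ∈ marginSet f (gapBound d β L D) then gapBound d β L D else 0 := by
    have := hpos D
    split_ifs <;> linarith
  have hsingle : ∀ j < D, ((if x t ∈ marginSet f (gapBound d β L j) ∧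
        Explores n β L x y (binAt j (x t)) t then gapBound d β L j else 0) +
      (if x t ∈ marginSet f (gapBound d β L j) ∧ Failed n β L x y m (binAt j (x t)) t
        then gapBound d β L j else 0)) ≤ ∑ k ∈ Finset.range D,
        ((if x t ∈ marginSet f (gapBound d β L k) ∧ Explores n β L x y (binAt k (x t)) t
            then gapBound d β L k else 0) +
          (if x t ∈ marginSet f (gapBound d β L k) ∧ Failed n β L x y m (binAt k (x t)) t
            then gapBound d β L k else 0)) := fun j hj =>
    Finset.single_le_sum (fun j _ => hterm j) (Finset.mem_range.mpr hj)
  -- If some bin on the way down has failed, the shallowest one, of depth `j`, is charged: nothing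
  -- above it has failed, so the regret is still at most `gapBound` at level `j`.
  by_cases hfail : ∃ j, j ≤ k ∧ j < D ∧ Failed n β L x y m (binAt j (x t)) t
  · have hj := Nat.find_spec hfail
    have hmin := fun j' (hj' : j' < Nat.find hfail) => Nat.find_min hfail hj'
    set j := Nat.find hfail
    have hgap := hG.gap (x t) k hlive j hj.1 (fun j' hj' hF =>
      hmin j' hj' ⟨by omega, by omega, hF⟩) _ harm _ hcell
    have h1 := regret_le_indicator hx hgap
    have h2 := hsingle j hj.2.1
    have h3 := hpos j
    by_cases hM : x t ∈ marginSet f (gapBound d β L j)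
    · simp only [hM, hj.2.2, true_and, if_true] at h1 h2
      split_ifs at h2 <;> linarith
    · simp only [hM, if_false] at h1
      have h4 := hterm j
      linarith
  · have hnf : ∀ j, j ≤ k → j < D → ¬ Failed n β L x y m (binAt j (x t)) t :=
      fun j h1 h2 h3 => hfail ⟨j, h1, h2, h3⟩
    have hgap := hG.gap (x t) k hlive k le_rfl (fun j hj => hnf j hj.le (by omega)) _ harm _ hcell
    have h1 := regret_le_indicator hx hgap
    have hsum := Finset.sum_nonneg (s := Finset.range D) fun j _ => hterm j
    rcases hkD.lt_or_eq with hlt | heq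
    · by_cases hr : ((abseState n β L x y t).se (binAt k (x t))).rounds <
          roundLimit n β L (binAt k (x t))
      · have hE : Explores n β L x y (binAt k (x t)) t := ⟨h.curBin_eq.symm, hr⟩
        have h2 := hsingle k hlt
        have h3 := hpos k
        by_cases hM : x t ∈ marginSet f (gapBound d β L k)
        · simp only [hM, hE, true_and, if_true] at h1 h2
          split_ifs at h2 <;> linarith
        · simp only [hM, if_false] at h1
          linarith
      -- The rounds are complete but the bin was not split, so one arm remains. An arm optimal at `x
      -- t` is still active, hence it is the one pulled and the regret vanishes.
      · obtain ⟨j, hj⟩ := exists_eq_fStar f (x t)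
        have hjact := hG.optimal (x t) k hlive hlt (fun j hj => hnf j hj (by omega)) _ hcell j hj
        have hcard := h.stopped (x t) k hlive hlt (not_lt.mp hr)
        rw [Finset.card_le_one.mp hcard _ harm _ hjact, hj]
        linarith
    · rw [heq] at h1
      linarith

end Regret

/-! ### Measurability of the policy -/

section Measurability

variable {Ω : Type*} [MeasurableSpace Ω] {d K : ℕ}

/-- Bins, arms and finite sets of arms take countably many values. Freezing them reduces the
measurability of objects with random indices, such as the policy on the current bin, to that of each
frozen case. -/
lemma measurable_of_countable_cases {ι γ : Type*} [Countable ι] [MeasurableSpace ι]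
    [MeasurableSingletonClass ι] [MeasurableSpace γ] {D : Ω → ι} (hD : Measurable D) {g : Ω → γ}
    (h : ι → Ω → γ) (hm : ∀ i, Measurable (h i)) (he : ∀ ω, g ω = h (D ω) ω) : Measurable g := by
  intro s hs
  have : g ⁻¹' s = ⋃ i, D ⁻¹' {i} ∩ (h i) ⁻¹' s := by
    ext ω
    simp [he]
  rw [this]
  exact MeasurableSet.iUnion fun i => (hD (measurableSet_singleton i)).inter (hm i hs)

lemma measurable_nat_sInf {E : ℕ → Set Ω} (hE : ∀ k, MeasurableSet (E k)) :
    Measurable fun ω => sInf {k | ω ∈ E k} := by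
  refine measurable_to_countable' fun j => ?_
  -- The second set accounts for the infimum of the empty set, which is zero.
  have : (fun ω => sInf {k | ω ∈ E k}) ⁻¹' {j} =
      (E j ∩ ⋂ i, ⋂ (_ : i < j), (E i)ᶜ) ∪ ({_ω | j = 0} ∩ ⋂ i, (E i)ᶜ) := by
    ext ω
    simp only [Set.mem_preimage, Set.mem_singleton_iff, Set.mem_union, Set.mem_inter_iff,
      Set.mem_iInter, Set.mem_compl_iff, Set.mem_ofPred_eq]
    constructor
    · intro h
      by_cases hne : {k | ω ∈ E k}.Nonempty
      · left
        have h1 := Nat.sInf_mem hne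
        rw [h] at h1
        exact ⟨h1, fun i hi hc => Nat.notMem_of_lt_sInf (by rw [h]; exact hi) hc⟩
      · right
        rw [Set.not_nonempty_iff_eq_empty] at hne
        rw [hne, Nat.sInf_empty] at h
        exact ⟨h.symm, fun i hi => (Set.ext_iff.mp hne i).mp hi⟩
    · rintro (⟨h1, h2⟩ | ⟨rfl, h⟩)
      · refine le_antisymm (Nat.sInf_le h1) (le_of_not_gt fun hlt => ?_)
        have h3 : sInf {k | ω ∈ E k} ∈ {k | ω ∈ E k} := Nat.sInf_mem ⟨j, h1⟩
        exact h2 _ hlt h3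
      · have : {k | ω ∈ E k} = ∅ := Set.eq_empty_of_forall_notMem h
        rw [this, Nat.sInf_empty]
  rw [this]
  exact ((hE j).inter (MeasurableSet.iInter fun i => MeasurableSet.iInter fun _ =>
    (hE i).compl)).union ((MeasurableSet.const _).inter (MeasurableSet.iInter fun i => (hE i).compl))

/-- A random state of Successive Elimination all of whose components are measurable. -/
structure MeasurableSE (s : Ω → SEState K) : Prop where
  active : Measurable fun ω => (s ω).active
  pending : Measurable fun ω => (s ω).pending
  rounds : Measurable fun ω => (s ω).rounds
  total : ∀ i, Measurable fun ω => (s ω).total i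

lemma MeasurableSE.of_cases {ι : Type*} [Countable ι] [MeasurableSpace ι]
    [MeasurableSingletonClass ι] {D : Ω → ι} (hD : Measurable D) {s : Ω → SEState K}
    (h : ι → Ω → SEState K) (hm : ∀ i, MeasurableSE (h i)) (he : ∀ ω, s ω = h (D ω) ω) :
    MeasurableSE s where
  active := measurable_of_countable_cases hD (fun i ω => (h i ω).active) (fun i => (hm i).active)
    fun ω => by rw [he]
  pending := measurable_of_countable_cases hD (fun i ω => (h i ω).pending)
    (fun i => (hm i).pending) fun ω => by rw [he]
  rounds := measurable_of_countable_cases hD (fun i ω => (h i ω).rounds) (fun i => (hm i).rounds)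
    fun ω => by rw [he]
  total j := measurable_of_countable_cases hD (fun i ω => (h i ω).total j)
    (fun i => (hm i).total j) fun ω => by rw [he]

lemma MeasurableSE.const (s : SEState K) : MeasurableSE fun _ : Ω => s :=
  ⟨measurable_const, measurable_const, measurable_const, fun _ => measurable_const⟩

/-- A random state of the policy all of whose components are measurable. -/
structure MeasurableState (σ : Ω → ABSEState d K) : Prop where
  live : Measurable fun ω => (σ ω).live
  se : ∀ B, MeasurableSE fun ω => (σ ω).se B

lemma measurableSet_mem_live {σ : Ω → ABSEState d K} (hσ : MeasurableState σ) {B : Ω → Bin d}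
    (hB : Measurable B) : MeasurableSet {ω | B ω ∈ (σ ω).live} :=
  (hB.prodMk hσ.live) (t := {p : Bin d × Finset (Bin d) | p.1 ∈ p.2})
    (Set.to_countable _).measurableSet

lemma MeasurableState.liveBin {σ : Ω → ABSEState d K} (hσ : MeasurableState σ) {x : Ω → Cov d}
    (hx : Measurable x) : Measurable fun ω => (σ ω).liveBin (x ω) :=
  measurable_of_countable_cases
    (measurable_nat_sInf (E := fun k => {ω | binAt k (x ω) ∈ (σ ω).live}) fun k =>
      measurableSet_mem_live hσ ((measurable_binAt k).comp hx))
    (fun k ω => binAt k (x ω)) (fun k => (measurable_binAt k).comp hx) fun _ => rfl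

variable [NeZero K]

lemma SEState.arm_congr {s s' : SEState K} (h : s.pending = s'.pending) : s.arm = s'.arm := by
  cases s; cases s'; subst h; rfl

lemma MeasurableSE.arm {s : Ω → SEState K} (hs : MeasurableSE s) :
    Measurable fun ω => (s ω).arm :=
  measurable_of_countable_cases hs.pending
    (fun p _ => (⟨p, p, 0, fun _ => 0⟩ : SEState K).arm) (fun _ => measurable_const)
    fun _ => SEState.arm_congr rfl

lemma MeasurableSE.update {s : Ω → SEState K} (hs : MeasurableSE s) {y : Ω → ℝ}
    (hy : Measurable y) (T γ : ℝ) : MeasurableSE fun ω => (s ω).update T γ (y ω) := by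
  classical
  refine MeasurableSE.of_cases (D := fun ω => ((s ω).active, (s ω).pending, (s ω).rounds))
    (hs.active.prodMk (hs.pending.prodMk hs.rounds))
    (fun D ω => (⟨D.1, D.2.1, D.2.2, (s ω).total⟩ : SEState K).update T γ (y ω)) ?_ fun ω => rfl
  rintro ⟨a, p, r⟩
  set c : Fin K := (⟨a, p, r, fun _ => 0⟩ : SEState K).arm with hc
  have harm : ∀ ω, (⟨a, p, r, (s ω).total⟩ : SEState K).arm = c := fun ω =>
    SEState.arm_congr rfl
  have htot : ∀ i, Measurable fun ω =>
      Function.update (s ω).total c ((s ω).total c + y ω) i := by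
    intro i
    by_cases hi : i = c
    · subst hi
      have := (hs.total c).add hy
      simpa [Pi.add_def] using this
    · simpa [Function.update_of_ne hi] using hs.total i
  simp only [SEState.update, harm]
  by_cases hp : (p.erase c).Nonempty
  · simp only [if_pos hp]
    exact ⟨measurable_const, measurable_const, measurable_const, htot⟩
  · simp only [if_neg hp]
    have hkept : Measurable fun ω => a.filter fun i => ∀ j ∈ a,
        Function.update (s ω).total c ((s ω).total c + y ω) j / ((r + 1 : ℕ) : ℝ) -
          γ * confU (r + 1) T ≤
        Function.update (s ω).total c ((s ω).total c + y ω) i / ((r + 1 : ℕ) : ℝ) := by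
      rw [measurable_finset_iff]
      intro i
      simp only [Finset.mem_filter]
      refine measurable_const.and (Measurable.forall fun j => measurable_const.imp ?_)
      exact measurableSet_setOfPred.mp
        (measurableSet_le (((htot j).div_const _).sub_const _) ((htot i).div_const _))
    refine ⟨?_, ?_, measurable_const, htot⟩
    · convert hkept
    · convert hkept

variable {n : ℕ} {β L : ℝ} {X : ℕ → Ω → Cov d} {Y : ℕ → Fin K → Ω → ℝ}

lemma measurable_curBin_of {t : ℕ}
    (hσ : MeasurableState fun ω => abseState n β L (fun s => X s ω) (fun s i => Y s i ω) t)
    (hX : Measurable (X t)) :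
    Measurable fun ω => curBin n β L (fun s => X s ω) (fun s i => Y s i ω) t :=
  hσ.liveBin hX

lemma measurable_abseArm_of {t : ℕ}
    (hσ : MeasurableState fun ω => abseState n β L (fun s => X s ω) (fun s i => Y s i ω) t)
    (hX : Measurable (X t)) :
    Measurable fun ω => abseArm n β L (fun s => X s ω) (fun s i => Y s i ω) t :=
  measurable_of_countable_cases (measurable_curBin_of hσ hX)
    (fun B ω => ((abseState n β L (fun s => X s ω) (fun s i => Y s i ω) t).se B).arm)
    (fun B => (hσ.se B).arm) fun _ => rfl

lemma MeasurableState.succ {t : ℕ}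
    (hσ : MeasurableState fun ω => abseState n β L (fun s => X s ω) (fun s i => Y s i ω) t)
    (hX : Measurable (X t)) (hY : ∀ i, Measurable (Y t i)) :
    MeasurableState fun ω => abseState n β L (fun s => X s ω) (fun s i => Y s i ω) (t + 1) := by
  classical
  have hB := measurable_curBin_of hσ hX
  have hA := measurable_abseArm_of hσ hX
  have hy : Measurable fun ω => Y t (abseArm n β L (fun s => X s ω) (fun s i => Y s i ω) t) ω :=
    measurable_of_countable_cases hA (fun i => Y t i) hY fun _ => rfl
  have hu : MeasurableSE fun ω => nextSE n β L (fun s => X s ω) (fun s i => Y s i ω) t :=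
    MeasurableSE.of_cases hB (fun B ω =>
      ((abseState n β L (fun s => X s ω) (fun s i => Y s i ω) t).se B).update (binHorizon n B) 2
        (Y t (abseArm n β L (fun s => X s ω) (fun s i => Y s i ω) t) ω))
      (fun B => (hσ.se B).update hy _ _) fun _ => rfl
  set S : Bin d × ℕ × Finset (Fin K) → Prop := fun D =>
    roundLimit n β L D.1 ≤ D.2.1 ∧ D.1.1 + 1 ≤ maxDepth d K n β ∧ 2 ≤ D.2.2.card with hS
  have hD : Measurable fun ω =>
      ((curBin n β L (fun s => X s ω) (fun s i => Y s i ω) t,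
        (nextSE n β L (fun s => X s ω) (fun s i => Y s i ω) t).rounds,
        (nextSE n β L (fun s => X s ω) (fun s i => Y s i ω) t).active) :
        Bin d × ℕ × Finset (Fin K)) :=
    hB.prodMk (hu.rounds.prodMk hu.active)
  refine ⟨?_, fun B' => ?_⟩
  · refine measurable_of_countable_cases (hD.prodMk hσ.live)
      (fun D _ => if S D.1 then D.2.erase D.1.1 ∪ burst D.1.1 else D.2)
      (fun _ => measurable_const) fun ω => ?_
    by_cases hs : Splits n β L (fun s => X s ω) (fun s i => Y s i ω) t
    · rw [abseState_succ_of_splits hs]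
      exact (if_pos hs).symm
    · rw [abseState_succ_of_not_splits hs]
      exact (if_neg hs).symm
  · refine MeasurableSE.of_cases hD
      (fun D ω => if S D then
        (if B' ∈ burst D.1 then SEState.init D.2.2 else
          if B' = D.1 then nextSE n β L (fun s => X s ω) (fun s i => Y s i ω) t
          else (abseState n β L (fun s => X s ω) (fun s i => Y s i ω) t).se B')
        else if B' = D.1 then nextSE n β L (fun s => X s ω) (fun s i => Y s i ω) t
          else (abseState n β L (fun s => X s ω) (fun s i => Y s i ω) t).se B')
      (fun D => ?_) fun ω => ?_
    · split_ifs
      · exact MeasurableSE.const _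
      · exact hu
      · exact hσ.se B'
      · exact hu
      · exact hσ.se B'
    · by_cases hs : Splits n β L (fun s => X s ω) (fun s i => Y s i ω) t
      · rw [abseState_succ_of_splits hs]
        have hs' : S (curBin n β L (fun s => X s ω) (fun s i => Y s i ω) t,
          (nextSE n β L (fun s => X s ω) (fun s i => Y s i ω) t).rounds,
          (nextSE n β L (fun s => X s ω) (fun s i => Y s i ω) t).active) := hs
        simp only [hs', if_true, Function.update_apply]
      · rw [abseState_succ_of_not_splits hs]
        have hs' : ¬ S (curBin n β L (fun s => X s ω) (fun s i => Y s i ω) t,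
          (nextSE n β L (fun s => X s ω) (fun s i => Y s i ω) t).rounds,
          (nextSE n β L (fun s => X s ω) (fun s i => Y s i ω) t).active) := hs
        simp only [hs', if_false, Function.update_apply]

/-- Only times before `t` enter, and the σ-algebra on `Ω` is arbitrary. The statement can thus be
applied to the history σ-algebra, which shows that the state before time `t` is determined by the
past. -/
lemma measurableState (t : ℕ) (hX : ∀ s < t, Measurable (X s))
    (hY : ∀ s < t, ∀ i, Measurable (Y s i)) :
    MeasurableState fun ω => abseState n β L (fun s => X s ω) (fun s i => Y s i ω) t := by
  induction t with
  | zero => exact ⟨measurable_const, fun B => MeasurableSE.const _⟩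
  | succ t ih =>
    exact (ih (fun s hs => hX s (by omega)) fun s hs => hY s (by omega)).succ
      (hX t (by omega)) (hY t (by omega))

lemma measurableSet_hit {t : ℕ} (hX : ∀ s ≤ t, Measurable (X s))
    (hY : ∀ s < t, ∀ i, Measurable (Y s i)) (A : Bin d) (i : Fin K) :
    MeasurableSet {ω | curBin n β L (fun s => X s ω) (fun s i => Y s i ω) t = A ∧
      abseArm n β L (fun s => X s ω) (fun s i => Y s i ω) t = i} := by
  have hσ := measurableState (n := n) (β := β) (L := L) t (fun s hs => hX s hs.le) hY
  exact (measurable_curBin_of hσ (hX t le_rfl) (measurableSet_singleton A)).inter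
    (measurable_abseArm_of hσ (hX t le_rfl) (measurableSet_singleton i))

lemma measurable_pulls (t : ℕ) (hX : ∀ s < t, Measurable (X s))
    (hY : ∀ s < t, ∀ i, Measurable (Y s i)) (A : Bin d) (i : Fin K) :
    Measurable fun ω => pulls n β L (fun s => X s ω) (fun s i => Y s i ω) A i t := by
  unfold pulls
  refine Finset.measurable_fun_sum _ fun s hs => ?_
  have hs' := Finset.mem_range.mp hs
  exact Measurable.ite (measurableSet_hit (fun r hr => hX r (by omega))
    (fun r hr => hY r (by omega)) A i) measurable_const measurable_const

lemma measurable_gain (t : ℕ) (hX : ∀ s < t, Measurable (X s))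
    (hY : ∀ s < t, ∀ i, Measurable (Y s i)) (A : Bin d) (i : Fin K) :
    Measurable fun ω => gain n β L (fun s => X s ω) (fun s i => Y s i ω) A i t := by
  unfold gain
  refine Finset.measurable_fun_sum _ fun s hs => ?_
  have hs' := Finset.mem_range.mp hs
  exact Measurable.ite (measurableSet_hit (fun r hr => hX r (by omega))
    (fun r hr => hY r (by omega)) A i) (hY s hs' i) measurable_const

lemma measurableSet_failed (t : ℕ) (hX : ∀ s < t, Measurable (X s))
    (hY : ∀ s < t, ∀ i, Measurable (Y s i)) (m : Bin d → Fin K → ℝ) (A : Bin d) :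
    MeasurableSet {ω | Failed n β L (fun s => X s ω) (fun s i => Y s i ω) m A t} := by
  have : {ω | Failed n β L (fun s => X s ω) (fun s i => Y s i ω) m A t} =
      ⋃ s, ⋃ (_ : s ≤ t), ⋃ i, ⋃ N : ℕ,
        {ω | pulls n β L (fun s => X s ω) (fun s i => Y s i ω) A i s = N} ∩
        {ω | 1 ≤ N ∧ N ≤ roundLimit n β L A ∧ N * confU N (binHorizon n A) / 2 <
          |gain n β L (fun s => X s ω) (fun s i => Y s i ω) A i s - N * m A i|} := by
    ext ω
    simp only [Failed, Set.mem_ofPred_eq, Set.mem_iUnion, Set.mem_inter_iff, exists_prop,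
      exists_eq_left']
  rw [this]
  refine MeasurableSet.iUnion fun s => MeasurableSet.iUnion fun hs => MeasurableSet.iUnion fun i =>
    MeasurableSet.iUnion fun N => ?_
  refine (measurable_pulls s (fun r hr => hX r (by omega)) (fun r hr => hY r (by omega)) A i
    (measurableSet_singleton N)).inter ?_
  refine measurableSet_setOfPred.mpr (measurable_const.and (measurable_const.and
    (measurableSet_setOfPred.mp (measurableSet_lt measurable_const ?_))))
  exact ((measurable_gain s (fun r hr => hX r (by omega)) (fun r hr => hY r (by omega)) A i).sub
    measurable_const).norm

end Measurability

/-! ### A maximal inequality -/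

section Maximal

open Classical in
/-- The product of the factors `H s` over the times `s < t` at which the event `G s` occurs. -/
def prodOn {Ω : Type*} (G : ℕ → Set Ω) (H : ℕ → Ω → ℝ≥0∞) (t : ℕ) (ω : Ω) : ℝ≥0∞ :=
  ∏ s ∈ Finset.range t, if ω ∈ G s then H s ω else 1

lemma prodOn_succ {Ω : Type*} (G : ℕ → Set Ω) (H : ℕ → Ω → ℝ≥0∞) (t : ℕ) (ω : Ω) [Decidable (ω ∈ G t)] :
    prodOn G H (t + 1) ω = prodOn G H t ω * if ω ∈ G t then H t ω else 1 := by
  classical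
  unfold prodOn
  rw [Finset.prod_range_succ]
  congr!

/-- The σ-algebra is left free because this is used for members of a filtration. -/
lemma measurable_mul_ite {Ω : Type*} {_ : MeasurableSpace Ω} {f g : Ω → ℝ≥0∞} {G : Set Ω}
    [DecidablePred (· ∈ G)] (hf : Measurable f) (hg : Measurable g) (hG : MeasurableSet G) :
    Measurable fun ω => f ω * if ω ∈ G then g ω else 1 :=
  hf.mul (Measurable.ite hG hg measurable_const)

lemma measurableSet_const_le {Ω : Type*} {_ : MeasurableSpace Ω} {f : Ω → ℝ≥0∞} (hf : Measurable f)
    (c : ℝ≥0∞) : MeasurableSet {ω | c ≤ f ω} := measurableSet_le measurable_const hf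

lemma measurable_indicator_of {Ω : Type*} {_ : MeasurableSpace Ω} {f : Ω → ℝ≥0∞} {G : Set Ω}
    (hf : Measurable f) (hG : MeasurableSet G) : Measurable (G.indicator f) := hf.indicator hG

/-- Ville's maximal inequality for a product of factors of mean at most `1`, each of them independent
of the past and taken into account only on an event determined by the past. -/
lemma measure_exists_le_prodOn {Ω : Type*} [mΩ : MeasurableSpace Ω] {μ : Measure Ω}
    [IsProbabilityMeasure μ] {F E : ℕ → MeasurableSpace Ω} (hF : ∀ t, F t ≤ mΩ)
    (hE : ∀ t, E t ≤ mΩ) (hmono : ∀ t, F t ≤ F (t + 1)) (hEF : ∀ t, E t ≤ F (t + 1))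
    (hind : ∀ t, Indep (F t) (E t) μ) {G : ℕ → Set Ω} {H : ℕ → Ω → ℝ≥0∞}
    (hG : ∀ t, MeasurableSet[F t] (G t)) (hH : ∀ t, Measurable[E t] (H t))
    (hH1 : ∀ t, ∫⁻ ω, H t ω ∂μ ≤ 1) (c : ℝ≥0∞) (t : ℕ) :
    c * μ {ω | ∃ s ≤ t, c ≤ prodOn G H s ω} ≤ 1 := by
  classical
  have hM : ∀ t, Measurable[F t] (prodOn G H t) := by
    intro t
    induction t with
    | zero => unfold prodOn; simp only [Finset.range_zero, Finset.prod_empty]; exact measurable_const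
    | succ t ih =>
      have : prodOn G H (t + 1) = fun ω => prodOn G H t ω * if ω ∈ G t then H t ω else 1 := by
        funext ω; rw [prodOn_succ]
      rw [this]
      exact measurable_mul_ite (ih.mono (hmono t) le_rfl) ((hH t).mono (hEF t) le_rfl)
        (hmono t _ (hG t))
  set A : ℕ → Set Ω := fun t => {ω | ∃ s ≤ t, c ≤ prodOn G H s ω} with hA
  have hmon : ∀ s t, s ≤ t → F s ≤ F t := fun s t hst =>
    monotone_nat_of_le_succ hmono hst
  have hAm : ∀ t, MeasurableSet[F t] (A t) := by
    intro t
    have : A t = ⋃ s, ⋃ (_ : s ≤ t), {ω | c ≤ prodOn G H s ω} := by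
      ext ω; simp [hA]
    rw [this]
    refine @MeasurableSet.iUnion _ _ (F t) _ _ fun s => ?_
    refine @MeasurableSet.iUnion _ _ (F t) _ _ fun hs => ?_
    exact hmon s t hs _ (measurableSet_const_le (hM s) c)
  -- The induction runs on this potential, which never increases: mass that first reaches level `c`
  -- at time `t + 1` is paid for by the part of the integral that it removes.
  suffices h : c * μ (A t) + ∫⁻ ω in (A t)ᶜ, prodOn G H t ω ∂μ ≤ 1 from
    le_trans le_self_add h
  induction t with
  | zero =>
    have h0 : ∀ ω, prodOn G H 0 ω = 1 := fun ω => by simp [prodOn]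
    by_cases hc : c ≤ 1
    · have : A 0 = Set.univ := by
        ext ω; simp [hA, h0, hc]
      rw [this]; simpa using hc
    · have : A 0 = ∅ := by
        ext ω; simp [hA, h0, hc]
      rw [this]; simp [h0]
  | succ t ih =>
    refine le_trans ?_ ih
    have hAt := hF t _ (hAm t)
    have hMt1 : Measurable (prodOn G H (t + 1)) := (hM (t + 1)).mono (hF _) le_rfl
    have hMt : Measurable (prodOn G H t) := (hM t).mono (hF _) le_rfl
    set D : Set Ω := {ω | c ≤ prodOn G H (t + 1) ω} with hD
    have hDm : MeasurableSet D := measurableSet_le measurable_const hMt1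
    have hsucc : A (t + 1) = A t ∪ (D ∩ (A t)ᶜ) := by
      ext ω
      simp only [hA, hD, Set.mem_union, Set.mem_inter_iff, Set.mem_compl_iff]
      constructor
      · rintro ⟨s, hs, hc⟩
        by_cases h : ∃ s ≤ t, c ≤ prodOn G H s ω
        · exact Or.inl h
        · refine Or.inr ⟨?_, h⟩
          rcases Nat.lt_or_ge t s with h1 | h1
          · obtain rfl : s = t + 1 := by omega
            exact hc
          · exact absurd ⟨s, h1, hc⟩ h
      · rintro (⟨s, hs, hc⟩ | ⟨hc, _⟩)
        · exact ⟨s, by omega, hc⟩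
        · exact ⟨t + 1, le_rfl, hc⟩
    have hcompl : (A (t + 1))ᶜ = Dᶜ ∩ (A t)ᶜ := by
      rw [hsucc]; ext ω
      simp only [Set.mem_compl_iff, Set.mem_union, Set.mem_inter_iff]
      tauto
    have h1 : c * μ (A (t + 1)) ≤
        c * μ (A t) + ∫⁻ ω in D ∩ (A t)ᶜ, prodOn G H (t + 1) ω ∂μ := by
      rw [hsucc]
      refine (mul_le_mul_right (measure_union_le _ _) c).trans ?_
      rw [mul_add]
      refine add_le_add le_rfl ?_
      rw [← setLIntegral_const]
      exact setLIntegral_mono' (hDm.inter hAt.compl) fun ω hω => hω.1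
    have h2 : ∫⁻ ω in D ∩ (A t)ᶜ, prodOn G H (t + 1) ω ∂μ +
        ∫⁻ ω in (A (t + 1))ᶜ, prodOn G H (t + 1) ω ∂μ =
        ∫⁻ ω in (A t)ᶜ, prodOn G H (t + 1) ω ∂μ := by
      rw [hcompl, Set.inter_comm D, Set.inter_comm Dᶜ, ← Set.sdiff_eq]
      exact lintegral_inter_add_sdiff _ _ hDm
    have h3 : ∫⁻ ω in (A t)ᶜ, prodOn G H (t + 1) ω ∂μ ≤ ∫⁻ ω in (A t)ᶜ, prodOn G H t ω ∂μ := by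
      rw [← lintegral_indicator hAt.compl, ← lintegral_indicator hAt.compl]
      have hGt := hF t _ (hG t)
      set W : Ω → ℝ≥0∞ := (A t)ᶜ.indicator (prodOn G H t) with hW
      have hWm : Measurable[F t] W :=
        measurable_indicator_of (hM t) (hAm t).compl
      have hWm' : Measurable W := hWm.mono (hF t) le_rfl
      -- The new factor multiplies only a function of the past, so independence applies; outside `G
      -- t` the product does not change.
      have e1 : ∀ ω, (A t)ᶜ.indicator (fun ω => prodOn G H (t + 1) ω) ω =
          (G t).indicator W ω * H t ω + (G t)ᶜ.indicator W ω := by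
        intro ω
        by_cases hω : ω ∈ (A t)ᶜ <;> by_cases hg : ω ∈ G t <;>
          simp [hW, hω, hg, prodOn_succ, Set.indicator]
      have e2 : ∫⁻ ω, W ω ∂μ = ∫⁻ ω, ((G t).indicator W ω + (G t)ᶜ.indicator W ω) ∂μ := by
        refine lintegral_congr fun ω => ?_
        by_cases hg : ω ∈ G t <;> simp [hg]
      simp only [e1]
      rw [e2]
      have hm1 : Measurable fun ω => (G t).indicator W ω := hWm'.indicator hGt
      rw [lintegral_add_right _ (hWm'.indicator hGt.compl),
        lintegral_add_right _ (hWm'.indicator hGt.compl)]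
      refine add_le_add ?_ le_rfl
      rw [lintegral_mul_eq_lintegral_mul_lintegral_of_independent_measurableSpace (hF t) (hE t)
        (hind t) (measurable_indicator_of hWm (hG t)) (hH t)]
      calc _ ≤ (∫⁻ ω, (G t).indicator W ω ∂μ) * 1 := by gcongr; exact hH1 t
        _ = _ := mul_one _
    calc c * μ (A (t + 1)) + ∫⁻ ω in (A (t + 1))ᶜ, prodOn G H (t + 1) ω ∂μ
        ≤ c * μ (A t) + (∫⁻ ω in D ∩ (A t)ᶜ, prodOn G H (t + 1) ω ∂μ +
          ∫⁻ ω in (A (t + 1))ᶜ, prodOn G H (t + 1) ω ∂μ) := by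
          rw [← add_assoc]; exact add_le_add h1 le_rfl
      _ ≤ c * μ (A t) + ∫⁻ ω in (A t)ᶜ, prodOn G H t ω ∂μ := by
          rw [h2]; exact add_le_add le_rfl h3

end Maximal

/-! ### The history of the machine -/

section History

set_option linter.unusedSectionVars false

variable {Ω : Type*} [mΩ : MeasurableSpace Ω] {d K : ℕ}

/-- The σ-algebra generated by the observation at time `t`. -/
abbrev obs (X : ℕ → Ω → Cov d) (Y : ℕ → Fin K → Ω → ℝ) (t : ℕ) : MeasurableSpace Ω :=
  MeasurableSpace.comap (fun ω => (X t ω, fun i => Y t i ω)) inferInstance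

/-- The σ-algebra generated by the observations before time `t`. -/
abbrev hist (X : ℕ → Ω → Cov d) (Y : ℕ → Fin K → Ω → ℝ) (t : ℕ) : MeasurableSpace Ω :=
  ⨆ s ∈ Set.Iio t, obs X Y s

variable {μ : Measure Ω} {PX : Measure (Cov d)} {f : Fin K → Cov d → ℝ} {X : ℕ → Ω → Cov d}
  {Y : ℕ → Fin K → Ω → ℝ}

lemma IsMachine.obs_le (hM : IsMachine μ PX f X Y) (t : ℕ) : obs X Y t ≤ mΩ :=
  Measurable.comap_le ((hM.measurable_X t).prodMk (measurable_pi_lambda _ (hM.measurable_Y t)))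

lemma IsMachine.hist_le (hM : IsMachine μ PX f X Y) (t : ℕ) : hist X Y t ≤ mΩ :=
  iSup₂_le fun s _ => hM.obs_le s

lemma obs_le_hist {s t : ℕ} (h : s < t) : obs X Y s ≤ hist X Y t :=
  le_iSup₂_of_le (f := fun s (_ : s ∈ Set.Iio t) => obs X Y s) s h le_rfl

lemma hist_mono {s t : ℕ} (h : s ≤ t) : hist X Y s ≤ hist X Y t :=
  iSup₂_le fun _ hr => obs_le_hist (lt_of_lt_of_le hr h)

lemma IsMachine.indep_hist_obs (hM : IsMachine μ PX f X Y) (t : ℕ) :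
    Indep (hist X Y t) (obs X Y t) μ := by
  have h := indep_iSup_of_disjoint (m := obs X Y) hM.obs_le hM.indep
    (S := Set.Iio t) (T := {t}) (by simp)
  simpa [hist] using h

lemma measurable_obs_X (t : ℕ) : Measurable[obs X Y t] (X t) := by
  have := comap_measurable (m := inferInstance) (fun ω => (X t ω, fun i => Y t i ω))
  exact measurable_fst.comp this

lemma measurable_obs_Y (t : ℕ) (i : Fin K) : Measurable[obs X Y t] (Y t i) := by
  have := comap_measurable (m := inferInstance) (fun ω => (X t ω, fun i => Y t i ω))
  exact (measurable_pi_apply i).comp (measurable_snd.comp this)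

lemma measurable_hist_X {s t : ℕ} (h : s < t) : Measurable[hist X Y t] (X s) :=
  (measurable_obs_X (Y := Y) s).mono (obs_le_hist h) le_rfl

lemma measurable_hist_Y {s t : ℕ} (h : s < t) (i : Fin K) : Measurable[hist X Y t] (Y s i) :=
  (measurable_obs_Y (X := X) s i).mono (obs_le_hist h) le_rfl

lemma continuousOn_of_smoothness {β L : ℝ} (hβ : 0 < β) (hf : Smoothness f β L) (i : Fin K) :
    ContinuousOn (f i) (unitCube d) := by
  intro z hz
  rw [ContinuousWithinAt, tendsto_iff_norm_sub_tendsto_zero]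
  have h0 : Filter.Tendsto (fun w => L * ‖w - z‖ ^ β) (nhdsWithin z (unitCube d)) (nhds 0) := by
    have h1 : Continuous fun w : Cov d => L * ‖w - z‖ ^ β :=
      continuous_const.mul ((continuous_id.sub continuous_const).norm.rpow_const
        fun _ => Or.inr hβ.le)
    have h2 := (h1.tendsto z).mono_left (nhdsWithin_le_nhds (s := unitCube d))
    simpa [Real.zero_rpow hβ.ne'] using h2
  refine squeeze_zero' (Filter.Eventually.of_forall fun _ => norm_nonneg _) ?_ h0
  filter_upwards [self_mem_nhdsWithin] with w hw
  exact hf i w hw z hz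

variable [IsProbabilityMeasure μ]

lemma IsMachine.isProbabilityMeasure (hM : IsMachine μ PX f X Y) : IsProbabilityMeasure PX := by
  rw [← hM.law_X 0]
  exact Measure.isProbabilityMeasure_map (hM.measurable_X 0).aemeasurable

lemma IsMachine.ae_mem_unitCube (hM : IsMachine μ PX f X Y) : ∀ᵐ z ∂PX, z ∈ unitCube d := by
  rw [← hM.law_X 0]
  exact (ae_map_iff (hM.measurable_X 0).aemeasurable measurableSet_unitCube).mpr (hM.X_mem 0)

lemma IsMachine.aestronglyMeasurable (hM : IsMachine μ PX f X Y) {β L : ℝ} (hβ : 0 < β)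
    (hf : Smoothness f β L) (i : Fin K) : AEStronglyMeasurable (f i) PX := by
  have := (continuousOn_of_smoothness hβ hf i).aestronglyMeasurable (μ := PX)
    measurableSet_unitCube
  rwa [Measure.restrict_eq_self_of_ae_mem hM.ae_mem_unitCube] at this

/-- The mean reward of arm `i` when the covariate belongs to the bin `A`. -/
def binMean (PX : Measure (Cov d)) (f : Fin K → Cov d → ℝ) (A : Bin d) (i : Fin K) : ℝ :=
  (∫ z in cell A, f i z ∂PX) / PX.real (cell A)

/-- The event that the covariate of time `t` belongs to the bin `A`. -/
def inBin (X : ℕ → Ω → Cov d) (A : Bin d) (t : ℕ) : Set Ω := {ω | binAt A.1 (X t ω) = A}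

lemma measurableSet_obs_inBin (A : Bin d) (t : ℕ) : MeasurableSet[obs X Y t] (inBin X A t) :=
  (measurable_binAt A.1).comp (measurable_obs_X (Y := Y) t) (measurableSet_singleton A)

lemma IsMachine.measurableSet_inBin (hM : IsMachine μ PX f X Y) (A : Bin d) (t : ℕ) :
    MeasurableSet (inBin X A t) :=
  hM.obs_le t _ (measurableSet_obs_inBin (Y := Y) A t)

lemma IsMachine.inBin_ae_eq (hM : IsMachine μ PX f X Y) (A : Bin d) (t : ℕ) :
    inBin X A t =ᵐ[μ] X t ⁻¹' cell A := by
  filter_upwards [hM.X_mem t] with ω hω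
  refine propext ⟨fun h => ⟨hω, h⟩, fun h => h.2⟩

lemma IsMachine.measure_preimage (hM : IsMachine μ PX f X Y) (t : ℕ) {S : Set (Cov d)}
    (hS : MeasurableSet S) : μ (X t ⁻¹' S) = PX S := by
  rw [← hM.law_X t, Measure.map_apply (hM.measurable_X t) hS]

lemma IsMachine.measure_inBin (hM : IsMachine μ PX f X Y) (A : Bin d) (t : ℕ) :
    μ (inBin X A t) = PX (cell A) := by
  rw [measure_congr (hM.inBin_ae_eq A t), hM.measure_preimage t (measurableSet_cell A)]

lemma IsMachine.integrable_Y (hM : IsMachine μ PX f X Y) (t : ℕ) (i : Fin K) :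
    Integrable (Y t i) μ := by
  refine Integrable.of_bound (hM.measurable_Y t i).aestronglyMeasurable 1 ?_
  filter_upwards [hM.Y_mem t i] with ω hω
  rw [Real.norm_eq_abs, abs_le]
  constructor <;> linarith [hω.1, hω.2]

/-- Belonging to the bin is an event of `σ(X t)`, so the reward can be replaced by its conditional
expectation. Given the bin, its mean is therefore `binMean`, although `f i` varies within the bin.
-/
lemma IsMachine.setIntegral_Y (hM : IsMachine μ PX f X Y) {β L : ℝ} (hβ : 0 < β)
    (hf : Smoothness f β L) (A : Bin d) (t : ℕ) (i : Fin K) :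
    ∫ ω in inBin X A t, Y t i ω ∂μ = ∫ z in cell A, f i z ∂PX := by
  have hle : MeasurableSpace.comap (X t) inferInstance ≤ mΩ := (hM.measurable_X t).comap_le
  have hS : MeasurableSet[MeasurableSpace.comap (X t) inferInstance] (inBin X A t) :=
    ⟨binAt A.1 ⁻¹' {A}, measurable_binAt A.1 (measurableSet_singleton A), rfl⟩
  rw [← setIntegral_condExp hle (hM.integrable_Y t i) hS,
    setIntegral_congr_ae (g := fun ω => f i (X t ω)) (hM.measurableSet_inBin A t)
      ((hM.condExp_Y t i).mono fun ω h _ => h),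
    setIntegral_congr_set (hM.inBin_ae_eq A t)]
  have := hM.aestronglyMeasurable hβ hf i
  conv_rhs => rw [← hM.law_X t]
  rw [setIntegral_map (measurableSet_cell A) (by rw [hM.law_X t]; exact this)
    (hM.measurable_X t).aemeasurable]

open Classical in
/-- The factor of the exponential supermartingale attached to the bin `A` and the arm `i`. -/
def expFactor (X : ℕ → Ω → Cov d) (Y : ℕ → Fin K → Ω → ℝ) (A : Bin d) (i : Fin K) (m l : ℝ)
    (t : ℕ) (ω : Ω) : ℝ≥0∞ :=
  if ω ∈ inBin X A t then ENNReal.ofReal (Real.exp (l * (Y t i ω - m) - l ^ 2 / 8)) else 1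

lemma measurable_expFactor (A : Bin d) (i : Fin K) (m l : ℝ) (t : ℕ) :
    Measurable[obs X Y t] (expFactor X Y A i m l t) := by
  have hY := measurable_obs_Y (X := X) (Y := Y) t i
  have h : Measurable[obs X Y t] fun ω =>
      ENNReal.ofReal (Real.exp (l * (Y t i ω - m) - l ^ 2 / 8)) := by
    have hc : Continuous fun v : ℝ => Real.exp (l * (v - m) - l ^ 2 / 8) := by fun_prop
    exact ENNReal.measurable_ofReal.comp (hc.measurable.comp hY)
  exact Measurable.ite (measurableSet_obs_inBin (Y := Y) A t) h measurable_const

/-- Conditionally on `X t` falling in the bin, the reward lies in `[0,1]` and has mean `binMean`;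
Hoeffding's lemma bounds its centred exponential moment by `exp (l ^ 2 / 8)`. Off that event the
factor is 1. -/
lemma IsMachine.lintegral_expFactor_le (hM : IsMachine μ PX f X Y) {β L : ℝ} (hβ : 0 < β)
    (hf : Smoothness f β L) (A : Bin d) (i : Fin K) (l : ℝ) (t : ℕ) :
    ∫⁻ ω, expFactor X Y A i (binMean PX f A i) l t ω ∂μ ≤ 1 := by
  set S := inBin X A t with hS
  set m := binMean PX f A i with hm
  have hSm : MeasurableSet S := hM.measurableSet_inBin A t
  have hsplit : ∫⁻ ω, expFactor X Y A i m l t ω ∂μ =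
      ∫⁻ ω in S, ENNReal.ofReal (Real.exp (l * (Y t i ω - m) - l ^ 2 / 8)) ∂μ + μ Sᶜ := by
    rw [← lintegral_add_compl _ hSm]
    congr 1
    · exact setLIntegral_congr_fun hSm fun ω hω => if_pos hω
    · have : ∫⁻ ω in Sᶜ, expFactor X Y A i m l t ω ∂μ = ∫⁻ _ω in Sᶜ, 1 ∂μ :=
        setLIntegral_congr_fun hSm.compl fun ω hω => if_neg hω
      rw [this]
      simp
  rw [hsplit]
  suffices h : ∫⁻ ω in S, ENNReal.ofReal (Real.exp (l * (Y t i ω - m) - l ^ 2 / 8)) ∂μ ≤ μ S by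
    calc _ ≤ μ S + μ Sᶜ := by gcongr
      _ = 1 := prob_add_prob_compl hSm
  -- Conditioning needs an event of positive probability; on a null event the bound is trivial.
  by_cases h0 : μ S = 0
  · rw [setLIntegral_measure_zero _ _ h0]; exact zero_le
  set ν : Measure Ω := ProbabilityTheory.cond μ S with hν
  have hνp : IsProbabilityMeasure ν := cond_isProbabilityMeasure h0
  have hac : ν ≪ μ := ProbabilityTheory.cond_absolutelyContinuous
  have hint : ∫ ω, Y t i ω ∂ν = m := by
    rw [hν, ProbabilityTheory.cond, integral_smul_measure, hM.setIntegral_Y hβ hf, hm, binMean,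
      hS, hM.measure_inBin, ENNReal.toReal_inv, smul_eq_mul, div_eq_inv_mul]
    rfl
  have hsub := hasSubgaussianMGF_of_mem_Icc (μ := ν) (X := Y t i) (a := 0) (b := 1)
    (hM.measurable_Y t i).aemeasurable (hac.ae_le ((hM.Y_mem t i).mono fun ω h => h))
  rw [hint] at hsub
  have hmgf := hsub.mgf_le l
  have hi := hsub.integrable_exp_mul l
  have hexp : ∫⁻ ω, ENNReal.ofReal (Real.exp (l * (Y t i ω - m) - l ^ 2 / 8)) ∂ν ≤ 1 := by
    have hi' : Integrable (fun ω => Real.exp (l * (Y t i ω - m) - l ^ 2 / 8)) ν := by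
      simp only [Real.exp_sub]
      exact hi.div_const _
    rw [← ofReal_integral_eq_lintegral_ofReal hi'
      (Filter.Eventually.of_forall fun _ => (Real.exp_pos _).le)]
    refine ENNReal.ofReal_le_one.mpr ?_
    simp only [Real.exp_sub]
    rw [integral_div, div_le_one (Real.exp_pos _)]
    refine hmgf.trans (Real.exp_le_exp.mpr (le_of_eq ?_))
    norm_num
    ring
  have hscale : ∫⁻ ω, ENNReal.ofReal (Real.exp (l * (Y t i ω - m) - l ^ 2 / 8)) ∂ν =
      (μ S)⁻¹ * ∫⁻ ω in S, ENNReal.ofReal (Real.exp (l * (Y t i ω - m) - l ^ 2 / 8)) ∂μ := by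
    rw [hν, ProbabilityTheory.cond, lintegral_smul_measure, smul_eq_mul]
  rw [hscale, mul_comm, ← div_eq_mul_inv,
    ENNReal.div_le_iff h0 (measure_ne_top μ S), one_mul] at hexp
  exact hexp

end History

/-! ### Probability of failure -/

section Failure

/-- From `log (b/a) ≤ b/a - 1`, passing from `T/b` to `T/a` costs at most `b - a`, which is absorbed
because `logBar ≥ 1`. Consequently the deviation threshold `N U(N) / 2` is nondecreasing in `N`. -/
lemma mul_logBar_le {a b T : ℝ} (ha : 0 < a) (hab : a ≤ b) (hT : 0 < T) :
    a * logBar (T / a) ≤ b * logBar (T / b) := by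
  have hb : 0 < b := ha.trans_le hab
  have h1 : Real.log (T / a) = Real.log (T / b) + Real.log (b / a) := by
    rw [← Real.log_mul (by positivity) (by positivity)]
    congr 1
    field_simp
  have h2 : Real.log (b / a) ≤ b / a - 1 := Real.log_le_sub_one_of_pos (by positivity)
  have h3 : Real.log (T / b) ≤ logBar (T / b) := le_max_left _ _
  have h4 := logBar_ge_one (T / b)
  have h5 : a * (b / a) = b := by field_simp
  rw [logBar, mul_max_of_nonneg _ _ ha.le]
  refine max_le ?_ ?_
  · rw [h1]
    nlinarith
  · nlinarith

/-- The tilting parameter used for the arms pulled about `2 ^ j` times. -/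
def tilt (T : ℝ) (j : ℕ) : ℝ := 2 * √(2 * 2 ^ j * logBar (T / 2 ^ j)) / 2 ^ j

/-- All `N` in a dyadic block `[q, 2q)` share one tilt. The threshold at `N` is at least its value
`v` at `q`, while the quadratic penalty is at most that at `2q`. The sign `σ` selects the side of
the deviation. -/
lemma exists_le_exp_of_lt {T S : ℝ} (hT : 0 < T) {N : ℕ} (hN : 1 ≤ N)
    (h : N * confU N T / 2 < |S|) :
    ∃ σ : Fin 2, T / 2 ^ (Nat.log 2 N) ≤
      Real.exp ((-1) ^ (σ : ℕ) * tilt T (Nat.log 2 N) * S -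
        ((-1) ^ (σ : ℕ) * tilt T (Nat.log 2 N)) ^ 2 / 8 * N) := by
  set j := Nat.log 2 N with hj
  set q : ℝ := 2 ^ j with hq
  have hq0 : 0 < q := by positivity
  have hNpos : (0 : ℝ) < N := by exact_mod_cast hN
  have h1 : q ≤ N := by
    have : 2 ^ j ≤ N := Nat.pow_log_le_self 2 (by omega)
    rw [hq]; exact_mod_cast this
  have h2 : (N : ℝ) ≤ 2 * q := by
    have : N < 2 ^ (j + 1) := Nat.lt_pow_succ_log_self one_lt_two N
    rw [hq, ← pow_succ']; exact_mod_cast this.le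
  set v := √(2 * q * logBar (T / q)) with hv
  have hv0 : 0 ≤ v := Real.sqrt_nonneg _
  have hlb := logBar_ge_one (T / q)
  have hv2 : v ^ 2 = 2 * q * logBar (T / q) := Real.sq_sqrt (by positivity)
  have h3 : v ≤ N * confU N T / 2 := by
    have e : (N : ℝ) * confU N T / 2 = √(N ^ 2 * (2 * logBar (T / N) / N)) := by
      rw [Real.sqrt_mul (by positivity), Real.sqrt_sq hNpos.le, confU]; ring
    rw [e]
    apply Real.sqrt_le_sqrt
    have := mul_logBar_le hq0 h1 hT
    have e2 : (N : ℝ) ^ 2 * (2 * logBar (T / N) / N) = 2 * (N * logBar (T / N)) := by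
      field_simp
    rw [e2]; linarith
  have hl : tilt T j = 2 * v / q := rfl
  have hl0 : 0 ≤ tilt T j := by rw [hl]; positivity
  have key : Real.log (T / q) ≤ tilt T j * |S| - tilt T j ^ 2 / 8 * N := by
    have e1 : tilt T j * v ≤ tilt T j * |S| := mul_le_mul_of_nonneg_left (h3.trans h.le) hl0
    have e2 : tilt T j ^ 2 / 8 * N ≤ tilt T j ^ 2 / 8 * (2 * q) := by gcongr
    -- The tilt `2v/q` maximizes `l v - l ^ 2 q / 4`; the maximum is `v ^ 2 / q = 2 logBar (T/q)`,
    -- twice what is required.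
    have e3 : tilt T j * v - tilt T j ^ 2 / 8 * (2 * q) = v ^ 2 / q := by
      rw [hl]; field_simp; ring
    have e4 : v ^ 2 / q = 2 * logBar (T / q) := by rw [hv2]; field_simp
    have e5 : Real.log (T / q) ≤ logBar (T / q) := le_max_left _ _
    linarith
  have hexp : T / q ≤ Real.exp (tilt T j * |S| - tilt T j ^ 2 / 8 * N) := by
    rw [← Real.log_le_iff_le_exp (by positivity)]
    exact key
  rcases le_total 0 S with hS | hS
  · refine ⟨0, ?_⟩
    rw [abs_of_nonneg hS] at hexp
    simpa using hexp
  · refine ⟨1, ?_⟩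
    rw [abs_of_nonpos hS] at hexp
    refine hexp.trans (le_of_eq ?_)
    congr 1
    norm_num

lemma measurableSet_mem_live_and_arm {Ω : Type*} {_ : MeasurableSpace Ω} {d K : ℕ} [NeZero K]
    {σ : Ω → ABSEState d K} (hσ : MeasurableState σ) (A : Bin d) (i : Fin K) :
    MeasurableSet {ω | A ∈ (σ ω).live ∧ ((σ ω).se A).arm = i} :=
  (measurableSet_mem_live hσ measurable_const).inter ((hσ.se A).arm (measurableSet_singleton i))

set_option linter.unusedSectionVars false

variable {Ω : Type*} [mΩ : MeasurableSpace Ω] {d K : ℕ} [NeZero K] {n : ℕ} {β L : ℝ}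

/-- The bin `A` is live before time `t` and the next arm to be pulled on it is `i`. -/
def armEvent (n : ℕ) (β L : ℝ) (X : ℕ → Ω → Cov d) (Y : ℕ → Fin K → Ω → ℝ) (A : Bin d)
    (i : Fin K) (t : ℕ) : Set Ω :=
  {ω | A ∈ (abseState n β L (fun s => X s ω) (fun s i => Y s i ω) t).live ∧
    ((abseState n β L (fun s => X s ω) (fun s i => Y s i ω) t).se A).arm = i}

variable {μ : Measure Ω} {PX : Measure (Cov d)} {f : Fin K → Cov d → ℝ} {X : ℕ → Ω → Cov d}
  {Y : ℕ → Fin K → Ω → ℝ}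

lemma measurableState_hist (t : ℕ) :
    @MeasurableState Ω (hist X Y t) d K
      fun ω => abseState n β L (fun s => X s ω) (fun s i => Y s i ω) t :=
  @measurableState Ω (hist X Y t) d K _ n β L X Y t (fun _ hs => measurable_hist_X hs)
    (fun _ hs i => measurable_hist_Y hs i)

lemma measurableSet_armEvent (A : Bin d) (i : Fin K) (t : ℕ) :
    MeasurableSet[hist X Y t] (armEvent n β L X Y A i t) :=
  measurableSet_mem_live_and_arm (measurableState_hist t) A i

/-- A pull of `i` on `A` splits into an event of the past (the bin is live and `i` is next on it)
and the event that `X t` lies in `A`. The first selects the factors and the second is part of the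
factor, as the maximal inequality demands. -/
lemma prodOn_expFactor (hℓ : ∀ A : Bin d, 1 ≤ roundLimit n β L A) (A : Bin d) (i : Fin K)
    (m l : ℝ) (t : ℕ) (ω : Ω) :
    prodOn (armEvent n β L X Y A i) (expFactor X Y A i m l) t ω =
      ENNReal.ofReal (Real.exp (l * (gain n β L (fun s => X s ω) (fun s i => Y s i ω) A i t -
        pulls n β L (fun s => X s ω) (fun s i => Y s i ω) A i t * m) -
        l ^ 2 / 8 * pulls n β L (fun s => X s ω) (fun s i => Y s i ω) A i t)) := by
  classical
  induction t with
  | zero => simp [prodOn, gain, pulls]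
  | succ t ih =>
    have h := invariant (x := fun s => X s ω) (y := fun s i => Y s i ω) hℓ t
    have hiff : (curBin n β L (fun s => X s ω) (fun s i => Y s i ω) t = A ∧
        abseArm n β L (fun s => X s ω) (fun s i => Y s i ω) t = i) ↔
        ω ∈ armEvent n β L X Y A i t ∧ ω ∈ inBin X A t := by
      constructor
      · rintro ⟨h1, h2⟩
        have h3 := (h.liveBin_eq_iff (X t ω) A).mp h1
        refine ⟨⟨h3.1, ?_⟩, h3.2⟩
        rw [abseArm_eq, h1] at h2
        exact h2
      · rintro ⟨⟨h1, h2⟩, h3⟩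
        have h4 : curBin n β L (fun s => X s ω) (fun s i => Y s i ω) t = A :=
          (h.liveBin_eq_iff (X t ω) A).mpr ⟨h1, h3⟩
        refine ⟨h4, ?_⟩
        rw [abseArm_eq, h4]
        exact h2
    rw [prodOn_succ, ih, gain_succ, pulls_succ]
    by_cases hc : curBin n β L (fun s => X s ω) (fun s i => Y s i ω) t = A ∧
        abseArm n β L (fun s => X s ω) (fun s i => Y s i ω) t = i
    · obtain ⟨h1, h2⟩ := hiff.mp hc
      rw [if_pos h1, if_pos hc, if_pos hc, expFactor, if_pos h2,
        ← ENNReal.ofReal_mul (Real.exp_pos _).le, ← Real.exp_add]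
      congr 2
      push_cast
      ring
    · rw [if_neg hc, if_neg hc]
      have : (if ω ∈ armEvent n β L X Y A i t then expFactor X Y A i m l t ω else 1) = 1 := by
        by_cases h1 : ω ∈ armEvent n β L X Y A i t
        · have h2 : ω ∉ inBin X A t := fun h2 => hc (hiff.mpr ⟨h1, h2⟩)
          rw [if_pos h1, expFactor, if_neg h2]
        · rw [if_neg h1]
      rw [this]
      simp

variable [IsProbabilityMeasure μ]

lemma IsMachine.measure_exists_le_exp (hM : IsMachine μ PX f X Y) (hβ : 0 < β)
    (hf : Smoothness f β L) (A : Bin d) (i : Fin K) (l : ℝ) {c : ℝ} (hc : 0 < c) (t : ℕ) :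
    μ {ω | ∃ s ≤ t, ENNReal.ofReal c ≤
      prodOn (armEvent n β L X Y A i) (expFactor X Y A i (binMean PX f A i) l) s ω} ≤
      ENNReal.ofReal c⁻¹ := by
  have h := measure_exists_le_prodOn (μ := μ) (F := hist X Y) (E := obs X Y) hM.hist_le hM.obs_le
    (fun t => hist_mono (Nat.le_succ t)) (fun t => obs_le_hist (Nat.lt_succ_self t))
    hM.indep_hist_obs (fun t => measurableSet_armEvent (n := n) (β := β) (L := L) A i t)
    (fun t => measurable_expFactor A i (binMean PX f A i) l t)
    (fun t => hM.lintegral_expFactor_le hβ hf A i l t) (ENNReal.ofReal c) t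
  rw [ENNReal.ofReal_inv_of_pos hc]
  rwa [mul_comm, ← ENNReal.le_div_iff_mul_le (Or.inl (by simpa using hc))
    (Or.inl ENNReal.ofReal_ne_top), one_div] at h

/-- The probability that a bin fails. -/
lemma IsMachine.measure_failed_le (hM : IsMachine μ PX f X Y) (hβ : 0 < β)
    (hf : Smoothness f β L) (hℓ : ∀ A : Bin d, 1 ≤ roundLimit n β L A) (A : Bin d)
    (hT : 0 < binHorizon n A) (t : ℕ) :
    μ {ω | Failed n β L (fun s => X s ω) (fun s i => Y s i ω) (binMean PX f) A t} ≤
      ENNReal.ofReal (4 * K * roundLimit n β L A / binHorizon n A) := by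
  set T := binHorizon n A with hTdef
  set ℓ := roundLimit n β L A with hℓdef
  set J := Nat.log 2 ℓ with hJ
  -- Peeling: a failure with `N` pulls makes one of the two processes of the block of `N` exceed `T
  -- / 2 ^ j`, and only `j ≤ log₂ ℓ` can occur.
  have hsub : {ω | Failed n β L (fun s => X s ω) (fun s i => Y s i ω) (binMean PX f) A t} ⊆
      ⋃ i : Fin K, ⋃ j ∈ Finset.range (J + 1), ⋃ σ : Fin 2, {ω | ∃ s ≤ t,
        ENNReal.ofReal (T / 2 ^ j) ≤ prodOn (armEvent n β L X Y A i)
          (expFactor X Y A i (binMean PX f A i) ((-1) ^ (σ : ℕ) * tilt T j)) s ω} := by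
    rintro ω ⟨s, hs, i, h1, h2, h3⟩
    obtain ⟨σ, hσ⟩ := exists_le_exp_of_lt hT h1 h3
    simp only [Set.mem_iUnion]
    refine ⟨i, Nat.log 2 (pulls n β L (fun s => X s ω) (fun s i => Y s i ω) A i s),
      Finset.mem_range.mpr (Nat.lt_succ_of_le (Nat.log_mono_right h2)), σ, s, hs, ?_⟩
    rw [prodOn_expFactor hℓ]
    exact ENNReal.ofReal_le_ofReal hσ
  refine (measure_mono hsub).trans ?_
  -- The levels contribute a geometric series dominated by its last term. With two signs and `K`
  -- arms this produces the factor `4 K`.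
  have hpow : ∑ j ∈ Finset.range (J + 1), (2 : ℝ) ^ j / T ≤ 2 * ℓ / T := by
    rw [← Finset.sum_div]
    gcongr
    have e1 : ∑ j ∈ Finset.range (J + 1), (2 : ℝ) ^ j = 2 ^ (J + 1) - 1 := by
      rw [geom_sum_eq (by norm_num)]; norm_num
    have e2 : 2 ^ J ≤ ℓ := Nat.pow_log_le_self 2 (by have := hℓ A; omega)
    have e3 : (2 : ℝ) ^ J ≤ ℓ := by exact_mod_cast e2
    rw [e1, pow_succ]
    linarith
  calc _ ≤ ∑ i : Fin K, ∑ j ∈ Finset.range (J + 1), ∑ σ : Fin 2,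
        ENNReal.ofReal (2 ^ j / T) := by
        refine (measure_iUnion_fintype_le _ _).trans (Finset.sum_le_sum fun i _ => ?_)
        refine (measure_biUnion_finset_le _ _).trans (Finset.sum_le_sum fun j _ => ?_)
        refine (measure_iUnion_fintype_le _ _).trans (Finset.sum_le_sum fun σ _ => ?_)
        refine (hM.measure_exists_le_exp hβ hf A i _ (c := T / 2 ^ j) (by positivity) t).trans
          (le_of_eq ?_)
        rw [inv_div]
    _ = ENNReal.ofReal (∑ i : Fin K, ∑ j ∈ Finset.range (J + 1), ∑ σ : Fin 2, 2 ^ j / T) := by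
        rw [ENNReal.ofReal_sum_of_nonneg fun i _ => by positivity]
        refine Finset.sum_congr rfl fun i _ => ?_
        rw [ENNReal.ofReal_sum_of_nonneg fun i _ => by positivity]
        refine Finset.sum_congr rfl fun j _ => ?_
        rw [ENNReal.ofReal_sum_of_nonneg fun i _ => by positivity]
    _ ≤ ENNReal.ofReal (4 * K * ℓ / T) := by
        apply ENNReal.ofReal_le_ofReal
        simp only [Finset.sum_const, Finset.card_univ, Fintype.card_fin, nsmul_eq_mul,
          ← Finset.mul_sum]
        have : (K : ℝ) * ((2 : ℕ) * ∑ j ∈ Finset.range (J + 1), (2 : ℝ) ^ j / T) ≤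
            K * ((2 : ℕ) * (2 * ℓ / T)) := by gcongr
        refine this.trans (le_of_eq ?_)
        push_cast
        ring

end Failure

/-! ### Bound for the expected regret -/

section Expectation

set_option linter.unusedSectionVars false

lemma HasBoundedDensity.le_measure_cell {d : ℕ} {PX : Measure (Cov d)} [IsProbabilityMeasure PX]
    {clow cup : ℝ} (hc : 0 ≤ clow) (h : HasBoundedDensity PX clow cup) {k : ℕ} {A : Bin d}
    (hA : A ∈ bins d k) : clow * (1 / 2 : ℝ) ^ (k * d) ≤ PX.real (cell A) := by
  obtain ⟨p, hp, hb, hPX⟩ := h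
  have h1 : ENNReal.ofReal (clow * (1 / 2 : ℝ) ^ (k * d)) ≤ PX (cell A) := by
    rw [hPX, withDensity_apply _ (measurableSet_cell A),
      Measure.restrict_restrict (measurableSet_cell A),
      Set.inter_eq_left.mpr cell_subset]
    calc ENNReal.ofReal (clow * (1 / 2 : ℝ) ^ (k * d))
        ≤ ENNReal.ofReal clow * volume (cell A) := by
          rw [ENNReal.ofReal_mul hc]
          gcongr
          exact volume_cell_ge hA
      _ = ∫⁻ _ in cell A, ENNReal.ofReal clow := (setLIntegral_const _ _).symm
      _ ≤ ∫⁻ x in cell A, ENNReal.ofReal (p x) :=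
          setLIntegral_mono' (measurableSet_cell A) fun x hx =>
            ENNReal.ofReal_le_ofReal (hb x hx.1).1
  exact (ENNReal.ofReal_le_iff_le_toReal (measure_ne_top _ _)).mp h1

lemma measurableSet_mem_live_and_rounds {Ω : Type*} {_ : MeasurableSpace Ω} {d K : ℕ}
    {σ : Ω → ABSEState d K} (hσ : MeasurableState σ) (A : Bin d) (l : ℕ) :
    MeasurableSet {ω | A ∈ (σ ω).live ∧ ((σ ω).se A).rounds < l} :=
  (measurableSet_mem_live hσ measurable_const).inter
    (measurableSet_lt (hσ.se A).rounds measurable_const)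

variable {Ω : Type*} [mΩ : MeasurableSpace Ω] {d K : ℕ} [NeZero K] {n : ℕ} {β L : ℝ}

/-- The bin `A` is live before time `t` and it has not completed its rounds. -/
def exploring (n : ℕ) (β L : ℝ) (X : ℕ → Ω → Cov d) (Y : ℕ → Fin K → Ω → ℝ) (A : Bin d)
    (t : ℕ) : Set Ω :=
  {ω | A ∈ (abseState n β L (fun s => X s ω) (fun s i => Y s i ω) t).live ∧
    ((abseState n β L (fun s => X s ω) (fun s i => Y s i ω) t).se A).rounds < roundLimit n β L A}

/-- The bin `A` has failed by time `t`. -/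
def failing (n : ℕ) (β L : ℝ) (X : ℕ → Ω → Cov d) (Y : ℕ → Fin K → Ω → ℝ)
    (m : Bin d → Fin K → ℝ) (A : Bin d) (t : ℕ) : Set Ω :=
  {ω | Failed n β L (fun s => X s ω) (fun s i => Y s i ω) m A t}

variable {μ : Measure Ω} {PX : Measure (Cov d)} {f : Fin K → Cov d → ℝ} {X : ℕ → Ω → Cov d}
  {Y : ℕ → Fin K → Ω → ℝ}

lemma measurableSet_exploring (A : Bin d) (t : ℕ) :
    MeasurableSet[hist X Y t] (exploring n β L X Y A t) :=
  measurableSet_mem_live_and_rounds (measurableState_hist t) A _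

lemma measurableSet_failing (m : Bin d → Fin K → ℝ) (A : Bin d) (t : ℕ) :
    MeasurableSet[hist X Y t] (failing n β L X Y m A t) :=
  @measurableSet_failed Ω (hist X Y t) d K _ n β L X Y t (fun _ hs => measurable_hist_X hs)
    (fun _ hs i => measurable_hist_Y hs i) m A

lemma explores_iff (hℓ : ∀ A : Bin d, 1 ≤ roundLimit n β L A) (A : Bin d) (t : ℕ) (ω : Ω) :
    Explores n β L (fun s => X s ω) (fun s i => Y s i ω) A t ↔
      ω ∈ exploring n β L X Y A t ∩ inBin X A t := by
  have h := invariant (x := fun s => X s ω) (y := fun s i => Y s i ω) hℓ t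
  have h1 := h.liveBin_eq_iff (X t ω) A
  constructor
  · rintro ⟨h2, h3⟩
    have h4 := h1.mp h2
    exact ⟨⟨h4.1, h3⟩, h4.2⟩
  · rintro ⟨⟨h2, h3⟩, h4⟩
    exact ⟨h1.mpr ⟨h2, h4⟩, h3⟩

variable [IsProbabilityMeasure μ]

lemma IsMachine.measureReal_preimage_inter (hM : IsMachine μ PX f X Y) (t : ℕ) {S : Set (Cov d)}
    (hS : MeasurableSet S) {Q : Set Ω} (hQ : MeasurableSet[hist X Y t] Q) :
    μ.real (X t ⁻¹' S ∩ Q) = PX.real S * μ.real Q := by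
  have h := (Indep_iff _ _ _).mp (hM.indep_hist_obs t) Q (X t ⁻¹' S) hQ
    (measurable_obs_X (Y := Y) t hS)
  rw [Set.inter_comm, measureReal_def, h, hM.measure_preimage t hS, mul_comm, ENNReal.toReal_mul]
  rfl

lemma sum_measureReal_le {S : ℕ → Set Ω} (hS : ∀ t, MeasurableSet (S t)) {c : ℝ} {t : ℕ}
    (h : ∀ ω, ∑ s ∈ Finset.range t, (S s).indicator (fun _ => (1 : ℝ)) ω ≤ c) :
    ∑ s ∈ Finset.range t, μ.real (S s) ≤ c := by
  have h1 : ∀ s, μ.real (S s) = ∫ ω, (S s).indicator (fun _ => (1 : ℝ)) ω ∂μ := fun s => by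
    rw [integral_indicator_const _ (hS s)]; simp
  have hi : ∀ s, Integrable ((S s).indicator (fun _ => (1 : ℝ))) μ := fun s =>
    (integrable_const 1).indicator (hS s)
  simp only [h1]
  rw [← integral_finsetSum _ fun s _ => hi s]
  calc _ ≤ ∫ _ω, c ∂μ := integral_mono (integrable_finsetSum _ fun s _ => hi s)
        (integrable_const c) h
    _ = c := by simp

/-- Being live and unfinished is decided by the past, hence independent of `X t` falling in `A`. The
products are probabilities of exploration, and explorations are counted along each path by
`card_explores_le`. -/
lemma IsMachine.sum_exploring_le (hM : IsMachine μ PX f X Y) {m : Bin d → Fin K → ℝ}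
    (hR : Regular n β L f m) (A : Bin d) (t : ℕ) :
    (∑ s ∈ Finset.range t, μ.real (exploring n β L X Y A s)) * PX.real (cell A) ≤
      K * roundLimit n β L A := by
  classical
  have h1 : ∀ s, μ.real (exploring n β L X Y A s) * PX.real (cell A) =
      μ.real (exploring n β L X Y A s ∩ inBin X A s) := by
    intro s
    rw [mul_comm, ← hM.measureReal_preimage_inter s (measurableSet_cell A)
      (measurableSet_exploring A s), Set.inter_comm]
    exact measureReal_congr ((Filter.EventuallyEq.refl _ _).inter (hM.inBin_ae_eq A s).symm)
  rw [Finset.sum_mul, Finset.sum_congr rfl fun s _ => h1 s]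
  refine sum_measureReal_le (fun s => (hM.hist_le s _ (measurableSet_exploring A s)).inter
    (hM.measurableSet_inBin A s)) fun ω => ?_
  have h2 := card_explores_le (x := fun s => X s ω) (y := fun s i => Y s i ω) hR A t
  have h3 : ((∑ s ∈ Finset.range t, (if Explores n β L (fun s => X s ω) (fun s i => Y s i ω) A s
      then (1 : ℕ) else 0) : ℕ) : ℝ) ≤ ((K * roundLimit n β L A : ℕ) : ℝ) := by
    exact_mod_cast h2
  push_cast at h3
  refine le_trans (le_of_eq (Finset.sum_congr rfl fun s _ => ?_)) h3
  simp only [Set.indicator, explores_iff (X := X) (Y := Y) hR.limit_pos]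

lemma IsMachine.aemeasurable_comp (hM : IsMachine μ PX f X Y) (hβ : 0 < β)
    (hf : Smoothness f β L) (t : ℕ) (i : Fin K) : AEMeasurable (fun ω => f i (X t ω)) μ := by
  have h := (hM.aestronglyMeasurable hβ hf i).aemeasurable
  rw [← hM.law_X t] at h
  exact h.comp_measurable (hM.measurable_X t)

lemma IsMachine.integrable_regret (hM : IsMachine μ PX f X Y) (hβ : 0 < β)
    (hf : Smoothness f β L) (t : ℕ) :
    Integrable (fun ω => fStar f (X t ω) -
      f (abseArm n β L (fun s => X s ω) (fun s i => Y s i ω) t) (X t ω)) μ := by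
  classical
  have hσ := measurableState (n := n) (β := β) (L := L) (X := X) (Y := Y) t
    (fun s _ => hM.measurable_X s) (fun s _ i => hM.measurable_Y s i)
  have harm := measurable_abseArm_of hσ (hM.measurable_X t)
  have hstar : AEMeasurable (fun ω => fStar f (X t ω)) μ :=
    AEMeasurable.iSup fun i => hM.aemeasurable_comp hβ hf t i
  have hpull : AEMeasurable (fun ω =>
      f (abseArm n β L (fun s => X s ω) (fun s i => Y s i ω) t) (X t ω)) μ := by
    have : (fun ω => f (abseArm n β L (fun s => X s ω) (fun s i => Y s i ω) t) (X t ω)) =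
        fun ω => ∑ i, {ω | abseArm n β L (fun s => X s ω) (fun s i => Y s i ω) t = i}.indicator
          (fun ω => f i (X t ω)) ω := by
      funext ω
      simp [Set.indicator]
    rw [this]
    exact Finset.aemeasurable_fun_sum _ fun i _ =>
      (hM.aemeasurable_comp hβ hf t i).indicator (harm (measurableSet_singleton i))
  refine Integrable.of_bound (hstar.sub hpull).aestronglyMeasurable 1 ?_
  filter_upwards [hM.X_mem t] with ω hω
  obtain ⟨j, hj⟩ := exists_eq_fStar f (X t ω)
  have h1 := hM.f_mem j _ hω
  have h2 := hM.f_mem (abseArm n β L (fun s => X s ω) (fun s i => Y s i ω) t) _ hω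
  rw [← hj, Real.norm_eq_abs, abs_le]
  constructor <;> linarith

lemma IsMachine.integrable_abseRegret (hM : IsMachine μ PX f X Y) (hβ : 0 < β)
    (hf : Smoothness f β L) : Integrable (abseRegret n β L f X Y) μ :=
  integrable_finsetSum _ fun t _ => hM.integrable_regret hβ hf t

/-- The expected regret at time `t`, split according to the bin responsible for it. -/
lemma IsMachine.integral_regret_le (hM : IsMachine μ PX f X Y) (hβ : 0 < β)
    (hf : Smoothness f β L) {m : Bin d → Fin K → ℝ} (hR : Regular n β L f m) (t : ℕ) :
    ∫ ω, (fStar f (X t ω) -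
      f (abseArm n β L (fun s => X s ω) (fun s i => Y s i ω) t) (X t ω)) ∂μ ≤
    ∑ k ∈ Finset.range (maxDepth d K n β), ∑ A ∈ bins d k,
      (PX.real (toMeasurable PX (marginSet f (gapBound d β L k)) ∩ cell A) *
        (μ.real (exploring n β L X Y A t) + μ.real (failing n β L X Y m A t))) *
        gapBound d β L k +
      PX.real (marginSet f (gapBound d β L (maxDepth d K n β))) *
        gapBound d β L (maxDepth d K n β) := by
  classical
  set D := maxDepth d K n β
  -- Measurable hulls have the same measure as the margin sets and make it unnecessary to discuss
  -- the measurability of `f♯`.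
  set M : ℕ → Set (Cov d) := fun k => toMeasurable PX (marginSet f (gapBound d β L k)) with hMdef
  have hMm : ∀ k, MeasurableSet (M k) := fun k => measurableSet_toMeasurable _ _
  have hMA : ∀ k A, MeasurableSet (M k ∩ cell A) := fun k A =>
    (hMm k).inter (measurableSet_cell A)
  set S1 : ℕ → Bin d → Set Ω := fun k A => X t ⁻¹' (M k ∩ cell A) ∩ exploring n β L X Y A t
    with hS1
  set S2 : ℕ → Bin d → Set Ω := fun k A => X t ⁻¹' (M k ∩ cell A) ∩ failing n β L X Y m A t
    with hS2
  have hX := hM.measurable_X t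
  have hS1m : ∀ k A, MeasurableSet (S1 k A) := fun k A =>
    (hX (hMA k A)).inter (hM.hist_le t _ (measurableSet_exploring A t))
  have hS2m : ∀ k A, MeasurableSet (S2 k A) := fun k A =>
    (hX (hMA k A)).inter (hM.hist_le t _ (measurableSet_failing m A t))
  have hS3m : MeasurableSet (X t ⁻¹' M D) := hX (hMm D)
  have hpos := hR.gapBound_nonneg
  have hI1 : ∀ k A, Integrable (fun ω => (S1 k A).indicator (fun _ => gapBound d β L k) ω +
      (S2 k A).indicator (fun _ => gapBound d β L k) ω) μ := fun k A =>
    ((integrable_const _).indicator (hS1m k A)).add ((integrable_const _).indicator (hS2m k A))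
  have hI2 : ∀ k, Integrable (fun ω => ∑ A ∈ bins d k,
      ((S1 k A).indicator (fun _ => gapBound d β L k) ω +
      (S2 k A).indicator (fun _ => gapBound d β L k) ω)) μ := fun k =>
    integrable_finsetSum _ fun A _ => hI1 k A
  have hI3 : Integrable (fun ω => (X t ⁻¹' M D).indicator (fun _ => gapBound d β L D) ω) μ :=
    (integrable_const _).indicator hS3m
  have hbound : ∀ᵐ ω ∂μ, fStar f (X t ω) -
      f (abseArm n β L (fun s => X s ω) (fun s i => Y s i ω) t) (X t ω) ≤
      ∑ k ∈ Finset.range D, ∑ A ∈ bins d k,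
        ((S1 k A).indicator (fun _ => gapBound d β L k) ω +
          (S2 k A).indicator (fun _ => gapBound d β L k) ω) +
        (X t ⁻¹' M D).indicator (fun _ => gapBound d β L D) ω := by
    filter_upwards [hM.X_mem t] with ω hω
    refine (regret_le (x := fun s => X s ω) (y := fun s i => Y s i ω) hR hω).trans ?_
    have hsub : ∀ k, X t ω ∈ marginSet f (gapBound d β L k) → X t ω ∈ M k := fun k h =>
      subset_toMeasurable _ _ h
    refine add_le_add (Finset.sum_le_sum fun k _ => ?_) ?_
    · have hnn : ∀ A ∈ bins d k, 0 ≤ (S1 k A).indicator (fun _ => gapBound d β L k) ω +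
          (S2 k A).indicator (fun _ => gapBound d β L k) ω := fun A _ =>
        add_nonneg (Set.indicator_nonneg (fun _ _ => hpos k) _)
          (Set.indicator_nonneg (fun _ _ => hpos k) _)
      refine le_trans (add_le_add ?_ ?_) (Finset.single_le_sum hnn (binAt_mem_bins k (X t ω)))
      · split_ifs with h
        · have h2 := (explores_iff (X := X) (Y := Y) hR.limit_pos _ t ω).mp h.2
          rw [Set.indicator_of_mem]
          exact ⟨⟨hsub k h.1, mem_cell_binAt hω k⟩, h2.1⟩
        · exact Set.indicator_nonneg (fun _ _ => hpos k) _
      · split_ifs with h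
        · rw [Set.indicator_of_mem]
          exact ⟨⟨hsub k h.1, mem_cell_binAt hω k⟩, h.2⟩
        · exact Set.indicator_nonneg (fun _ _ => hpos k) _
    · split_ifs with h
      · rw [Set.indicator_of_mem]
        exact hsub D h
      · exact Set.indicator_nonneg (fun _ _ => hpos D) _
  refine (integral_mono_ae (hM.integrable_regret hβ hf t)
    ((integrable_finsetSum _ fun k _ => hI2 k).add hI3) hbound).trans (le_of_eq ?_)
  simp only [Pi.add_apply]
  rw [integral_add (integrable_finsetSum _ fun k _ => hI2 k) hI3,
    integral_finsetSum _ fun k _ => hI2 k]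
  congr 1
  · refine Finset.sum_congr rfl fun k _ => ?_
    rw [integral_finsetSum _ fun A _ => hI1 k A]
    refine Finset.sum_congr rfl fun A _ => ?_
    rw [integral_add ((integrable_const _).indicator (hS1m k A))
      ((integrable_const _).indicator (hS2m k A)), integral_indicator_const _ (hS1m k A),
      integral_indicator_const _ (hS2m k A), hS1, hS2]
    simp only
    rw [hM.measureReal_preimage_inter t (hMA k A) (measurableSet_exploring A t),
      hM.measureReal_preimage_inter t (hMA k A) (measurableSet_failing m A t)]
    simp only [smul_eq_mul]
    ring
  · rw [integral_indicator_const _ hS3m, smul_eq_mul, measureReal_def,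
      hM.measure_preimage t (hMm D), hMdef]
    simp only [measure_toMeasurable]
    rfl

/-- The expected regret is bounded by a sum over the depths of the bins. -/
lemma IsMachine.integral_abseRegret_le (hM : IsMachine μ PX f X Y) (hβ : 0 < β)
    (hf : Smoothness f β L) (hR : Regular n β L f (binMean PX f)) {clow cup : ℝ} (hc : 0 < clow)
    (hD : HasBoundedDensity PX clow cup) (hn : 0 < n) {ℓ : ℕ → ℝ}
    (hℓ : ∀ A : Bin d, (roundLimit n β L A : ℝ) ≤ ℓ A.1) :
    ∫ ω, abseRegret n β L f X Y ω ∂μ ≤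
    ∑ k ∈ Finset.range (maxDepth d K n β),
      PX.real (marginSet f (gapBound d β L k)) * gapBound d β L k *
        ((1 / clow + 4) * (K * ℓ k * 2 ^ (k * d))) +
      n * (PX.real (marginSet f (gapBound d β L (maxDepth d K n β))) *
        gapBound d β L (maxDepth d K n β)) := by
  have hPX := hM.isProbabilityMeasure
  unfold abseRegret
  rw [integral_finsetSum _ fun t _ => hM.integrable_regret hβ hf t]
  refine (Finset.sum_le_sum fun t _ => hM.integral_regret_le hβ hf hR t).trans ?_
  rw [Finset.sum_add_distrib, Finset.sum_const, Finset.card_range, nsmul_eq_mul]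
  refine add_le_add ?_ le_rfl
  rw [Finset.sum_comm]
  refine Finset.sum_le_sum fun k _ => ?_
  rw [Finset.sum_comm]
  set M := toMeasurable PX (marginSet f (gapBound d β L k)) with hMdef
  have hpos := hR.gapBound_nonneg k
  -- Exploration yields `K ℓ / P(A)`, with `P(A)` at least `clow 2^{-kd}`; failure yields `n` times
  -- `4 K ℓ / (n 2^{-kd})`. Both are of order `K ℓ 2^{kd}`.
  have hkey : ∀ A ∈ bins d k, ∑ t ∈ Finset.range n, (PX.real (M ∩ cell A) *
      (μ.real (exploring n β L X Y A t) + μ.real (failing n β L X Y (binMean PX f) A t))) *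
        gapBound d β L k ≤ PX.real (M ∩ cell A) *
      (gapBound d β L k * ((1 / clow + 4) * (K * ℓ k * 2 ^ (k * d)))) := by
    intro A hA
    have hAk := (mem_bins.mp hA).1
    rw [← Finset.sum_mul, ← Finset.mul_sum, mul_assoc]
    refine mul_le_mul_of_nonneg_left ?_ measureReal_nonneg
    rw [mul_comm]
    refine mul_le_mul_of_nonneg_left ?_ hpos
    rw [Finset.sum_add_distrib, add_mul]
    have hlA : (K : ℝ) * roundLimit n β L A ≤ K * ℓ k := by
      have := hℓ A; rw [hAk] at this; gcongr
    have h2 : (0 : ℝ) < 2 ^ (k * d) := by positivity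
    have hcell := hD.le_measure_cell hc.le hA
    rw [one_div, inv_pow] at hcell
    refine add_le_add ?_ ?_
    · have h1 := hM.sum_exploring_le hR A n
      have h3 : 0 ≤ ∑ s ∈ Finset.range n, μ.real (exploring n β L X Y A s) :=
        Finset.sum_nonneg fun _ _ => measureReal_nonneg
      have h4 := mul_le_mul_of_nonneg_left hcell h3
      have h5 := (h4.trans h1).trans hlA
      have h6 : (∑ s ∈ Finset.range n, μ.real (exploring n β L X Y A s)) =
        ((∑ s ∈ Finset.range n, μ.real (exploring n β L X Y A s)) *
          (clow * (2 ^ (k * d))⁻¹)) * (1 / clow * 2 ^ (k * d)) := by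
        field_simp
      rw [h6]
      refine (mul_le_mul_of_nonneg_right h5 (by positivity)).trans (le_of_eq ?_)
      ring
    · have hnpos : (0 : ℝ) < n := by exact_mod_cast hn
      have hT : binHorizon n A = n * (2 ^ (k * d))⁻¹ := by
        rw [binHorizon, Bin.side, hAk, ← pow_mul, one_div, inv_pow]
      have hTpos : 0 < binHorizon n A := by rw [hT]; positivity
      have h1 : ∀ t ∈ Finset.range n, μ.real (failing n β L X Y (binMean PX f) A t) ≤
          4 * K * roundLimit n β L A / binHorizon n A := fun t _ =>
        ENNReal.toReal_le_of_le_ofReal (by positivity)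
          (hM.measure_failed_le hβ hf hR.limit_pos A hTpos t)
      refine (Finset.sum_le_sum h1).trans ?_
      rw [Finset.sum_const, Finset.card_range, nsmul_eq_mul, hT]
      have e : (n : ℝ) * (4 * K * roundLimit n β L A / (n * (2 ^ (k * d))⁻¹)) =
          4 * (K * roundLimit n β L A * 2 ^ (k * d)) := by
        field_simp
      rw [e]
      gcongr
  refine (Finset.sum_le_sum hkey).trans ?_
  have hℓ0 : 0 ≤ ℓ k := (Nat.cast_nonneg _).trans (hℓ ((k, 0) : Bin d))
  -- Keeping `M ∩ A` in each term pays off here: the cells of one depth are disjoint, so only the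
  -- mass of the margin set remains.
  have hdisj : ∑ A ∈ bins d k, PX.real (M ∩ cell A) ≤
      PX.real (marginSet f (gapBound d β L k)) := by
    rw [← measureReal_biUnion_finset]
    · calc PX.real (⋃ A ∈ bins d k, M ∩ cell A) ≤ PX.real M :=
          measureReal_mono (Set.iUnion₂_subset fun A _ => Set.inter_subset_left)
            (measure_ne_top _ _)
        _ = _ := by rw [hMdef, measureReal_def, measure_toMeasurable]; rfl
    · intro A hA B hB hAB
      have := pairwise_disjoint_cell (((mem_bins.mp hA).1).trans ((mem_bins.mp hB).1).symm) hAB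
      exact this.mono Set.inter_subset_right Set.inter_subset_right
    · exact fun A _ => (measurableSet_toMeasurable _ _).inter (measurableSet_cell A)
  rw [← Finset.sum_mul]
  exact (mul_le_mul_of_nonneg_right hdisj (by positivity)).trans (le_of_eq (mul_assoc _ _ _).symm)

end Expectation

/-! ### The number of rounds -/

section Rounds

/-- The assumed lower bound on `l` implies `l a ^ 2 ≥ 8`, hence `T/l ≤ T a ^ 2`. The logarithm in
`U` is thus bounded by the one in the hypothesis, and `U ^ 2 = 8 logBar (T/l) / l` is at most `a ^
2`. -/
lemma confU_le_of_le {T a : ℝ} (hT : 0 < T) (ha : 0 < a) {l : ℕ} (hl : 1 ≤ l)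
    (h : 8 / a ^ 2 * logBar (T * a ^ 2) ≤ l) : confU l T ≤ a := by
  have hlpos : (0 : ℝ) < l := by exact_mod_cast hl
  have hb : 0 < a ^ 2 := by positivity
  have h1 := logBar_ge_one (T * a ^ 2)
  have h2 : 8 * logBar (T * a ^ 2) ≤ l * a ^ 2 := by
    rw [div_mul_eq_mul_div, div_le_iff₀ hb] at h; exact h
  have h3 : T / l ≤ T * a ^ 2 := by
    rw [div_le_iff₀ hlpos]
    nlinarith
  have h4 : logBar (T / l) ≤ logBar (T * a ^ 2) :=
    max_le_max_right _ (Real.log_le_log (by positivity) h3)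
  have h5 : 2 * logBar (T / l) / l ≤ (a / 2) ^ 2 := by
    rw [div_le_iff₀ hlpos]
    nlinarith
  have h6 := Real.sqrt_le_sqrt h5
  rw [Real.sqrt_sq (by positivity)] at h6
  unfold confU
  linarith

lemma one_le_confU_one (T : ℝ) : 1 ≤ confU 1 T := by
  have h1 := logBar_ge_one (T / (1 : ℕ))
  have h2 : 1 ≤ √(2 * logBar (T / (1 : ℕ)) / (1 : ℕ)) := by
    rw [Real.one_le_sqrt, Nat.cast_one, div_one]
    rw [Nat.cast_one] at h1
    linarith
  unfold confU
  linarith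

/-- Going from `l + 1` back to `l` at most doubles both `1/l` and the truncated logarithm, so `U ^
2` grows by a factor of at most 4. -/
lemma confU_le_two_mul_succ {T : ℝ} (hT : 0 < T) {l : ℕ} (hl : 1 ≤ l) :
    confU l T ≤ 2 * confU (l + 1) T := by
  have hlpos : (1 : ℝ) ≤ l := by exact_mod_cast hl
  have hl1 : ((l + 1 : ℕ) : ℝ) = l + 1 := by push_cast; ring
  have h1 : logBar (T / l) ≤ 2 * logBar (T / (l + 1)) := by
    have h2 := logBar_ge_one (T / (l + 1))
    have h3 : Real.log (T / l) = Real.log (T / (l + 1)) + Real.log ((l + 1) / l) := by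
      rw [← Real.log_mul (by positivity) (by positivity)]
      congr 1
      field_simp
    have h4 : Real.log (((l : ℝ) + 1) / l) ≤ (l + 1) / l - 1 :=
      Real.log_le_sub_one_of_pos (by positivity)
    have h5 : ((l : ℝ) + 1) / l - 1 ≤ 1 := by
      rw [sub_le_iff_le_add, div_le_iff₀ (by positivity)]; linarith
    have h6 : Real.log (T / (l + 1)) ≤ logBar (T / (l + 1)) := le_max_left _ _
    exact max_le (by linarith) (by linarith)
  have h7 : 2 * logBar (T / l) / l ≤ 2 ^ 2 * (2 * logBar (T / (l + 1)) / (l + 1)) := by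
    have h2 := logBar_ge_one (T / (l + 1))
    rw [mul_div_assoc', div_le_div_iff₀ (by positivity) (by positivity)]
    nlinarith [mul_le_mul h1 (show (l : ℝ) + 1 ≤ 2 * l by linarith) (by positivity)
      (by positivity)]
  have h8 := Real.sqrt_le_sqrt h7
  rw [Real.sqrt_mul (by positivity), Real.sqrt_sq (by norm_num)] at h8
  unfold confU
  rw [hl1]
  linarith

variable {d : ℕ} {n : ℕ} {β L : ℝ}

lemma c0_pos (hd : 1 ≤ d) (hL : 0 < L) : 0 < c0 d β L := by
  have : (0 : ℝ) < d := by exact_mod_cast hd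
  unfold c0
  positivity

lemma binHorizon_pos (hn : 0 < n) (A : Bin d) : 0 < binHorizon n A := by
  have := side_pos A
  have : (0 : ℝ) < n := by exact_mod_cast hn
  unfold binHorizon
  positivity

lemma ceil_mem_roundLimit (hd : 1 ≤ d) (hL : 0 < L) (hn : 0 < n) (A : Bin d) :
    ⌈8 / (2 * c0 d β L * A.side ^ β) ^ 2 *
        logBar (binHorizon n A * (2 * c0 d β L * A.side ^ β) ^ 2)⌉₊ ∈
      {l : ℕ | 1 ≤ l ∧ confU l (binHorizon n A) ≤ 2 * c0 d β L * A.side ^ β} := by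
  have hc := c0_pos (β := β) hd hL
  have hs := side_pos A
  have ha : 0 < 2 * c0 d β L * A.side ^ β := by positivity
  have h1 := logBar_ge_one (binHorizon n A * (2 * c0 d β L * A.side ^ β) ^ 2)
  have hl : 1 ≤ ⌈8 / (2 * c0 d β L * A.side ^ β) ^ 2 *
        logBar (binHorizon n A * (2 * c0 d β L * A.side ^ β) ^ 2)⌉₊ :=
    Nat.one_le_ceil_iff.mpr (by positivity)
  exact ⟨hl, confU_le_of_le (binHorizon_pos hn A) ha hl (Nat.le_ceil _)⟩

lemma roundLimit_mem (hd : 1 ≤ d) (hL : 0 < L) (hn : 0 < n) (A : Bin d) :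
    1 ≤ roundLimit n β L A ∧
      confU (roundLimit n β L A) (binHorizon n A) ≤ 2 * c0 d β L * A.side ^ β :=
  Nat.sInf_mem ⟨_, ceil_mem_roundLimit hd hL hn A⟩

lemma roundLimit_le (hd : 1 ≤ d) (hL : 0 < L) (hn : 0 < n) (A : Bin d) :
    (roundLimit n β L A : ℝ) ≤ 8 / (2 * c0 d β L * A.side ^ β) ^ 2 *
        logBar (binHorizon n A * (2 * c0 d β L * A.side ^ β) ^ 2) + 1 := by
  have h := Nat.sInf_le (ceil_mem_roundLimit (β := β) hd hL hn A)
  have h1 := logBar_ge_one (binHorizon n A * (2 * c0 d β L * A.side ^ β) ^ 2)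
  have h2 := Nat.ceil_lt_add_one (a := 8 / (2 * c0 d β L * A.side ^ β) ^ 2 *
        logBar (binHorizon n A * (2 * c0 d β L * A.side ^ β) ^ 2)) (by positivity)
  have h3 : (roundLimit n β L A : ℝ) ≤ (⌈8 / (2 * c0 d β L * A.side ^ β) ^ 2 *
        logBar (binHorizon n A * (2 * c0 d β L * A.side ^ β) ^ 2)⌉₊ : ℝ) := by exact_mod_cast h
  linarith

/-- By minimality `U` exceeds `2 c₀ |A|^β` at every earlier round, and the last step at most halves
it. When `τ` is both the first and the last round there is no predecessor, and `U(1) ≥ 1` is used;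
hence the minimum with 1. -/
lemma min_le_confU (hn : 0 < n) (hL : 0 < L) (hd : 1 ≤ d)
    (A : Bin d) {τ : ℕ} (h1 : 1 ≤ τ) (h2 : τ ≤ roundLimit n β L A) :
    min 1 (c0 d β L * A.side ^ β) ≤ confU τ (binHorizon n A) := by
  have hc := c0_pos (β := β) hd hL
  have hs := side_pos A
  have ha : 0 < c0 d β L * A.side ^ β := by positivity
  have hlt : ∀ l, 1 ≤ l → l < roundLimit n β L A →
      2 * c0 d β L * A.side ^ β < confU l (binHorizon n A) := by
    intro l hl hlt
    by_contra hc
    exact Nat.notMem_of_lt_sInf hlt ⟨hl, not_lt.mp hc⟩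
  rcases h2.lt_or_eq with h | h
  · refine (min_le_right _ _).trans ?_
    have := hlt τ h1 h
    linarith
  · rcases h1.lt_or_eq with h3 | h3
    · refine (min_le_right _ _).trans ?_
      obtain ⟨l, rfl⟩ : ∃ l, τ = l + 1 := ⟨τ - 1, by omega⟩
      have e1 := hlt l (by omega) (by omega)
      have e2 := confU_le_two_mul_succ (binHorizon_pos hn A) (l := l) (by omega)
      linarith
    · rw [← h3]
      exact (min_le_left _ _).trans (one_le_confU_one _)

/-- The rounds on a bin of depth `k` are at most of order `2^{2kβ} log (n 2^{-k(d+2β)})`. -/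
lemma exists_roundLimit_le (d : ℕ) (hd : 1 ≤ d) (β L : ℝ) (hβ : 0 < β) (hL : 0 < L) :
    ∃ C : ℝ, 0 < C ∧ ∀ n : ℕ, 0 < n → ∀ A : Bin d, (roundLimit n β L A : ℝ) ≤
      C * ((1 / 2 : ℝ) ^ A.1) ^ (-(2 * β)) *
        logBar (n * ((1 / 2 : ℝ) ^ A.1) ^ ((d : ℝ) + 2 * β)) := by
  have hc := c0_pos (β := β) hd hL
  set κ : ℝ := (2 * c0 d β L) ^ 2 with hκ
  have hκ0 : 0 < κ := by positivity
  -- The term `|log κ|` pays for removing `κ` from the logarithm, and the final 1 for rounding up to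
  -- an integer.
  refine ⟨8 / κ * (1 + |Real.log κ|) + 1, by positivity, fun n hn A => ?_⟩
  refine (roundLimit_le hd hL hn A).trans ?_
  have hs : 0 < A.side := side_pos A
  have hside : ((1 / 2 : ℝ) ^ A.1) = A.side := rfl
  have hnpos : (0 : ℝ) < n := by exact_mod_cast hn
  rw [hside]
  set r := A.side ^ (-(2 * β)) with hr
  have hr1 : 1 ≤ r := Real.one_le_rpow_of_pos_of_le_one_of_nonpos hs (side_le_one A) (by linarith)
  have e1 : (2 * c0 d β L * A.side ^ β) ^ 2 = κ / r := by
    rw [hr, Real.rpow_neg hs.le, div_inv_eq_mul, mul_pow, ← hκ, ← Real.rpow_natCast,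
      ← Real.rpow_mul hs.le]
    congr 2
    push_cast; ring
  have e2 : binHorizon n A * (2 * c0 d β L * A.side ^ β) ^ 2 =
      κ * (n * A.side ^ ((d : ℝ) + 2 * β)) := by
    rw [e1, hr, Real.rpow_neg hs.le, div_inv_eq_mul, binHorizon, Real.rpow_add hs,
      Real.rpow_natCast]
    ring
  rw [e2, e1]
  set y := (n : ℝ) * A.side ^ ((d : ℝ) + 2 * β) with hy
  have hy0 : 0 < y := by positivity
  have h1 := logBar_ge_one y
  have e3 : logBar (κ * y) ≤ (1 + |Real.log κ|) * logBar y := by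
    have h2 : Real.log y ≤ logBar y := le_max_left _ _
    have h3 := le_abs_self (Real.log κ)
    have h4 := abs_nonneg (Real.log κ)
    refine max_le ?_ ?_
    · rw [Real.log_mul hκ0.ne' hy0.ne']
      nlinarith
    · nlinarith
  calc 8 / (κ / r) * logBar (κ * y) + 1 ≤ 8 / (κ / r) * ((1 + |Real.log κ|) * logBar y) + 1 := by
        gcongr
    _ = 8 / κ * (1 + |Real.log κ|) * r * logBar y + 1 := by
        rw [div_div_eq_mul_div]; ring
    _ ≤ (8 / κ * (1 + |Real.log κ|) + 1) * r * logBar y := by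
        have : 1 ≤ r * logBar y := one_le_mul_of_one_le_of_one_le hr1 h1
        linarith

end Rounds

/-! ### Averages of the mean rewards over the bins -/

section RegularMachine

variable {Ω : Type*} [mΩ : MeasurableSpace Ω] {d K : ℕ} {n : ℕ} {β L : ℝ}
  {μ : Measure Ω} {PX : Measure (Cov d)} {f : Fin K → Cov d → ℝ} {X : ℕ → Ω → Cov d}
  {Y : ℕ → Fin K → Ω → ℝ} [IsProbabilityMeasure μ]

lemma setIntegral_div_mem {E : Type*} [MeasurableSpace E] {P : Measure E} [IsFiniteMeasure P]
    {S : Set E} (hS : MeasurableSet S) (h0 : 0 < P.real S) {g : E → ℝ} (hg : IntegrableOn g S P)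
    {a b : ℝ} (h : ∀ z ∈ S, a ≤ g z ∧ g z ≤ b) :
    a ≤ (∫ z in S, g z ∂P) / P.real S ∧ (∫ z in S, g z ∂P) / P.real S ≤ b := by
  have hc : ∀ c : ℝ, ∫ _ in S, c ∂P = c * P.real S := fun c => by
    rw [setIntegral_const, smul_eq_mul, mul_comm]
  have hi : ∀ c : ℝ, IntegrableOn (fun _ => c) S P := fun c => integrableOn_const
  constructor
  · rw [le_div_iff₀ h0, ← hc]
    exact setIntegral_mono_on (hi a) hg hS fun z hz => (h z hz).1
  · rw [div_le_iff₀ h0, ← hc]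
    exact setIntegral_mono_on hg (hi b) hS fun z hz => (h z hz).2

/-- A nonempty cell is a genuine bin and has positive mass by the lower bound on the density, so
`binMean` is a true average of values that oscillate by at most `c₀/2 |A|^β`. -/
lemma IsMachine.regular (hM : IsMachine μ PX f X Y) (hd : 1 ≤ d) (hβ : 0 < β) (hβ1 : β ≤ 1)
    (hL : 0 < L) (hf : Smoothness f β L) {clow cup : ℝ} (hc : 0 < clow)
    (hD : HasBoundedDensity PX clow cup) (hn : 0 < n) :
    Regular n β L f (binMean PX f) := by
  have hPX := hM.isProbabilityMeasure
  have hpos : ∀ A : Bin d, ∀ z ∈ cell A, 0 < PX.real (cell A) := by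
    intro A z hz
    have hA : A ∈ bins d A.1 := by
      have := binAt_mem_bins A.1 z; rwa [hz.2] at this
    exact lt_of_lt_of_le (by positivity) (hD.le_measure_cell hc.le hA)
  have hint : ∀ (A : Bin d) i, IntegrableOn (f i) (cell A) PX := by
    intro A i
    refine Integrable.integrableOn (Integrable.of_bound (hM.aestronglyMeasurable hβ hf i) 1 ?_)
    filter_upwards [hM.ae_mem_unitCube] with z hz
    have := hM.f_mem i z hz
    rw [Real.norm_eq_abs, abs_le]
    constructor <;> linarith
  refine ⟨(c0_pos hd hL).le, hβ.le, hβ1, hM.f_mem, ?_, ?_, fun A => (roundLimit_mem hd hL hn A).1,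
    fun A => (roundLimit_mem hd hL hn A).2, fun A τ h1 h2 => min_le_confU hn hL hd A h1 h2⟩
  · rintro A ⟨z, hz⟩ i
    exact setIntegral_div_mem (measurableSet_cell A) (hpos A z hz) (hint A i)
      fun w hw => hM.f_mem i w hw.1
  · intro A z hz i
    have h := setIntegral_div_mem (measurableSet_cell A) (hpos A z hz) (hint A i)
      (a := f i z - c0 d β L / 2 * A.side ^ β) (b := f i z + c0 d β L / 2 * A.side ^ β)
      fun w hw => by
        have := abs_le.mp (abs_sub_le_of_mem_cell hβ hL hf hw hz i)
        constructor <;> linarith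
    rw [abs_le]
    unfold binMean
    constructor <;> linarith [h.1, h.2]

end RegularMachine

/-! ### The margin condition -/

section MarginCondition

variable {d K : ℕ} {PX : Measure (Cov d)} {f : Fin K → Cov d → ℝ}

/-- The margin condition holds for all `δ ≥ 0` at the price of a larger constant. -/
lemma Margin.measure_marginSet_le [IsProbabilityMeasure PX] {α : ℝ≥0∞} {δ₀ C₀ a : ℝ}
    (hδ₀ : 0 < δ₀) (hC₀ : 0 < C₀) (ha : 0 < a) (hα : α = ⊤ ∨ α.toReal = a)
    (h : Margin PX f α δ₀ C₀) {δ : ℝ} (hδ : 0 ≤ δ) :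
    PX.real (marginSet f δ) ≤ (C₀ + δ₀ ^ (-a)) * δ ^ a := by
  have hδa : 0 ≤ δ ^ a := Real.rpow_nonneg hδ a
  have hδ₀a : 0 < δ₀ ^ (-a) := Real.rpow_pos_of_pos hδ₀ _
  rcases le_or_gt δ δ₀ with h1 | h1
  · have h2 : marginPow δ α ≤ δ ^ a := by
      unfold marginPow
      split_ifs with h3
      · exact hδa
      · rw [hα.resolve_left h3]
    calc PX.real (marginSet f δ)
        ≤ PX.real {x | 0 < fStar f x - fSharp f x ∧ fStar f x - fSharp f x ≤ δ} :=
          measureReal_mono (fun z hz => hz.2) (measure_ne_top _ _)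
      _ ≤ C₀ * marginPow δ α := h δ hδ h1
      _ ≤ C₀ * δ ^ a := by gcongr
      _ ≤ (C₀ + δ₀ ^ (-a)) * δ ^ a := by
          gcongr
          linarith
  -- Beyond `δ₀` the trivial bound `1 ≤ (δ/δ₀)^a` suffices.
  · calc PX.real (marginSet f δ) ≤ 1 := measureReal_le_one
      _ = δ₀ ^ (-a) * δ₀ ^ a := by rw [← Real.rpow_add hδ₀]; simp
      _ ≤ δ₀ ^ (-a) * δ ^ a := by gcongr
      _ ≤ (C₀ + δ₀ ^ (-a)) * δ ^ a := by
          gcongr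
          linarith

lemma fStar_sub_le [NeZero K] {β L : ℝ} (hf : Smoothness f β L) {z w : Cov d}
    (hz : z ∈ unitCube d) (hw : w ∈ unitCube d) :
    fStar f z - fStar f w ≤ L * ‖z - w‖ ^ β := by
  obtain ⟨j, hj⟩ := exists_eq_fStar f z
  have h1 := le_fStar f j w
  have h2 := (abs_le.mp (hf j z hz w hw)).2
  linarith

lemma gap_sub_le [NeZero K] {β L : ℝ} (hf : Smoothness f β L) {z w : Cov d}
    (hz : z ∈ unitCube d) (hw : w ∈ unitCube d) (i : Fin K) :
    (fStar f z - f i z) - (fStar f w - f i w) ≤ 2 * L * ‖z - w‖ ^ β := by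
  have h1 := fStar_sub_le hf hz hw
  have h2 := (abs_le.mp (hf i z hz w hw)).1
  linarith

/-- Variation of a gap over `c` cell diameters: `c = 1` is used inside a cell and `c = 2` for the
displacement from the set where the arm is optimal. -/
lemma two_mul_rpow_le {β L : ℝ} (hβ : 0 < β) (hβ1 : β ≤ 1) (hL : 0 < L) {c t h : ℝ}
    (hc0 : 0 ≤ c) (hc : c ≤ 2) (hh : 0 ≤ h) (ht0 : 0 ≤ t) (ht : t ≤ c * (√d * h)) :
    2 * L * t ^ β ≤ c ^ β * c0 d β L * h ^ β ∧ c ^ β ≤ 2 := by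
  constructor
  · have h1 := Real.rpow_le_rpow ht0 ht hβ.le
    rw [Real.mul_rpow hc0 (by positivity), Real.mul_rpow (Real.sqrt_nonneg _) hh,
      Real.sqrt_eq_rpow, ← Real.rpow_mul (by positivity)] at h1
    calc 2 * L * t ^ β ≤ 2 * L * (c ^ β * ((d : ℝ) ^ (1 / 2 * β) * h ^ β)) := by gcongr
      _ = c ^ β * c0 d β L * h ^ β := by
        unfold c0; rw [show 1 / 2 * β = β / 2 by ring]; ring
  · calc c ^ β ≤ 2 ^ β := by gcongr
      _ ≤ 2 ^ (1 : ℝ) := Real.rpow_le_rpow_of_exponent_le (by norm_num) hβ1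
      _ = 2 := by norm_num

/-- A cell on which an arm is suboptimal, but not by much, is contained in a set to which the
margin condition applies. -/
lemma cell_subset_marginSet [NeZero K] {β L : ℝ} (hβ : 0 < β) (hβ1 : β ≤ 1) (hL : 0 < L)
    (hf : Smoothness f β L) {w : Cov d} (hw : w ∈ unitCube d) {k : ℕ} {i : Fin K}
    (hpos : ∀ z ∈ cell (binAt k w), f i z < fStar f z) {η : ℝ}
    (hη : fStar f w - f i w + c0 d β L * ((1 / 2 : ℝ) ^ k) ^ β ≤ η) :
    cell (binAt k w) ⊆ marginSet f η := by
  intro z hz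
  have h1 := hpos z hz
  have h2 := le_fSharp h1
  have h3 := fSharp_lt h1
  have h4 := gap_sub_le hf hz.1 hw i
  have h5 : ‖z - w‖ ≤ 1 * (√d * (1 / 2 : ℝ) ^ k) := by
    rw [one_mul]
    exact norm_sub_le_of_mem_cell hz (mem_cell_binAt hw k)
  have h6 := (two_mul_rpow_le hβ hβ1 hL zero_le_one (by norm_num) (by positivity)
    (norm_nonneg _) h5).1
  rw [Real.one_rpow, one_mul] at h6
  exact ⟨hz.1, by linarith, by linarith⟩

/-- When `d < αβ` the gap is bounded from below wherever it is positive. -/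
lemma exists_marginSet_eq_empty (d : ℕ) (hd : 1 ≤ d) {β L a c C : ℝ} (hβ : 0 < β) (hβ1 : β ≤ 1)
    (hL : 0 < L) (hc : 0 < c) (hab : d < a * β) :
    ∃ Δ : ℝ, 0 < Δ ∧ ∀ (K : ℕ) [NeZero K] (PX : Measure (Cov d)) (f : Fin K → Cov d → ℝ),
      IsProbabilityMeasure PX → Smoothness f β L →
      (∀ k, ∀ A ∈ bins d k, c * (1 / 2 : ℝ) ^ (k * d) ≤ PX.real (cell A)) →
      (∀ δ : ℝ, 0 ≤ δ → PX.real (marginSet f δ) ≤ C * δ ^ a) →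
      ∀ δ < Δ, marginSet f δ = ∅ := by
  have hc0 := c0_pos (β := β) hd hL
  -- The gap at the chosen point is at most `(1 + 2 c₀) h^β`, and its variation over the cell adds
  -- `c₀ h^β`.
  set b := 1 + 3 * c0 d β L with hb
  have hb0 : 0 < b := by positivity
  -- The ratio of `h^d` to `h^{aβ}` is `q ^ k`, so from some depth `k₁` on the margin bound is
  -- smaller than the mass of a cell.
  set q : ℝ := 2 ^ (a * β - d) with hq
  have hq1 : 1 < q := Real.one_lt_rpow (by norm_num) (by linarith)
  obtain ⟨k₁, hk₁⟩ := pow_unbounded_of_one_lt (C * b ^ a / c) hq1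
  have hbig : ∀ k ≥ k₁, C * (b * ((1 / 2 : ℝ) ^ k) ^ β) ^ a < c * (1 / 2 : ℝ) ^ (k * d) := by
    intro k hk
    have h1 : C * b ^ a / c < q ^ k := hk₁.trans_le (pow_le_pow_right₀ hq1.le hk)
    rw [div_lt_iff₀ hc] at h1
    have h2 : (0 : ℝ) < (1 / 2 : ℝ) ^ k := by positivity
    have h3 : q ^ k * (((1 / 2 : ℝ) ^ k) ^ β) ^ a = (1 / 2 : ℝ) ^ (k * d) := by
      have e1 : q ^ k = ((1 / 2 : ℝ) ^ k) ^ (d - a * β) := by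
        rw [hq, ← Real.rpow_natCast, ← Real.rpow_mul (by norm_num), ← Real.rpow_natCast,
          ← Real.rpow_mul (by norm_num), one_div, Real.inv_rpow (by norm_num),
          ← Real.rpow_neg (by norm_num)]
        congr 1; ring
      rw [e1, ← Real.rpow_mul h2.le, ← Real.rpow_add h2, pow_mul, ← Real.rpow_natCast _ d]
      congr 1; ring
    rw [Real.mul_rpow hb0.le (by positivity), ← h3]
    have h4 : 0 < (((1 / 2 : ℝ) ^ k) ^ β) ^ a := by positivity
    nlinarith
  refine ⟨((1 / 2 : ℝ) ^ k₁) ^ β, by positivity, fun K _ PX f hP hf hcell hmargin δ hδ => ?_⟩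
  have hcontra : ∀ k ≥ k₁, ∀ w ∈ unitCube d, ∀ i,
      (∀ z ∈ cell (binAt k w), f i z < fStar f z) →
      fStar f w - f i w ≤ (1 + 2 * c0 d β L) * ((1 / 2 : ℝ) ^ k) ^ β → False := by
    intro k hk w hw i hpos hle
    have hsub := cell_subset_marginSet hβ hβ1 hL hf hw hpos
      (η := b * ((1 / 2 : ℝ) ^ k) ^ β) (by rw [hb]; linarith)
    have h1 := hcell k _ (binAt_mem_bins k w)
    have h2 := hmargin (b * ((1 / 2 : ℝ) ^ k) ^ β) (by positivity)
    have h3 := measureReal_mono (μ := PX) hsub (measure_ne_top _ _)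
    have h4 := hbig k hk
    linarith
  refine Set.eq_empty_of_forall_notMem fun z hz => ?_
  obtain ⟨hzc, hz1, hz2⟩ := hz
  obtain ⟨i, hi⟩ := exists_eq_fSharp hz1
  rw [← hi] at hz1 hz2
  -- The set on which arm `i` is optimal. If it is nonempty, a contradiction follows from `z ∉ Z`
  -- alone, at a fine enough depth; the smallness of `δ` matters only when it is empty.
  set Z : Set (Cov d) := {w | w ∈ unitCube d ∧ fStar f w ≤ f i w} with hZ
  by_cases hne : Z.Nonempty
  · have hcont := fun j => continuousOn_of_smoothness hβ hf j
    have hZeq : Z = ⋂ j, {w ∈ unitCube d | f j w ≤ f i w} := by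
      ext w
      simp only [hZ, Set.mem_iInter]
      constructor
      · rintro ⟨h1, h2⟩ j
        exact ⟨h1, (le_fStar f j w).trans h2⟩
      · intro h
        exact ⟨(h i).1, ciSup_le fun j => (h j).2⟩
    have hZc : IsClosed Z := by
      rw [hZeq]
      exact isClosed_iInter fun j => isClosed_unitCube.isClosed_le (hcont j) (hcont i)
    have hZk : IsCompact Z := isCompact_unitCube.of_isClosed_subset hZc fun w hw => hw.1
    obtain ⟨x₀, hx₀, hmin⟩ := hZk.exists_infDist_eq_dist hne z
    set D := dist z x₀ with hDdef
    have hfar : ∀ w ∈ Z, D ≤ dist z w := fun w hw => by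
      rw [← hmin]; exact Metric.infDist_le_dist_of_mem hw
    have hD : 0 < D := by
      refine dist_pos.mpr fun h => ?_
      rw [← h] at hx₀
      linarith [hx₀.2]
    have hd0 : 0 < √(d : ℝ) := Real.sqrt_pos.mpr (by exact_mod_cast hd)
    obtain ⟨k₂, hk₂⟩ := exists_pow_lt_of_lt_one (show 0 < D / (2 * √d) by positivity)
      (show (1 / 2 : ℝ) < 1 by norm_num)
    set k := max k₁ k₂ with hk
    have hkD : 2 * (√d * (1 / 2 : ℝ) ^ k) ≤ D := by
      have h1 : (1 / 2 : ℝ) ^ k ≤ (1 / 2 : ℝ) ^ k₂ :=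
        pow_le_pow_of_le_one (by norm_num) (by norm_num) (le_max_right _ _)
      have h2 := h1.trans hk₂.le
      rw [le_div_iff₀ (by positivity)] at h2
      linarith
    set h := √d * (1 / 2 : ℝ) ^ k with hh
    have hh0 : 0 < h := by positivity
    set s := 2 * h / D with hs
    have hs0 : 0 ≤ s := by positivity
    have hs1 : s ≤ 1 := (div_le_one hD).mpr hkD
    -- This point lies on the segment from the nearest point `x₀` of `Z` to `z`, at distance `2h`
    -- from `x₀`, where `h` bounds the diameter of a cell. It is close enough to `Z` for a small
    -- gap, yet its cell misses `Z`: a point of `Z` there would be within `D - h` of `z`.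
    set w := x₀ + s • (z - x₀) with hw
    have hwc : w ∈ unitCube d := by
      have : w = (1 - s) • x₀ + s • z := by rw [hw, smul_sub, sub_smul, one_smul]; abel
      rw [this]
      exact convex_unitCube hx₀.1 hzc (by linarith) hs0 (by ring)
    have hwx : ‖w - x₀‖ = 2 * h := by
      rw [hw, add_sub_cancel_left, norm_smul, Real.norm_of_nonneg hs0, ← dist_eq_norm, ← hDdef, hs]
      field_simp
    have hzw : dist z w = D - 2 * h := by
      have : z - w = (1 - s) • (z - x₀) := by rw [hw, sub_smul, one_smul]; abel
      rw [dist_eq_norm, this, norm_smul, Real.norm_of_nonneg (by linarith), ← dist_eq_norm,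
        ← hDdef, hs]
      field_simp
    refine hcontra k (le_max_left _ _) w hwc i (fun v hv => ?_) ?_
    · by_contra hle
      have h1 := hfar v ⟨hv.1, not_lt.mp hle⟩
      have h2 := dist_triangle z w v
      have h3 : dist w v ≤ h := by
        rw [dist_eq_norm]
        exact norm_sub_le_of_mem_cell (mem_cell_binAt hwc k) hv
      linarith
    · have h1 := gap_sub_le hf hwc hx₀.1 i
      have h2 := two_mul_rpow_le (d := d) hβ hβ1 hL (c := 2) (t := ‖w - x₀‖) (h := (1 / 2 : ℝ) ^ k)
        (by norm_num) le_rfl (by positivity) (norm_nonneg _) hwx.le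
      have h3 := hx₀.2
      have h4 : 0 ≤ ((1 / 2 : ℝ) ^ k) ^ β := by positivity
      have h5 : 2 ^ β * c0 d β L * ((1 / 2 : ℝ) ^ k) ^ β ≤
          2 * c0 d β L * ((1 / 2 : ℝ) ^ k) ^ β := by
        gcongr
        exact h2.2
      linarith [h2.1]
  · refine hcontra k₁ le_rfl z hzc i (fun v hv => ?_) ?_
    · by_contra hle
      exact hne ⟨v, hv.1, not_lt.mp hle⟩
    · have h4 : 0 ≤ ((1 / 2 : ℝ) ^ k₁) ^ β := by positivity
      nlinarith

end MarginCondition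

/-! ### Summation over the depths -/

section Summation

/-- Geometric growth beats the linear weight. Raising `D` by one adds a geometric sum, and the bound
reproduces itself because `1/(q-1)^2 + 1/(q-1) = q/(q-1)^2`. -/
lemma sum_pow_mul_sub_le {q : ℝ} (hq : 1 < q) (D : ℕ) :
    ∑ k ∈ Finset.range D, q ^ k * ((D : ℝ) - k) ≤ q ^ (D + 1) / (q - 1) ^ 2 := by
  have hq1 : 0 < q - 1 := by linarith
  induction D with
  | zero => simp; positivity
  | succ D ih =>
    have h1 : ∑ k ∈ Finset.range (D + 1), q ^ k * (((D + 1 : ℕ) : ℝ) - k) =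
        ∑ k ∈ Finset.range D, q ^ k * ((D : ℝ) - k) + ∑ k ∈ Finset.range (D + 1), q ^ k := by
      rw [Finset.sum_range_succ, Finset.sum_range_succ (f := fun k => q ^ k), ← add_assoc,
        ← Finset.sum_add_distrib]
      congr 1
      · refine Finset.sum_congr rfl fun k _ => ?_
        push_cast; ring
      · push_cast; ring
    rw [h1, geom_sum_eq hq.ne']
    have h2 : (q ^ (D + 1) - 1) / (q - 1) ≤ q ^ (D + 1) / (q - 1) := by gcongr; linarith
    have h3 : q ^ (D + 1) / (q - 1) ^ 2 + q ^ (D + 1) / (q - 1) =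
        q ^ (D + 1 + 1) / (q - 1) ^ 2 := by field_simp; ring
    linarith

lemma log_mul_log_pos {K : ℕ} (hK : 2 ≤ K) : 0 < (K : ℝ) * Real.log K := by
  have : (2 : ℝ) ≤ K := by exact_mod_cast hK
  have := Real.log_pos (show (1 : ℝ) < K by linarith)
  positivity

lemma half_le_log {K : ℕ} (hK : 2 ≤ K) : 1 / 2 ≤ Real.log K := by
  have h : (2 : ℝ) ≤ K := by exact_mod_cast hK
  have h1 := Real.log_le_log (by norm_num) h
  have := Real.log_two_gt_d9
  linarith

lemma log_mul_log_le {K : ℕ} (hK : 2 ≤ K) :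
    Real.log ((K : ℝ) * Real.log K) ≤ 2 * Real.log K := by
  have h : (2 : ℝ) ≤ K := by exact_mod_cast hK
  have h1 := half_le_log hK
  have h2 := Real.log_le_log (by linarith) (Real.log_le_self (show (0 : ℝ) ≤ K by linarith))
  rw [Real.log_mul (by positivity) (by positivity)]
  linarith

lemma two_le_of_mul_log_le {K n : ℕ} (hK : 2 ≤ K) (hn : (K : ℝ) * Real.log K ≤ n) : 2 ≤ n := by
  have h : (2 : ℝ) ≤ K := by exact_mod_cast hK
  have h1 := Real.log_le_log (by norm_num) h
  have h2 := Real.log_two_gt_d9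
  have h3 : (1 : ℝ) < n := by nlinarith
  exact_mod_cast h3

lemma le_of_mul_log_le {K n : ℕ} (hK : 2 ≤ K) (hn : (K : ℝ) * Real.log K ≤ n) : K ≤ n := by
  rcases hK.lt_or_eq with h | h
  · have h3 : (3 : ℝ) ≤ K := by exact_mod_cast h
    have h1 : 1 ≤ Real.log K := by
      rw [Real.le_log_iff_exp_le (by linarith)]
      have := Real.exp_one_lt_d9
      linarith
    have h2 : (K : ℝ) ≤ n := by nlinarith
    exact_mod_cast h2
  -- For `K = 2` the logarithm is below 1, but `n` is an integer larger than `2 log 2 > 1`.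
  · rw [← h]; exact two_le_of_mul_log_le hK hn

variable {d K n : ℕ} {β : ℝ}

lemma maxDepth_spec {q : ℝ} (hq : 0 < q) {E : ℝ} :
    (1 / 2 : ℝ) ^ sInf {k : ℕ | (1 / 2 : ℝ) ^ k ≤ q ^ (1 / E)} ≤ q ^ (1 / E) := by
  have hne : {k : ℕ | (1 / 2 : ℝ) ^ k ≤ q ^ (1 / E)}.Nonempty := by
    obtain ⟨k, hk⟩ := exists_pow_lt_of_lt_one (Real.rpow_pos_of_pos hq (1 / E))
      (show (1 / 2 : ℝ) < 1 by norm_num)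
    exact ⟨k, hk.le⟩
  exact Nat.sInf_mem hne

lemma pow_maxDepth_rpow_le (hK : 2 ≤ K) (hn : (K : ℝ) * Real.log K ≤ n) (hβ : 0 < β) :
    ((1 / 2 : ℝ) ^ maxDepth d K n β) ^ ((d : ℝ) + 2 * β) ≤ (K : ℝ) * Real.log K / n := by
  have hn0 : (0 : ℝ) < n := (log_mul_log_pos hK).trans_le hn
  have hq : 0 < (K : ℝ) * Real.log K / n := div_pos (log_mul_log_pos hK) hn0
  have hE : 0 < (d : ℝ) + 2 * β := by positivity
  have h := Real.rpow_le_rpow (by positivity) (maxDepth_spec hq (E := (d : ℝ) + 2 * β)) hE.le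
  rwa [← Real.rpow_mul hq.le, one_div_mul_cancel hE.ne', Real.rpow_one] at h

lemma lt_pow_rpow_of_lt_maxDepth (hK : 2 ≤ K) (hn : (K : ℝ) * Real.log K ≤ n) (hβ : 0 < β)
    {k : ℕ} (hk : k < maxDepth d K n β) :
    (K : ℝ) * Real.log K / n < ((1 / 2 : ℝ) ^ k) ^ ((d : ℝ) + 2 * β) := by
  have hn0 : (0 : ℝ) < n := (log_mul_log_pos hK).trans_le hn
  have hq : 0 < (K : ℝ) * Real.log K / n := div_pos (log_mul_log_pos hK) hn0
  have hE : 0 < (d : ℝ) + 2 * β := by positivity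
  have h1 : ¬ (1 / 2 : ℝ) ^ k ≤ ((K : ℝ) * Real.log K / n) ^ (1 / ((d : ℝ) + 2 * β)) :=
    Nat.notMem_of_lt_sInf (s := {k : ℕ | (1 / 2 : ℝ) ^ k ≤ _}) hk
  have h := Real.rpow_lt_rpow (by positivity) (not_le.mp h1) hE
  rwa [← Real.rpow_mul hq.le, one_div_mul_cancel hE.ne', Real.rpow_one] at h

/-- The logarithmic factor at depth `k`. -/
lemma logBar_depth_le (hK : 2 ≤ K) (hn : (K : ℝ) * Real.log K ≤ n) (hβ : 0 < β)
    {k : ℕ} (hk : k < maxDepth d K n β) :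
    logBar (n * ((1 / 2 : ℝ) ^ k) ^ ((d : ℝ) + 2 * β)) ≤
      (2 + 2 * ((d : ℝ) + 2 * β)) * Real.log K * ((maxDepth d K n β : ℝ) - k) := by
  set D := maxDepth d K n β with hD
  set E := (d : ℝ) + 2 * β with hE
  have hE0 : 0 < E := by positivity
  have hn0 : (0 : ℝ) < n := (log_mul_log_pos hK).trans_le hn
  have hlog := half_le_log hK
  have hDk : (1 : ℝ) ≤ (D : ℝ) - k := by
    have : ((k + 1 : ℕ) : ℝ) ≤ D := by exact_mod_cast hk
    push_cast at this; linarith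
  obtain ⟨j, hj⟩ : ∃ j, D = k + j := ⟨D - k, by omega⟩
  have hjD : (D : ℝ) - k = j := by rw [hj]; push_cast; ring
  rw [hjD] at hDk ⊢
  have h1 := pow_maxDepth_rpow_le (d := d) hK hn hβ
  rw [← hD, ← hE, le_div_iff₀ hn0] at h1
  -- At depth `D` the quantity `n 2^{-DE}` is at most `K log K`, and each of the `j` depths above
  -- multiplies it by `2^E`.
  have h2 : n * ((1 / 2 : ℝ) ^ k) ^ E ≤ (K : ℝ) * Real.log K * ((2 : ℝ) ^ j) ^ E := by
    have e : ((1 / 2 : ℝ) ^ k) ^ E = ((1 / 2 : ℝ) ^ D) ^ E * ((2 : ℝ) ^ j) ^ E := by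
      rw [← Real.mul_rpow (by positivity) (by positivity), hj, pow_add, mul_assoc, ← mul_pow]
      norm_num
    rw [e, ← mul_assoc, mul_comm (n : ℝ)]
    gcongr
  have h3 : Real.log (n * ((1 / 2 : ℝ) ^ k) ^ E) ≤ 2 * Real.log K + j * E := by
    refine (Real.log_le_log (by positivity) h2).trans ?_
    rw [Real.log_mul (log_mul_log_pos hK).ne' (by positivity), Real.log_rpow (by positivity),
      Real.log_pow]
    have h4 := log_mul_log_le hK
    have h5 : Real.log 2 ≤ 1 := by have := Real.log_two_lt_d9; linarith
    have h6 : E * (j * Real.log 2) ≤ E * (j * 1) := by gcongr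
    linarith
  have h7 : (0 : ℝ) ≤ j := by linarith
  refine max_le ?_ ?_
  · have h8 : Real.log K ≤ Real.log K * j := le_mul_of_one_le_right (by linarith) hDk
    -- Since `2 log K ≥ 1`, the sum of the two terms is bounded by a product, from which `log K`
    -- factors out.
    have h9 : j * E ≤ 2 * E * (Real.log K * j) := by
      have : j * E * 1 ≤ j * E * (2 * Real.log K) :=
        mul_le_mul_of_nonneg_left (by linarith) (by positivity)
      linarith
    linarith
  · have h8 : 1 ≤ 2 * Real.log K * j := one_le_mul_of_one_le_of_one_le (by linarith) hDk
    have h9 : 0 ≤ 2 * E * (Real.log K * j) := by positivity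
    linarith

end Summation

/-! ### The bounds for the two regimes -/

section Regimes

variable {d K n : ℕ} {β : ℝ}

/-- Sum of the contributions of the depths under the margin condition with `αβ ≤ d`. -/
lemma depth_sum_le_of_margin (d : ℕ) {β a : ℝ} (hβ : 0 < β) (ha : 0 < a)
    (hab : a * β ≤ d) {c₁ c₂ : ℝ} (hc₁ : 0 < c₁) (hc₂ : 0 < c₂) :
    ∃ C : ℝ, 0 < C ∧ ∀ K n : ℕ, 2 ≤ K → (K : ℝ) * Real.log K ≤ n →
      ∑ k ∈ Finset.range (maxDepth d K n β), c₁ * (((1 / 2 : ℝ) ^ k) ^ β) ^ (a + 1) *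
        (c₂ * (K * (((1 / 2 : ℝ) ^ k) ^ (-(2 * β)) *
          logBar (n * ((1 / 2 : ℝ) ^ k) ^ ((d : ℝ) + 2 * β))) * 2 ^ (k * d))) +
      n * (c₁ * (((1 / 2 : ℝ) ^ maxDepth d K n β) ^ β) ^ (a + 1)) ≤
      C * n * ((K : ℝ) * Real.log K / n) ^ (β * (a + 1) / (2 * β + d)) := by
  set E := (d : ℝ) + 2 * β with hE
  have hE0 : 0 < E := by positivity
  -- The powers of `2^{-k}` are `β(a+1)` from regret and margin, `-2β` from the rounds and `-d` from
  -- the number of bins; they add up to `-s`, and `s ≥ β > 0`.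
  set s := d + β - a * β with hs
  have hs0 : 0 < s := by rw [hs]; linarith
  set q : ℝ := 2 ^ s with hq
  have hq1 : 1 < q := Real.one_lt_rpow (by norm_num) hs0
  set c₃ := c₁ * c₂ * (2 + 2 * E) * (q ^ 2 / (q - 1) ^ 2) with hc₃
  have hq1' : 0 < q - 1 := by linarith
  have hc₃0 : 0 < c₃ := by positivity
  refine ⟨c₃ + c₁, by positivity, fun K n hK hn => ?_⟩
  set D := maxDepth d K n β with hD
  have hn0 : (0 : ℝ) < n := (log_mul_log_pos hK).trans_le hn
  have hlog := half_le_log hK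
  set Q := (K : ℝ) * Real.log K / n with hQ
  have hQ0 : 0 < Q := div_pos (log_mul_log_pos hK) hn0
  have hexp : β * (a + 1) / (2 * β + d) = β * (a + 1) / E := by
    rw [hE, add_comm (d : ℝ)]
  rw [hexp, add_mul, add_mul]
  refine add_le_add ?_ ?_
  · rcases Nat.eq_zero_or_pos D with h0 | hDpos
    · rw [h0]; simp only [Finset.range_zero, Finset.sum_empty]; positivity
    have hterm : ∀ k ∈ Finset.range D, c₁ * (((1 / 2 : ℝ) ^ k) ^ β) ^ (a + 1) *
        (c₂ * (K * (((1 / 2 : ℝ) ^ k) ^ (-(2 * β)) *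
          logBar (n * ((1 / 2 : ℝ) ^ k) ^ E)) * 2 ^ (k * d))) ≤
        c₁ * c₂ * (2 + 2 * E) * (K * Real.log K) * (q ^ k * ((D : ℝ) - k)) := by
      intro k hk
      have h1 := logBar_depth_le (d := d) hK hn hβ (Finset.mem_range.mp hk)
      rw [← hE, ← hD] at h1
      have hh : (0 : ℝ) < (1 / 2 : ℝ) ^ k := by positivity
      have e1 : (((1 / 2 : ℝ) ^ k) ^ β) ^ (a + 1) * (((1 / 2 : ℝ) ^ k) ^ (-(2 * β)) *
          2 ^ (k * d)) = q ^ k := by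
        have e2 : (2 : ℝ) ^ (k * d) = ((1 / 2 : ℝ) ^ k) ^ (-(d : ℝ)) := by
          rw [Real.rpow_neg hh.le, Real.rpow_natCast, ← pow_mul, one_div, inv_pow, inv_inv]
        have e3 : q ^ k = ((1 / 2 : ℝ) ^ k) ^ (-s) := by
          rw [Real.rpow_neg hh.le, hq, ← Real.rpow_natCast, ← Real.rpow_mul (by norm_num),
            ← Real.rpow_natCast, ← Real.rpow_mul (by norm_num), one_div,
            Real.inv_rpow (by norm_num), inv_inv, mul_comm]
        rw [e2, e3, ← Real.rpow_mul hh.le, ← Real.rpow_add hh, ← Real.rpow_add hh, hs]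
        congr 1; ring
      calc _ = c₁ * c₂ * K * ((((1 / 2 : ℝ) ^ k) ^ β) ^ (a + 1) *
            (((1 / 2 : ℝ) ^ k) ^ (-(2 * β)) * 2 ^ (k * d))) *
            logBar (n * ((1 / 2 : ℝ) ^ k) ^ E) := by ring
        _ = c₁ * c₂ * K * q ^ k * logBar (n * ((1 / 2 : ℝ) ^ k) ^ E) := by rw [e1]
        _ ≤ c₁ * c₂ * K * q ^ k * ((2 + 2 * E) * Real.log K * ((D : ℝ) - k)) := by gcongr
        _ = _ := by ring
    refine (Finset.sum_le_sum hterm).trans ?_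
    rw [← Finset.mul_sum]
    have h2 := sum_pow_mul_sub_le hq1 D
    -- The definition of `D` bounds `2^{-D}` from above only. A lower bound on the side comes from
    -- minimality at the previous depth `D'`, at the cost of a factor `q`.
    obtain ⟨D', hD'⟩ : ∃ D', D = D' + 1 := ⟨D - 1, by omega⟩
    have h3 := lt_pow_rpow_of_lt_maxDepth (d := d) hK hn hβ (k := D') (by omega)
    rw [← hE, ← hQ] at h3
    have h4 : q ^ D' ≤ Q ^ (-(s / E)) := by
      have hh : (0 : ℝ) < (1 / 2 : ℝ) ^ D' := by positivity
      have e3 : q ^ D' = (((1 / 2 : ℝ) ^ D') ^ E) ^ (-(s / E)) := by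
        rw [← Real.rpow_mul hh.le, show E * -(s / E) = -s by field_simp,
          Real.rpow_neg hh.le, hq, ← Real.rpow_natCast, ← Real.rpow_mul (by norm_num),
          ← Real.rpow_natCast, ← Real.rpow_mul (by norm_num), one_div,
          Real.inv_rpow (by norm_num), inv_inv, mul_comm]
      rw [e3]
      exact Real.rpow_le_rpow_of_nonpos hQ0 h3.le (by rw [neg_nonpos]; positivity)
    have h5 : (K : ℝ) * Real.log K = n * Q := by rw [hQ]; field_simp
    -- The exponents match because `E - s = β (a + 1)`.
    have h6 : Q * Q ^ (-(s / E)) = Q ^ (β * (a + 1) / E) := by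
      nth_rewrite 1 [← Real.rpow_one Q]
      rw [← Real.rpow_add hQ0]
      congr 1
      rw [hs]; field_simp; rw [hE]; ring
    calc c₁ * c₂ * (2 + 2 * E) * (K * Real.log K) * ∑ k ∈ Finset.range D, q ^ k * ((D : ℝ) - k)
        ≤ c₁ * c₂ * (2 + 2 * E) * (n * Q) * (q ^ 2 / (q - 1) ^ 2 * q ^ D') := by
          rw [h5]
          have : q ^ (D + 1) / (q - 1) ^ 2 = q ^ 2 / (q - 1) ^ 2 * q ^ D' := by
            rw [hD']; ring
          rw [← this]
          gcongr
      _ ≤ c₁ * c₂ * (2 + 2 * E) * (n * Q) * (q ^ 2 / (q - 1) ^ 2 * Q ^ (-(s / E))) := by gcongr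
      _ = c₃ * n * (Q * Q ^ (-(s / E))) := by rw [hc₃]; ring
      _ = _ := by rw [h6]
  · have h1 := pow_maxDepth_rpow_le (d := d) hK hn hβ
    rw [← hE, ← hD, ← hQ] at h1
    have hh : (0 : ℝ) < (1 / 2 : ℝ) ^ D := by positivity
    have h2 : (((1 / 2 : ℝ) ^ D) ^ β) ^ (a + 1) ≤ Q ^ (β * (a + 1) / E) := by
      have h3 := Real.rpow_le_rpow (by positivity) h1
        (show 0 ≤ β * (a + 1) / E by positivity)
      rw [← Real.rpow_mul hh.le] at h3 ⊢
      rwa [show E * (β * (a + 1) / E) = β * (a + 1) by field_simp] at h3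
    calc n * (c₁ * (((1 / 2 : ℝ) ^ D) ^ β) ^ (a + 1)) ≤ n * (c₁ * Q ^ (β * (a + 1) / E)) := by
          gcongr
      _ = _ := by ring

/-- Sum of the contributions of the depths when only finitely many of them matter. -/
lemma depth_sum_le_of_gap (d k₁ : ℕ) {β : ℝ} (hβ : 0 < β) {c₁ c₂ : ℝ} (hc₁ : 0 < c₁)
    (hc₂ : 0 < c₂) :
    ∃ C : ℝ, 0 < C ∧ ∀ (K n : ℕ) (p : ℕ → ℝ), 2 ≤ K → (K : ℝ) * Real.log K ≤ n →
      (∀ k, 0 ≤ p k ∧ p k ≤ 1) → (∀ k ≥ k₁, p k = 0) →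
      ∑ k ∈ Finset.range (maxDepth d K n β), p k * (c₁ * ((1 / 2 : ℝ) ^ k) ^ β) *
        (c₂ * (K * (((1 / 2 : ℝ) ^ k) ^ (-(2 * β)) *
          logBar (n * ((1 / 2 : ℝ) ^ k) ^ ((d : ℝ) + 2 * β))) * 2 ^ (k * d))) +
      n * (p (maxDepth d K n β) * (c₁ * ((1 / 2 : ℝ) ^ maxDepth d K n β) ^ β)) ≤
      C * K * Real.log n := by
  set E := (d : ℝ) + 2 * β with hE
  have hE0 : 0 < E := by positivity
  set S := ∑ k ∈ Finset.range k₁, ((1 / 2 : ℝ) ^ k) ^ (-(2 * β)) * 2 ^ (k * d) with hS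
  have hS0 : 0 ≤ S := Finset.sum_nonneg fun k _ => by positivity
  set c₄ := c₁ * (((1 / 2 : ℝ) ^ k₁) ^ E)⁻¹ with hc₄
  refine ⟨2 * c₁ * c₂ * S + c₄, by positivity, fun K n p hK hn hp hp0 => ?_⟩
  set D := maxDepth d K n β with hD
  have hn0 : (0 : ℝ) < n := (log_mul_log_pos hK).trans_le hn
  have hn2 := half_le_log (two_le_of_mul_log_le hK hn)
  have hle1 : ∀ k : ℕ, (1 / 2 : ℝ) ^ k ≤ 1 := fun k => pow_le_one₀ (by norm_num) (by norm_num)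
  have hrp : ∀ k : ℕ, ∀ e : ℝ, 0 ≤ e → ((1 / 2 : ℝ) ^ k) ^ e ≤ 1 := fun k e he =>
    Real.rpow_le_one (by positivity) (hle1 k) he
  rw [add_mul, add_mul]
  refine add_le_add ?_ ?_
  · have hlb : ∀ k : ℕ, logBar (n * ((1 / 2 : ℝ) ^ k) ^ E) ≤ 2 * Real.log n := by
      intro k
      refine max_le ?_ (by linarith)
      have : n * ((1 / 2 : ℝ) ^ k) ^ E ≤ n := mul_le_of_le_one_right hn0.le (hrp k E hE0.le)
      have := Real.log_le_log (by positivity) this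
      linarith
    have hF : ∀ k ∈ Finset.range D, p k * (c₁ * ((1 / 2 : ℝ) ^ k) ^ β) *
        (c₂ * (K * (((1 / 2 : ℝ) ^ k) ^ (-(2 * β)) *
          logBar (n * ((1 / 2 : ℝ) ^ k) ^ E)) * 2 ^ (k * d))) ≤
        if k < k₁ then 2 * c₁ * c₂ * K * Real.log n *
          (((1 / 2 : ℝ) ^ k) ^ (-(2 * β)) * 2 ^ (k * d)) else 0 := by
      intro k _
      split_ifs with hk
      · have hl := hlb k
        have hb := hrp k β hβ.le
        have hlb0 : 0 ≤ logBar (n * ((1 / 2 : ℝ) ^ k) ^ E) := by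
          linarith [logBar_ge_one (n * ((1 / 2 : ℝ) ^ k) ^ E)]
        calc _ ≤ 1 * (c₁ * 1) * (c₂ * (K * (((1 / 2 : ℝ) ^ k) ^ (-(2 * β)) *
              (2 * Real.log n)) * 2 ^ (k * d))) := by
              gcongr
              exact (hp k).2
          _ = _ := by ring
      · rw [hp0 k (not_lt.mp hk)]; simp
    refine (Finset.sum_le_sum hF).trans ?_
    rw [← Finset.sum_filter]
    calc _ ≤ ∑ k ∈ Finset.range k₁, 2 * c₁ * c₂ * K * Real.log n *
          (((1 / 2 : ℝ) ^ k) ^ (-(2 * β)) * 2 ^ (k * d)) := by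
          refine Finset.sum_le_sum_of_subset_of_nonneg (fun k hk => ?_) fun k _ _ => ?_
          · exact Finset.mem_range.mpr (Finset.mem_filter.mp hk).2
          · have : 0 ≤ Real.log n := by linarith
            positivity
      _ = _ := by rw [← Finset.mul_sum, ← hS]; ring
  -- If `D` is at least `k₁`, the last term vanishes. Otherwise the side at depth `D` is bounded
  -- below, so `n` is at most a constant times `K log K`, and the trivial bound `c₁ n` is enough.
  · rcases Nat.lt_or_ge D k₁ with h | h
    · have h1 := pow_maxDepth_rpow_le (d := d) hK hn hβ
      rw [← hE, ← hD] at h1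
      have h2 : ((1 / 2 : ℝ) ^ k₁) ^ E ≤ ((1 / 2 : ℝ) ^ D) ^ E :=
        Real.rpow_le_rpow (by positivity) (pow_le_pow_of_le_one (by norm_num) (by norm_num) h.le)
          hE0.le
      have h3 := h2.trans h1
      have hx : 0 < ((1 / 2 : ℝ) ^ k₁) ^ E := by positivity
      rw [le_div_iff₀ hn0] at h3
      have hKn : (K : ℝ) ≤ n := by exact_mod_cast le_of_mul_log_le hK hn
      have hK0 : (0 : ℝ) < K := by positivity
      have h4 : (K : ℝ) * Real.log K ≤ K * Real.log n := by
        gcongr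
      have h5 : (n : ℝ) ≤ (((1 / 2 : ℝ) ^ k₁) ^ E)⁻¹ * (K * Real.log n) := by
        rw [inv_mul_eq_div, le_div_iff₀ hx]
        linarith
      calc n * (p D * (c₁ * ((1 / 2 : ℝ) ^ D) ^ β)) ≤ n * (1 * (c₁ * 1)) := by
            gcongr
            · exact (hp D).2
            · exact hrp D β hβ.le
        _ = c₁ * n := by ring
        _ ≤ c₁ * ((((1 / 2 : ℝ) ^ k₁) ^ E)⁻¹ * (K * Real.log n)) := by gcongr
        _ = _ := by rw [hc₄]; ring
    · rw [hp0 D h]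
      have : 0 ≤ Real.log n := by linarith
      simp only [zero_mul, mul_zero]
      positivity

end Regimes

/-! ### The regret bound -/

section Main

/-- The bound for the expected regret, with explicit numbers of rounds. -/
lemma exists_integral_abseRegret_le (d : ℕ) (hd : 1 ≤ d) {β L clow cup : ℝ} (hβ : 0 < β)
    (hβ1 : β ≤ 1) (hL : 0 < L) (hclow : 0 < clow) :
    ∃ c : ℝ, 0 < c ∧ ∀ (K : ℕ) [NeZero K] (n : ℕ), 0 < n →
      ∀ (Ω : Type u) [MeasurableSpace Ω] (μ : Measure Ω) [IsProbabilityMeasure μ]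
        (PX : Measure (Cov d)) (f : Fin K → Cov d → ℝ) (X : ℕ → Ω → Cov d)
        (Y : ℕ → Fin K → Ω → ℝ), IsMachine μ PX f X Y → HasBoundedDensity PX clow cup →
        Smoothness f β L →
        ∫ ω, abseRegret n β L f X Y ω ∂μ ≤
          ∑ k ∈ Finset.range (maxDepth d K n β),
            PX.real (marginSet f (gapBound d β L k)) * gapBound d β L k *
            (c * (K * (((1 / 2 : ℝ) ^ k) ^ (-(2 * β)) *
              logBar (n * ((1 / 2 : ℝ) ^ k) ^ ((d : ℝ) + 2 * β))) * 2 ^ (k * d))) +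
          n * (PX.real (marginSet f (gapBound d β L (maxDepth d K n β))) *
            gapBound d β L (maxDepth d K n β)) := by
  obtain ⟨C, hC, hround⟩ := exists_roundLimit_le d hd β L hβ hL
  refine ⟨(1 / clow + 4) * C, by positivity, fun K _ n hn Ω _ μ _ PX f X Y hM hD hf => ?_⟩
  refine (hM.integral_abseRegret_le hβ hf (hM.regular hd hβ hβ1 hL hf hclow hD hn) hclow hD hn
    (ℓ := fun k => C * ((1 / 2 : ℝ) ^ k) ^ (-(2 * β)) *
      logBar (n * ((1 / 2 : ℝ) ^ k) ^ ((d : ℝ) + 2 * β))) (hround n hn)).trans (le_of_eq ?_)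
  congr 1
  refine Finset.sum_congr rfl fun k _ => ?_
  ring

end Main

end CovariateBandit

end

/-! ### The two regimes of the margin exponent -/

theorem theorem3 (d : ℕ) (hd : 1 ≤ d) (β L : ℝ) (hβ : 0 < β) (hβ1 : β ≤ 1) (hL : 0 < L)
    (α : ℝ≥0∞) (hα : 0 < α) (clow cup δ₀ C₀ : ℝ) (hclow : 0 < clow) (hcup : 0 < cup)
    (hδ₀ : 0 < δ₀) (hδ₀1 : δ₀ < 1) (hC₀ : 0 < C₀) :
    ∃ C : ℝ, 0 < C ∧
      ∀ (K : ℕ) [NeZero K] (n : ℕ), 2 ≤ K → (K : ℝ) * Real.log K ≤ n →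
      ∀ (Ω : Type u) [MeasurableSpace Ω] (μ : Measure Ω) [IsProbabilityMeasure μ]
        (PX : Measure (CovariateBandit.Cov d)) (f : Fin K → CovariateBandit.Cov d → ℝ)
        (X : ℕ → Ω → CovariateBandit.Cov d) (Y : ℕ → Fin K → Ω → ℝ),
        CovariateBandit.IsMachine μ PX f X Y →
        CovariateBandit.HasBoundedDensity PX clow cup →
        CovariateBandit.Smoothness f β L →
        CovariateBandit.Margin PX f α δ₀ C₀ →
        Integrable (CovariateBandit.abseRegret n β L f X Y) μ ∧
        (α ≠ ⊤ → α.toReal * β ≤ d →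
          ∫ ω, CovariateBandit.abseRegret n β L f X Y ω ∂μ ≤
            C * n * ((K : ℝ) * Real.log K / n) ^ (β * (α.toReal + 1) / (2 * β + d))) ∧
        ((α = ⊤ ∨ d < α.toReal * β) →
          ∫ ω, CovariateBandit.abseRegret n β L f X Y ω ∂μ ≤ C * K * Real.log n) := by
  have hc0 := CovariateBandit.c0_pos (β := β) hd hL
  obtain ⟨c, hc, hbound⟩ := CovariateBandit.exists_integral_abseRegret_le.{u} d hd (cup := cup) hβ hβ1 hL hclow
  set G : ℝ := max (14 * CovariateBandit.c0 d β L) 1 with hG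
  have hG0 : 0 < G := lt_of_lt_of_le one_pos (le_max_right _ _)
  have hgap : ∀ k, CovariateBandit.gapBound d β L k = G * ((1 / 2 : ℝ) ^ k) ^ β := fun k => rfl
  have hn0 : ∀ K n : ℕ, 2 ≤ K → (K : ℝ) * Real.log K ≤ n → 0 < n := fun K n hK hn =>
    lt_of_lt_of_le two_pos (CovariateBandit.two_le_of_mul_log_le hK hn)
  by_cases hcase : α ≠ ⊤ ∧ α.toReal * β ≤ d
  · have ha : 0 < α.toReal := ENNReal.toReal_pos hα.ne' hcase.1
    set a := α.toReal
    set C₁ := C₀ + δ₀ ^ (-a)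
    have hC₁ : 0 < C₁ := by positivity
    obtain ⟨C, hC, hsum⟩ := CovariateBandit.depth_sum_le_of_margin d hβ ha hcase.2
      (show 0 < C₁ * G ^ (a + 1) by positivity) hc
    refine ⟨C, hC, fun K _ n hK hn Ω _ μ _ PX f X Y hM hD hf hmar => ?_⟩
    have hPX := hM.isProbabilityMeasure
    have hp : ∀ k, PX.real (CovariateBandit.marginSet f (CovariateBandit.gapBound d β L k)) * CovariateBandit.gapBound d β L k ≤
        C₁ * G ^ (a + 1) * (((1 / 2 : ℝ) ^ k) ^ β) ^ (a + 1) := by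
      intro k
      have h0 : 0 < CovariateBandit.gapBound d β L k := by rw [hgap]; positivity
      have h1 := hmar.measure_marginSet_le hδ₀ hC₀ ha (Or.inr rfl) h0.le
      calc _ ≤ C₁ * CovariateBandit.gapBound d β L k ^ a * CovariateBandit.gapBound d β L k := by gcongr
        _ = C₁ * CovariateBandit.gapBound d β L k ^ (a + 1) := by rw [Real.rpow_add_one h0.ne']; ring
        _ = _ := by rw [hgap, Real.mul_rpow hG0.le (by positivity)]; ring
    refine ⟨hM.integrable_abseRegret hβ hf, fun _ _ => ?_, fun h => ?_⟩
    · refine (hbound K n (hn0 K n hK hn) Ω μ PX f X Y hM hD hf).trans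
        (le_trans ?_ (hsum K n hK hn))
      refine add_le_add (Finset.sum_le_sum fun k _ => ?_) ?_
      · refine mul_le_mul_of_nonneg_right (hp k) ?_
        have := CovariateBandit.logBar_ge_one (n * ((1 / 2 : ℝ) ^ k) ^ ((d : ℝ) + 2 * β))
        positivity
      · exact mul_le_mul_of_nonneg_left (hp _) (Nat.cast_nonneg n)
    · rcases h with h | h
      · exact absurd h hcase.1
      · exact absurd hcase.2 (not_le.mpr h)
  · have hd0 : (0 : ℝ) < d := by exact_mod_cast hd
    -- For `α = ∞` the margin condition holds with any finite exponent; `2 d / β` is one that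
    -- satisfies `d < aβ`.
    obtain ⟨a, ha, haα, hab⟩ : ∃ a : ℝ, 0 < a ∧ (α = ⊤ ∨ α.toReal = a) ∧ d < a * β := by
      by_cases hα' : α = ⊤
      · refine ⟨2 * d / β, by positivity, Or.inl hα', ?_⟩
        rw [div_mul_cancel₀ _ hβ.ne']
        linarith
      · exact ⟨α.toReal, ENNReal.toReal_pos hα.ne' hα', Or.inr rfl,
          not_le.mp fun h => hcase ⟨hα', h⟩⟩
    set C₁ := C₀ + δ₀ ^ (-a)
    obtain ⟨Δ, hΔ, hempty⟩ := CovariateBandit.exists_marginSet_eq_empty d hd (C := C₁) hβ hβ1 hL hclow hab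
    -- From depth `k₁` on, `gapBound` is below the smallest positive gap and the margin sets are
    -- empty.
    obtain ⟨k₁, hk₁⟩ := exists_pow_lt_of_lt_one (show 0 < Δ / G by positivity)
      (Real.rpow_lt_one (by norm_num) (by norm_num) hβ : (1 / 2 : ℝ) ^ β < 1)
    obtain ⟨C, hC, hsum⟩ := CovariateBandit.depth_sum_le_of_gap d k₁ hβ hG0 hc
    refine ⟨C, hC, fun K _ n hK hn Ω _ μ _ PX f X Y hM hD hf hmar => ?_⟩
    have hPX := hM.isProbabilityMeasure
    refine ⟨hM.integrable_abseRegret hβ hf, fun h1 h2 => absurd ⟨h1, h2⟩ hcase, fun _ => ?_⟩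
    refine (hbound K n (hn0 K n hK hn) Ω μ PX f X Y hM hD hf).trans
      (hsum K n (fun k => PX.real (CovariateBandit.marginSet f (CovariateBandit.gapBound d β L k))) hK hn
        (fun k => ⟨measureReal_nonneg, measureReal_le_one⟩) fun k hk => ?_)
    have hlt : CovariateBandit.gapBound d β L k < Δ := by
      have h1 : ((1 / 2 : ℝ) ^ k) ^ β ≤ ((1 / 2 : ℝ) ^ k₁) ^ β :=
        Real.rpow_le_rpow (by positivity) (pow_le_pow_of_le_one (by norm_num) (by norm_num) hk)
          hβ.le
      have h2 : ((1 / 2 : ℝ) ^ k₁) ^ β = ((1 / 2 : ℝ) ^ β) ^ k₁ := by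
        rw [← Real.rpow_natCast, ← Real.rpow_natCast, ← Real.rpow_mul (by norm_num),
          ← Real.rpow_mul (by norm_num), mul_comm]
      rw [h2] at h1
      have h3 := h1.trans_lt hk₁
      rw [lt_div_iff₀ hG0] at h3
      rw [hgap]
      linarith
    have := hempty K PX f hPX hf (fun k A hA => hD.le_measure_cell hclow.le hA)
      (fun δ hδ => hmar.measure_marginSet_le hδ₀ hC₀ ha haα hδ) _ hlt
    simp only [this, measureReal_empty]
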